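/- Let $C$ be a finite commutative group of odd order $n$ with unit $e$, let $\chi\colon C\times C\to\mathbb C^\times$ be a non-degenerate symmetric bicharacter, $\kappa\in\mathbb R$ with $\kappa^2=1/n$, $q\colon C\to\mathbb C^\times$ with $q(a^{-1})=q(a)$ and $\chi(a,b)=\frac{q(ab)}{q(a)q(b)}$, and $\delta\in\mathbb C$ with $\delta^2=\kappa\sum_{a\in C}q(a)^{-1}$. Let $\mathcal{TY}=\mathcal{TY}(C,q,\kappa,\delta)$ be the Tambara--Yamagami category: the semisimple $\mathbb C$-linear category with simple objects $a\in C$ (in degree $1$) and $\sigma$ (in degree $-1$), fusion rules $a\otimes b=ab$, $a\otimes\sigma=\sigma=\sigma\otimes a$, $\sigma\otimes\sigma=\bigoplus_{x\in C}x$, unit $e$ with trivial unitors, and non-trivial associators $X\otimes(Y\otimes Z)\to(X\otimes Y)\otimes Z$ $$a_{a,\sigma,b}=\chi(a,b)\,\mathrm{id}_\sigma,\qquad a_{\sigma,a,\sigma}=\bigoplus_{x}\chi(a,x)\,\mathrm{id}_x,\qquad a_{\sigma,\sigma,\sigma}=\big(\kappa\,\chi(x,y)^{-1}\,\mathrm{id}_\sigma\big)_{x,y\in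 C}.$$ Its duals are $a^*=a^{-1}$ with trivial evaluation and coevaluation and $\sigma^*=\sigma$ with $\mathrm{ev}_\sigma=\kappa^{-1}\mathrm{pr}\colon\sigma\otimes\sigma\to e$, $\mathrm{coev}_\sigma=\mathrm{incl}\colon e\to\sigma\otimes\sigma$; the pivotal structure is $j_a=\mathrm{id}_a$, $j_\sigma=\mathrm{sgn}(\kappa)\,\mathrm{id}_\sigma$. The group $\mathbb Z_2=\{1,-1\}$ acts strictly by $\rho_{-1}(a)=a^{-1}$, $\rho_{-1}(\sigma)=\sigma$, and the $\mathbb Z_2$-crossed braiding $c_{X,Y}\colon X\otimes Y\to Y\otimes\rho_h(X)$, for $Y$ of degree $h$, is $$c_{a,b}=\chi(a,b)\,\mathrm{id}_{ab},\qquad c_{a,\sigma}=c_{\sigma,a}=q(a)^{-1}\mathrm{id}_\sigma,\qquad c_{\sigma,\sigma}=\bigoplus_{x\in C}\delta q(x)\,\mathrm{id}_x.$$ Let $\mathcal{TY}^{\mathbb Z_2}$ be the equivariantisation. Its objects are pairs $(X,u)$ with isomorphisms $u_g\colon\rho_g(X)\to X$ such that $u_g\circ\rho_g(u_h)=u_{hg}$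 (under $\rho_g\rho_h=\rho_{hg}$); its morphisms are the morphisms $f$ with $f\circ u_g=v_g\circ\rho_g(f)$; the tensor product is $(X,u)\otimes(Y,v)=(X\otimes Y,\,(u_g\otimes v_g)\circ(\rho_g^2)^{-1})$, where $\rho_g^2\colon\rho_g(X)\otimes\rho_g(Y)\to\rho_g(X\otimes Y)$; evaluation, coevaluation and pivotal structure are those of the underlying objects. Put $$X_\pm=(e,\ u_{-1}=\pm\mathrm{id}),\qquad Y_a=(a\oplus a^{-1},\ u_{-1}=\mathrm{id})\ \ (a\in C\setminus\{e\}),\qquad Z_\pm=(\sigma,\ u_{-1}=\pm\mathrm{id}),$$ where for $Y_a$ the identity $\rho_{-1}(a\oplus a^{-1})=a^{-1}\oplus a\to a\oplus a^{-1}$ exchanges the two positions. 1. (Simple objects) $X_\pm$, $Y_a$ and $Z_\pm$ are simple, every simple object of $\mathcal{TY}^{\mathbb Z_2}$ is isomorphic to one of them, and the only isomorphisms between differently labelled ones are $Y_a\cong Y_{a^{-1}}$; so there are $\frac{n-1}2$ classes of objects $Y_a$. The objects $X_\pm$ are invertible. The dimensions are $\dim X_\pm=1$, $\dim Y_a=2$,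 $\dim Z_\pm=\sqrt n$. 2. (Monoidal structure) $X_+$ is the monoidal unit, and the associators and unitors are those of the underlying objects of $\mathcal{TY}$. Writing $X_s,Z_s$ with $s\in\{1,-1\}$ for $X_\pm,Z_\pm$, and $Y_e:=X_+\oplus X_-$, the fusion rules are, for $s,t\in\{1,-1\}$ and $a,b\in C\setminus\{e\}$, $$X_s\otimes X_t\cong X_{st},\quad X_s\otimes Y_a\cong Y_a\cong Y_a\otimes X_s,\quad X_s\otimes Z_t\cong Z_{st}\cong Z_s\otimes X_t,\quad Y_a\otimes Y_b\cong Y_{ab}\oplus Y_{ab^{-1}},$$ $$Y_a\otimes Z_s\cong Z_+\oplus Z_-\cong Z_s\otimes Y_a,\qquad Z_s\otimes Z_t\cong X_{st}\oplus\bigoplus_{\{x,x^{-1}\}\subseteq C\setminus\{e\}}Y_x,$$ where the last sum runs over the orbits of $x\mapsto x^{-1}$ on $C\setminus\{e\}$. 3. (Braiding) The morphisms $c^{\mathbb Z_2}_{(X,u),(Y,v)}=\bigoplus_{h\in\mathbb Z_2}(\mathrm{id}_{Y_h}\otimes u_h)\circ c_{X,Y_h}$, where $Y_h$ is the degree $h$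 part of $Y$, form a braiding on $\mathcal{TY}^{\mathbb Z_2}$. On the simple objects its components are $$c_{X_s,X_t}=\mathrm{id}_e,\qquad c_{X_s,Y_a}=c_{Y_a,X_s}=\mathrm{id}_{a\oplus a^{-1}},\qquad c_{Y_a,Y_b}=\chi(a,b)\,\mathrm{id}_{ab\oplus(ab)^{-1}}\oplus\chi(a,b^{-1})\,\mathrm{id}_{ab^{-1}\oplus a^{-1}b},$$ $$c_{Z_s,X_t}=\mathrm{id}_\sigma,\qquad c_{Z_s,Y_a}=c_{Y_a,Z_s}=q(a)^{-1}\mathrm{id}_{\sigma\oplus\sigma},\qquad c_{X_s,Z_t}=s\,\mathrm{id}_\sigma,\qquad c_{Z_s,Z_t}=s\bigoplus_{x\in C}\delta q(x)\,\mathrm{id}_x.$$ Here $c_{M,N}$ sends the summand of $M\otimes N$ coming from simple summands $i$ of $M$ and $k$ of $N$ to the one of $N\otimes M$ coming from $k$ and $i$, except that $c_{Y_a,Z_s}$ sends $a^{\pm1}\otimes\sigma$ to $\sigma\otimes a^{\mp1}$. -/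

import Mathlib

open CategoryTheory MonoidalCategory Limits

universe u

noncomputable section

namespace TambaraYamagami

open scoped Classical

/-! ### The data and the set of simple labels -/

/-- The data `(q, κ, δ)` of a pivotal `ℤ/2`-crossed braided Tambara–Yamagami category on the finite
commutative group `C`: a non-degenerate symmetric bicharacter `χ`, a square root `κ` of `1/|C|`,
a quadratic form `q` with associated bicharacter `χ`, and a square root `δ` of `κ ∑ q(a)⁻¹`. -/
structure Datum (C : Type u) [CommGroup C] [Fintype C] where
  χ : C →* C →* ℂˣ
  χ_symm : ∀ a b, χ a b = χ b a
  χ_nondeg : ∀ b, (∀ a, χ a b = 1) → b = 1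
  κ : ℝ
  κ_sq : κ ^ 2 = 1 / (Fintype.card C : ℝ)
  q : C → ℂˣ
  q_inv : ∀ a, q a⁻¹ = q a
  q_mul : ∀ a b, χ a b = q (a * b) / (q a * q b)
  δ : ℂ
  δ_sq : δ ^ 2 = (κ : ℂ) * ∑ a : C, (q a : ℂ)⁻¹

/-- Labels of the simple objects: the elements of `C` and one further object `σ`. -/
inductive Label (C : Type u) : Type u
  | elt (a : C) : Label C
  | sigma : Label C

open Label

section Labels

variable {C : Type u}

instance [Fintype C] : Fintype (Label C) :=
  Fintype.ofSurjective (fun o : Option C => o.elim sigma elt) (by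
    rintro (a | _)
    · exact ⟨some a, rfl⟩
    · exact ⟨none, rfl⟩)

variable [CommGroup C]

/-- `Fuses s t w`: the simple object `w` is a summand (with multiplicity one) of `s ⊗ t`, i.e.
`a ⊗ b = ab`, `a ⊗ σ = σ = σ ⊗ a`, `σ ⊗ σ = ⨁ x, x`. -/
def Fuses : Label C → Label C → Label C → Prop
  | elt a, elt b, elt c => a * b = c
  | elt _, sigma, sigma => True
  | sigma, elt _, sigma => True
  | sigma, sigma, elt _ => True
  | _, _, _ => False

/-- The `ℤ/2 = {1,-1}`-action on labels: `-1` sends `a` to `a⁻¹` and fixes `σ`. -/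
instance : MulAction ℤˣ (Label C) where
  smul g
    | elt a => elt (a ^ (g : ℤ))
    | sigma => sigma
  one_smul s := by
    cases s
    · change elt _ = _; simp
    · rfl
  mul_smul g h s := by
    cases s
    · change elt _ = elt _; rw [← zpow_mul, Units.val_mul, mul_comm]
    · rfl

@[simp] theorem smul_elt (g : ℤˣ) (a : C) : g • (elt a) = elt (a ^ (g : ℤ)) := rfl

@[simp] theorem smul_sigma (g : ℤˣ) : g • (sigma : Label C) = sigma := rfl

theorem Fuses.smul {s t w : Label C} (g : ℤˣ) (h : Fuses s t w) :
    Fuses (g • s) (g • t) (g • w) := by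
  cases s <;> cases t <;> cases w <;> simp_all [Fuses, ← mul_zpow]

/-- The degree of a simple object in the `ℤ/2`-grading. -/
def Label.deg : Label C → ℤˣ
  | elt _ => 1
  | sigma => -1

end Labels

/-! ### The semisimple category -/

variable {C : Type u} [CommGroup C] [Fintype C]

/-- Objects of `TY(C,q,κ,δ)`: finite formal direct sums `⨁ i, lab i` of simple objects. -/
structure TY (D : Datum C) where
  ι : Type u
  [fin : Fintype ι]
  lab : ι → Label C

attribute [instance] TY.fin

variable {D : Datum C}

namespace TY

/-- Morphisms `⨁ i, s i ⟶ ⨁ j, t j`: complex matrices whose `(i,j)` entry is the component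
`s i ⟶ t j`, a multiple of the identity if `s i = t j` and zero otherwise. -/
@[ext]
structure Hom (X Y : TY D) where
  mat : Matrix X.ι Y.ι ℂ
  homog : ∀ i j, X.lab i ≠ Y.lab j → mat i j = 0

instance : Category (TY D) where
  Hom X Y := Hom X Y
  id X := ⟨1, fun i j h => Matrix.one_apply_ne (by rintro rfl; exact h rfl)⟩
  comp {X Y Z} f g := ⟨f.mat * g.mat, fun i j h => by
    rw [Matrix.mul_apply]
    refine Finset.sum_eq_zero fun k _ => ?_
    by_cases h1 : X.lab i = Y.lab k
    · rw [g.homog k j (h1 ▸ h), mul_zero]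
    · rw [f.homog i k h1, zero_mul]⟩
  id_comp f := Hom.ext (Matrix.one_mul _)
  comp_id f := Hom.ext (Matrix.mul_one _)
  assoc f g h := Hom.ext (Matrix.mul_assoc _ _ _)

/-- The matrix of a morphism. -/
def mat {X Y : TY D} (f : X ⟶ Y) : Matrix X.ι Y.ι ℂ := Hom.mat f

@[ext] theorem hom_ext {X Y : TY D} {f g : X ⟶ Y} (h : mat f = mat g) : f = g := Hom.ext h

theorem mat_homog {X Y : TY D} (f : X ⟶ Y) {i : X.ι} {j : Y.ι} (h : X.lab i ≠ Y.lab j) :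
    mat f i j = 0 := Hom.homog f i j h

theorem lab_eq {X Y : TY D} (f : X ⟶ Y) {i : X.ι} {j : Y.ι} (h : mat f i j ≠ 0) :
    X.lab i = Y.lab j := by
  by_contra h'
  exact h (mat_homog f h')

@[simp] theorem mat_id (X : TY D) : mat (𝟙 X) = 1 := rfl

@[simp] theorem mat_comp {X Y Z : TY D} (f : X ⟶ Y) (g : Y ⟶ Z) : mat (f ≫ g) = mat f * mat g :=
  rfl

instance (X Y : TY D) : Zero (X ⟶ Y) := ⟨⟨0, fun _ _ _ => rfl⟩⟩

instance (X Y : TY D) : Add (X ⟶ Y) :=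
  ⟨fun f g => ⟨mat f + mat g, fun i j h => by simp [mat_homog f h, mat_homog g h]⟩⟩

instance (X Y : TY D) : Neg (X ⟶ Y) :=
  ⟨fun f => ⟨-mat f, fun i j h => by simp [mat_homog f h]⟩⟩

instance (X Y : TY D) : AddCommGroup (X ⟶ Y) where
  add_assoc _ _ _ := hom_ext (add_assoc _ _ _)
  zero_add _ := hom_ext (zero_add _)
  add_zero _ := hom_ext (add_zero _)
  neg_add_cancel _ := hom_ext (neg_add_cancel _)
  add_comm _ _ := hom_ext (add_comm _ _)
  nsmul := nsmulRec
  zsmul := zsmulRec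

@[simp] theorem mat_zero (X Y : TY D) : mat (0 : X ⟶ Y) = 0 := rfl
@[simp] theorem mat_add {X Y : TY D} (f g : X ⟶ Y) : mat (f + g) = mat f + mat g := rfl
@[simp] theorem mat_neg {X Y : TY D} (f : X ⟶ Y) : mat (-f) = -mat f := rfl

instance : Preadditive (TY D) where
  add_comp _ _ _ f f' g := hom_ext (by simp [Matrix.add_mul])
  comp_add _ _ _ f g g' := hom_ext (by simp [Matrix.mul_add])

/-- A label-preserving bijection of the summands, scaled by a non-zero scalar, as an isomorphism. -/
def isoOfEquiv {X Y : TY D} (e : X.ι ≃ Y.ι) (he : ∀ i, X.lab i = Y.lab (e i)) (c : ℂˣ := 1) :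
    X ≅ Y where
  hom := ⟨Matrix.of fun i j => if e i = j then (c : ℂ) else 0, fun i j h => by
    refine if_neg ?_
    rintro rfl
    exact h (he i)⟩
  inv := ⟨Matrix.of fun j i => if e i = j then ((c⁻¹ : ℂˣ) : ℂ) else 0, fun j i h => by
    refine if_neg ?_
    rintro rfl
    exact h (he i).symm⟩
  hom_inv_id := by
    apply hom_ext
    ext i k
    change ∑ j, (if e i = j then (c : ℂ) else 0) * (if e k = j then ((c⁻¹ : ℂˣ) : ℂ) else 0) = _
    simp [Matrix.one_apply, eq_comm]
  inv_hom_id := by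
    apply hom_ext
    ext j l
    change ∑ i, (if e i = j then ((c⁻¹ : ℂˣ) : ℂ) else 0) * (if e i = l then (c : ℂ) else 0) = _
    rw [Finset.sum_eq_single (e.symm j)]
    · simp [Matrix.one_apply]
    · intro i _ hi
      rw [if_neg (by rintro rfl; simp at hi), zero_mul]
    · simp

theorem isoOfEquiv_hom_apply {X Y : TY D} (e : X.ι ≃ Y.ι) (he : ∀ i, X.lab i = Y.lab (e i))
    (c : ℂˣ) (i : X.ι) (j : Y.ι) :
    mat (isoOfEquiv e he c).hom i j = if e i = j then (c : ℂ) else 0 := rfl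

theorem isoOfEquiv_inv_apply {X Y : TY D} (e : X.ι ≃ Y.ι) (he : ∀ i, X.lab i = Y.lab (e i))
    (c : ℂˣ) (i : X.ι) (j : Y.ι) :
    mat (isoOfEquiv e he c).inv j i = if e i = j then ((c⁻¹ : ℂˣ) : ℂ) else 0 := rfl

/-! ### The tensor product -/

/-- Index of a simple summand `out` of `X.lab left ⊗ Y.lab right`. -/
@[ext]
structure TensorIdx (X Y : TY D) where
  left : X.ι
  right : Y.ι
  out : Label C
  fuses : Fuses (X.lab left) (Y.lab right) out

instance (X Y : TY D) : Fintype (TensorIdx X Y) :=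
  Fintype.ofInjective (fun p => (p.left, p.right, p.out)) (by
    rintro ⟨i, j, w, h⟩ ⟨i', j', w', h'⟩ e
    simp only [Prod.mk.injEq] at e
    obtain ⟨rfl, rfl, rfl⟩ := e
    rfl)

/-- The tensor product, distributing over direct sums. -/
def tensor (X Y : TY D) : TY D := ⟨TensorIdx X Y, TensorIdx.out⟩

/-- The tensor product of morphisms. -/
def tensorMap {X X' Y Y' : TY D} (f : X ⟶ X') (g : Y ⟶ Y') : tensor X Y ⟶ tensor X' Y' :=
  ⟨Matrix.of fun (p : TensorIdx X Y) (r : TensorIdx X' Y') =>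
      if p.out = r.out then mat f p.left r.left * mat g p.right r.right else 0,
    fun _ _ h => if_neg h⟩

theorem tensorMap_apply {X X' Y Y' : TY D} (f : X ⟶ X') (g : Y ⟶ Y')
    (p : TensorIdx X Y) (r : TensorIdx X' Y') :
    mat (tensorMap f g) p r =
      if p.out = r.out then mat f p.left r.left * mat g p.right r.right else 0 := rfl

/-- The object with a single simple summand `s`. -/
def single (D : Datum C) (s : Label C) : TY D := ⟨PUnit, fun _ => s⟩

end TY

/-- Components of the associator `a_{X,Y,Z} : X ⊗ (Y ⊗ Z) ⟶ (X ⊗ Y) ⊗ Z` on simple objects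
`s, t, r`: the scalar from the copy of `d` in `s ⊗ v ⊆ s ⊗ (t ⊗ r)` to the copy of `d` in
`w ⊗ r ⊆ (s ⊗ t) ⊗ r`. The only non-trivial ones are `a_{a,σ,b} = χ(a,b)`, `a_{σ,a,σ} = ⨁ χ(a,x)`
and `a_{σ,σ,σ} = (κ χ(x,y)⁻¹)_{x,y}`. -/
def assocCoeff (D : Datum C) : (s t r d v w : Label C) → ℂ
  | elt a, sigma, elt b, _, _, _ => D.χ a b
  | sigma, elt a, sigma, elt x, _, _ => D.χ a x
  | sigma, sigma, sigma, _, elt x, elt y => D.κ * ((D.χ x y)⁻¹ : ℂˣ)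
  | _, _, _, _, _, _ => 1

/-- Components of the inverse associator `(X ⊗ Y) ⊗ Z ⟶ X ⊗ (Y ⊗ Z)`. -/
def assocInvCoeff (D : Datum C) : (s t r d w v : Label C) → ℂ
  | elt a, sigma, elt b, _, _, _ => ((D.χ a b)⁻¹ : ℂˣ)
  | sigma, elt a, sigma, elt x, _, _ => ((D.χ a x)⁻¹ : ℂˣ)
  | sigma, sigma, sigma, _, elt y, elt x => D.κ * (D.χ y x : ℂ)
  | _, _, _, _, _, _ => 1

theorem char_sum (D : Datum C) (c : C) :
    (D.κ : ℂ) * D.κ * ∑ x : C, (D.χ c x : ℂ) = if c = 1 then 1 else 0 := by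
  have hk : (D.κ : ℂ) * D.κ = 1 / (Fintype.card C : ℂ) := by
    rw [← pow_two, ← Complex.ofReal_pow, D.κ_sq]; simp
  have h0 : (Fintype.card C : ℂ) ≠ 0 := by exact_mod_cast Fintype.card_ne_zero
  have h1 := sum_hom_units ((Units.coeHom ℂ).comp (D.χ c))
  have h2 : ((Units.coeHom ℂ).comp (D.χ c) = 1) ↔ c = 1 := by
    constructor
    · intro h
      refine D.χ_nondeg c fun a => ?_
      rw [D.χ_symm]
      have := DFunLike.congr_fun h a
      exact Units.ext this
    · rintro rfl
      ext a
      simp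
  simp only [h2] at h1
  have h3 : ∑ x : C, (D.χ c x : ℂ) = if c = 1 then (Fintype.card C : ℂ) else 0 := by
    refine h1.trans ?_
    split_ifs <;> simp
  rw [h3, hk]
  split_ifs
  · field_simp
  · simp

namespace TY

theorem sum_tensorIdx {X Y : TY D} (F : X.ι → Y.ι → Label C → ℂ) :
    ∑ p : TensorIdx X Y, F p.left p.right p.out =
      ∑ i, ∑ k, ∑ w, if Fuses (X.lab i) (Y.lab k) w then F i k w else 0 := by
  let e : TensorIdx X Y → X.ι × Y.ι × Label C := fun p => (p.left, p.right, p.out)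
  have he : Function.Injective e := by
    intro p r h
    simp only [e, Prod.mk.injEq] at h
    exact TensorIdx.ext h.1 h.2.1 h.2.2
  have h1 : ∑ i, ∑ k, ∑ w, (if Fuses (X.lab i) (Y.lab k) w then F i k w else 0) =
      ∑ z : X.ι × Y.ι × Label C,
        if Fuses (X.lab z.1) (Y.lab z.2.1) z.2.2 then F z.1 z.2.1 z.2.2 else 0 := by
    rw [Fintype.sum_prod_type]
    simp_rw [Fintype.sum_prod_type]
  rw [h1]
  refine Finset.sum_of_injOn e he.injOn (by simp) ?_ ?_
  · rintro ⟨i, k, w⟩ _ hz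
    refine if_neg fun hf => hz ?_
    simpa using ⟨(⟨i, k, w, hf⟩ : TensorIdx X Y), rfl⟩
  · rintro p -
    exact (if_pos p.fuses).symm

theorem tensorMap_comp {X X' X'' Y Y' Y'' : TY D} (f : X ⟶ X') (f' : X' ⟶ X'') (g : Y ⟶ Y')
    (g' : Y' ⟶ Y'') : tensorMap f g ≫ tensorMap f' g' = tensorMap (f ≫ f') (g ≫ g') := by
  refine hom_ext (Matrix.ext fun (p : TensorIdx X Y) (r : TensorIdx X'' Y'') => ?_)
  refine (sum_tensorIdx (X := X') (Y := Y') fun i k w =>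
    (if p.out = w then mat f p.left i * mat g p.right k else 0) *
      if w = r.out then mat f' i r.left * mat g' k r.right else 0).trans ?_
  rw [tensorMap_apply, mat_comp, mat_comp, Matrix.mul_apply, Matrix.mul_apply,
    Finset.sum_mul_sum]
  split_ifs with h
  · refine Finset.sum_congr rfl fun i _ => Finset.sum_congr rfl fun k _ => ?_
    rw [Finset.sum_eq_single p.out]
    · rw [if_pos rfl, if_pos h]
      split_ifs with h1
      · ring
      · by_cases hf : mat f p.left i = 0
        · simp [hf]
        by_cases hg : mat g p.right k = 0
        · simp [hg]
        · exact absurd (lab_eq f hf ▸ lab_eq g hg ▸ p.fuses) h1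
    · intro w _ hw
      simp [hw.symm]
    · simp
  · refine Finset.sum_eq_zero fun i _ => Finset.sum_eq_zero fun k _ => Finset.sum_eq_zero
      fun w _ => ?_
    by_cases h1 : p.out = w
    · subst h1; simp [h]
    · simp [h1]

theorem mat_id_apply (X : TY D) (i j : X.ι) : mat (𝟙 X) i j = if i = j then 1 else 0 := rfl

theorem tensorMap_id (X Y : TY D) : tensorMap (𝟙 X) (𝟙 Y) = 𝟙 (tensor X Y) := by
  refine hom_ext (Matrix.ext fun (p : TensorIdx X Y) (r : TensorIdx X Y) => ?_)
  refine Eq.trans ?_ (mat_id_apply (tensor X Y) p r).symm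
  rw [tensorMap_apply, mat_id_apply, mat_id_apply]
  have : p = r ↔ p.out = r.out ∧ p.left = r.left ∧ p.right = r.right := by
    rw [TensorIdx.ext_iff]; tauto
  by_cases h : p = r
  · rw [if_pos (this.1 h).1, if_pos (this.1 h).2.1, if_pos (this.1 h).2.2]
    exact (mul_one _).trans (if_pos h).symm
  · refine Eq.trans ?_ (if_neg h).symm
    have h' := fun h' => h (this.2 h')
    split_ifs <;> simp_all

/-- The associator `(X ⊗ Y) ⊗ Z ⟶ X ⊗ (Y ⊗ Z)`. -/
def assocHom (X Y Z : TY D) : tensor (tensor X Y) Z ⟶ tensor X (tensor Y Z) :=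
  ⟨Matrix.of fun (p : TensorIdx (tensor X Y) Z) (r : TensorIdx X (tensor Y Z)) =>
      if p.left.left = r.left ∧ p.left.right = r.right.left ∧ p.right = r.right.right ∧
          p.out = r.out then
        assocInvCoeff D (X.lab p.left.left) (Y.lab p.left.right) (Z.lab p.right) p.out p.left.out
          r.right.out
      else 0,
    fun _ _ h => if_neg fun h' => h h'.2.2.2⟩

/-- The inverse associator `X ⊗ (Y ⊗ Z) ⟶ (X ⊗ Y) ⊗ Z`. -/
def assocInv (X Y Z : TY D) : tensor X (tensor Y Z) ⟶ tensor (tensor X Y) Z :=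
  ⟨Matrix.of fun (r : TensorIdx X (tensor Y Z)) (p : TensorIdx (tensor X Y) Z) =>
      if p.left.left = r.left ∧ p.left.right = r.right.left ∧ p.right = r.right.right ∧
          p.out = r.out then
        assocCoeff D (X.lab p.left.left) (Y.lab p.left.right) (Z.lab p.right) p.out r.right.out
          p.left.out
      else 0,
    fun _ _ h => if_neg fun h' => h h'.2.2.2.symm⟩

theorem sum_idx_right {X Y Z : TY D} (i : X.ι) (j : Y.ι) (k : Z.ι) (d : Label C)
    (c : Label C → ℂ) :
    ∑ r : TensorIdx X (tensor Y Z), (if i = r.left ∧ j = TensorIdx.left r.right ∧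
        k = TensorIdx.right r.right ∧ d = r.out then c (TensorIdx.out r.right) else 0) =
      ∑ v, if Fuses (Y.lab j) (Z.lab k) v ∧ Fuses (X.lab i) v d then c v else 0 := by
  rw [← Finset.sum_filter, ← Finset.sum_filter]
  refine Finset.sum_bij (fun r _ => TensorIdx.out r.right) ?_ ?_ ?_ (fun _ _ => rfl)
  · rintro ⟨i', ⟨j', k', v, h1⟩, d', h2⟩ h
    simp only [Finset.mem_filter, Finset.mem_univ, true_and] at h ⊢
    obtain ⟨rfl, rfl, rfl, rfl⟩ := h
    exact ⟨h1, h2⟩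
  · rintro ⟨i', ⟨j', k', v, h1⟩, d', h2⟩ h ⟨i'', ⟨j'', k'', v', h1'⟩, d'', h2'⟩ h' e
    simp only [Finset.mem_filter, Finset.mem_univ, true_and] at h h' e
    obtain ⟨rfl, rfl, rfl, rfl⟩ := h
    obtain ⟨rfl, rfl, rfl, rfl⟩ := h'
    subst e
    rfl
  · intro v hv
    simp only [Finset.mem_filter, Finset.mem_univ, true_and] at hv
    exact ⟨⟨i, ⟨j, k, v, hv.1⟩, d, hv.2⟩, by simp, rfl⟩

theorem sum_idx_left {X Y Z : TY D} (i : X.ι) (j : Y.ι) (k : Z.ι) (d : Label C)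
    (c : Label C → ℂ) :
    ∑ p : TensorIdx (tensor X Y) Z, (if TensorIdx.left p.left = i ∧ TensorIdx.right p.left = j ∧
        p.right = k ∧ p.out = d then c (TensorIdx.out p.left) else 0) =
      ∑ w, if Fuses (X.lab i) (Y.lab j) w ∧ Fuses w (Z.lab k) d then c w else 0 := by
  rw [← Finset.sum_filter, ← Finset.sum_filter]
  refine Finset.sum_bij (fun r _ => TensorIdx.out r.left) ?_ ?_ ?_ (fun _ _ => rfl)
  · rintro ⟨⟨i', j', v, h1⟩, k', d', h2⟩ h
    simp only [Finset.mem_filter, Finset.mem_univ, true_and] at h ⊢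
    obtain ⟨rfl, rfl, rfl, rfl⟩ := h
    exact ⟨h1, h2⟩
  · rintro ⟨⟨i', j', v, h1⟩, k', d', h2⟩ h ⟨⟨i'', j'', v', h1'⟩, k'', d'', h2'⟩ h' e
    simp only [Finset.mem_filter, Finset.mem_univ, true_and] at h h' e
    obtain ⟨rfl, rfl, rfl, rfl⟩ := h
    obtain ⟨rfl, rfl, rfl, rfl⟩ := h'
    subst e
    rfl
  · intro v hv
    simp only [Finset.mem_filter, Finset.mem_univ, true_and] at hv
    exact ⟨⟨⟨i, j, v, hv.1⟩, k, d, hv.2⟩, by simp, rfl⟩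

theorem sum_label (f : Label C → ℂ) : ∑ v, f v = ∑ a, f (elt a) + f sigma := by
  let e : Option C ≃ Label C :=
    ⟨fun o => o.elim sigma elt, fun s => match s with | elt a => some a | sigma => none,
      by rintro (_ | _) <;> rfl, by rintro (_ | _) <;> rfl⟩
  rw [← e.sum_comp, Fintype.sum_option, add_comm]
  rfl

theorem coeff_hom_inv {s t r d w w' : Label C} (h1 : Fuses s t w) (h2 : Fuses w r d)
    (h1' : Fuses s t w') (h2' : Fuses w' r d) :
    (∑ v, if Fuses t r v ∧ Fuses s v d then
      assocInvCoeff D s t r d w v * assocCoeff D s t r d v w' else 0) =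
      if w = w' then 1 else 0 := by
  rw [sum_label]
  rcases s with a | _ <;> rcases t with b | _ <;> rcases r with c | _ <;> rcases d with d | _ <;>
    rcases w with x | _ <;> rcases w' with y | _ <;> simp only [Fuses] at h1 h2 h1' h2'
  · subst h1 h1' h2
    have h3 : ∀ z, (b * c = z ∧ z = b * c) ↔ z = b * c := fun z => ⟨And.right, fun h => ⟨h.symm, h⟩⟩
    simp [Fuses, assocInvCoeff, assocCoeff, mul_assoc, h3]
  · have h3 := h1.symm.trans h1'
    simp [Fuses, assocInvCoeff, assocCoeff, h3]
  · simp [Fuses, assocInvCoeff, assocCoeff]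
  · simp [Fuses, assocInvCoeff, assocCoeff, ← eq_inv_mul_iff_mul_eq]
  · simp [Fuses, assocInvCoeff, assocCoeff]
  · simp [Fuses, assocInvCoeff, assocCoeff]
  · have h3 := mul_right_cancel (h2.trans h2'.symm)
    simp [Fuses, assocInvCoeff, assocCoeff, h3]
  · have := char_sum D (x * y⁻¹)
    rw [Finset.mul_sum] at this
    simp only [mul_inv_eq_one] at this
    simp only [Fuses, assocInvCoeff, assocCoeff, elt.injEq]
    rw [← this]
    simp only [and_self, if_true, if_false, add_zero]
    refine Finset.sum_congr rfl fun z _ => ?_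
    rw [D.χ_symm z y]
    simp
    ring

theorem coeff_inv_hom {s t r d v v' : Label C} (h1 : Fuses t r v) (h2 : Fuses s v d)
    (h1' : Fuses t r v') (h2' : Fuses s v' d) :
    (∑ w, if Fuses s t w ∧ Fuses w r d then
      assocCoeff D s t r d v w * assocInvCoeff D s t r d w v' else 0) =
      if v = v' then 1 else 0 := by
  rw [sum_label]
  rcases s with a | _ <;> rcases t with b | _ <;> rcases r with c | _ <;> rcases d with d | _ <;>
    rcases v with x | _ <;> rcases v' with y | _ <;> simp only [Fuses] at h1 h2 h1' h2'
  · subst h1 h1' h2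
    have h3 : ∀ z, (a * b = z ∧ z = a * b) ↔ z = a * b := fun z => ⟨And.right, fun h => ⟨h.symm, h⟩⟩
    simp [Fuses, assocInvCoeff, assocCoeff, ← mul_assoc, h3]
  · simp [Fuses, assocInvCoeff, assocCoeff]
  · simp [Fuses, assocInvCoeff, assocCoeff]
  · have h3 := mul_left_cancel (h2.trans h2'.symm)
    simp [Fuses, assocInvCoeff, assocCoeff, h3]
  · have h3 := h1.symm.trans h1'
    simp [Fuses, assocInvCoeff, assocCoeff, h3]
  · simp [Fuses, assocInvCoeff, assocCoeff]
  · simp [Fuses, assocInvCoeff, assocCoeff, ← eq_mul_inv_iff_mul_eq]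
  · have := char_sum D (x⁻¹ * y)
    rw [Finset.mul_sum] at this
    simp only [inv_mul_eq_one] at this
    simp only [Fuses, assocInvCoeff, assocCoeff, elt.injEq]
    rw [← this]
    simp only [and_self, if_true, if_false, add_zero]
    refine Finset.sum_congr rfl fun z _ => ?_
    rw [D.χ_symm z y]
    simp
    ring

theorem assocHom_inv (X Y Z : TY D) : assocHom X Y Z ≫ assocInv X Y Z = 𝟙 _ := by
  refine hom_ext (Matrix.ext fun (p : TensorIdx (tensor X Y) Z) (p' : TensorIdx _ Z) => ?_)
  refine Eq.trans ?_ (mat_id_apply (tensor (tensor X Y) Z) p p').symm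
  obtain ⟨⟨i, j, w, h1⟩, k, d, h2⟩ := p
  obtain ⟨⟨i', j', w', h1'⟩, k', d', h2'⟩ := p'
  by_cases he : i' = i ∧ j' = j ∧ k' = k ∧ d' = d
  · obtain ⟨rfl, rfl, rfl, rfl⟩ := he
    have e1 := (sum_idx_right (X := X) (Y := Y) (Z := Z) i' j' k' d' fun v =>
      assocInvCoeff D _ _ _ d' w v * assocCoeff D _ _ _ d' v w').trans
        (coeff_hom_inv h1 h2 h1' h2')
    refine Eq.trans ?_ (e1.trans ?_)
    · refine Finset.sum_congr rfl fun r _ => ?_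
      change (if _ then _ else _) * (if _ then _ else _) = _
      by_cases hm : i' = r.left ∧ j' = TensorIdx.left r.right ∧
        k' = TensorIdx.right r.right ∧ d' = r.out
      · rw [if_pos hm, if_pos hm, if_pos hm]
      · rw [if_neg hm, if_neg hm, mul_zero]
        exact (if_neg hm).symm
    · by_cases hw : w = w'
      · subst hw; exact (if_pos rfl).trans (if_pos rfl).symm
      · rw [if_neg hw]
        refine (if_neg fun h => hw ?_).symm
        exact congrArg (fun p : TensorIdx (tensor X Y) Z => TensorIdx.out p.left) h
  · refine Eq.trans (Finset.sum_eq_zero fun r _ => ?_) (if_neg fun h => he ?_).symm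
    · change (if _ then _ else _) * (if _ then _ else _) = _
      split_ifs with ha hb
      · obtain ⟨a1, a2, a3, a4⟩ := ha
        obtain ⟨b1, b2, b3, b4⟩ := hb
        exact absurd ⟨b1.trans a1.symm, b2.trans a2.symm, b3.trans a3.symm, b4.trans a4.symm⟩ he
      all_goals simp
    · cases h; simp

theorem assocInv_hom (X Y Z : TY D) : assocInv X Y Z ≫ assocHom X Y Z = 𝟙 _ := by
  refine hom_ext (Matrix.ext fun (p : TensorIdx X (tensor Y Z)) (p' : TensorIdx X _) => ?_)
  refine Eq.trans ?_ (mat_id_apply (tensor X (tensor Y Z)) p p').symm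
  obtain ⟨i, ⟨j, k, w, h1⟩, d, h2⟩ := p
  obtain ⟨i', ⟨j', k', w', h1'⟩, d', h2'⟩ := p'
  by_cases he : i = i' ∧ j = j' ∧ k = k' ∧ d = d'
  · obtain ⟨rfl, rfl, rfl, rfl⟩ := he
    have e1 := (sum_idx_left (X := X) (Y := Y) (Z := Z) i j k d fun v =>
      assocCoeff D _ _ _ d w v * assocInvCoeff D _ _ _ d v w').trans
        (coeff_inv_hom h1 h2 h1' h2')
    refine Eq.trans ?_ (e1.trans ?_)
    · refine Finset.sum_congr rfl fun r _ => ?_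
      obtain ⟨⟨i', j', v, h3⟩, k', d', h4⟩ := r
      change (if _ then _ else _) * (if _ then _ else _) = _
      by_cases hm : i' = i ∧ j' = j ∧ k' = k ∧ d' = d
      · obtain ⟨rfl, rfl, rfl, rfl⟩ := hm
        rw [if_pos, if_pos, if_pos] <;> simp
      · rw [if_neg hm, if_neg hm, mul_zero]
        exact (if_neg hm).symm
    · by_cases hw : w = w'
      · subst hw; exact (if_pos rfl).trans (if_pos rfl).symm
      · rw [if_neg hw]
        refine (if_neg fun h => hw ?_).symm
        exact congrArg (fun p : TensorIdx X (tensor Y Z) => TensorIdx.out p.right) h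
  · refine Eq.trans (Finset.sum_eq_zero fun r _ => ?_) (if_neg fun h => he ?_).symm
    · change (if _ then _ else _) * (if _ then _ else _) = _
      split_ifs with ha hb
      · obtain ⟨a1, a2, a3, a4⟩ := ha
        obtain ⟨b1, b2, b3, b4⟩ := hb
        exact absurd ⟨a1.symm.trans b1, a2.symm.trans b2, a3.symm.trans b3, a4.symm.trans b4⟩ he
      all_goals simp
    · cases h; simp

theorem assocHom_apply {X Y Z : TY D} (p : TensorIdx (tensor X Y) Z)
    (r : TensorIdx X (tensor Y Z)) :
    mat (assocHom X Y Z) p r =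
      if TensorIdx.left p.left = r.left ∧ TensorIdx.right p.left = TensorIdx.left r.right ∧
          p.right = TensorIdx.right r.right ∧ p.out = r.out then
        assocInvCoeff D (X.lab (TensorIdx.left p.left)) (Y.lab (TensorIdx.right p.left))
          (Z.lab p.right) p.out (TensorIdx.out p.left) (TensorIdx.out r.right)
      else 0 := rfl

theorem assocHom_naturality {X X' Y Y' Z Z' : TY D} (f : X ⟶ X') (g : Y ⟶ Y') (h : Z ⟶ Z') :
    tensorMap (tensorMap f g) h ≫ assocHom X' Y' Z' =
      assocHom X Y Z ≫ tensorMap f (tensorMap g h) := by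
  refine hom_ext (Matrix.ext fun (p : TensorIdx (tensor X Y) Z)
    (r : TensorIdx X' (tensor Y' Z')) => ?_)
  obtain ⟨⟨i, j, w, h1⟩, k, d, h2⟩ := p
  obtain ⟨i', ⟨j', k', v, h1'⟩, d', h2'⟩ := r
  replace h2 : Fuses w (Z.lab k) d := h2
  replace h2' : Fuses (X'.lab i') v d' := h2'
  set m := mat f i i' * mat g j j' * mat h k k' with hm
  have L := sum_idx_left (X := X') (Y := Y') (Z := Z') i' j' k' d' fun x =>
    if w = x ∧ d = d' then
      m * assocInvCoeff D (X'.lab i') (Y'.lab j') (Z'.lab k') d' x v else 0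
  have R := sum_idx_right (X := X) (Y := Y) (Z := Z) i j k d fun x =>
    if x = v ∧ d = d' then
      m * assocInvCoeff D (X.lab i) (Y.lab j) (Z.lab k) d w x else 0
  refine Eq.trans ((Finset.sum_congr rfl ?_).trans L)
    (Eq.trans ?_ ((Finset.sum_congr rfl ?_).trans R).symm)
  · rintro ⟨⟨i2, j2, w2, h3⟩, k2, d2, h4⟩ -
    change (if d = d2 then (if w = w2 then mat f i i2 * mat g j j2 else 0) * mat h k k2 else 0) *
      (if i2 = i' ∧ j2 = j' ∧ k2 = k' ∧ d2 = d' then assocInvCoeff D _ _ _ d2 w2 v else 0) =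
      if i2 = i' ∧ j2 = j' ∧ k2 = k' ∧ d2 = d' then _ else 0
    by_cases he : i2 = i' ∧ j2 = j' ∧ k2 = k' ∧ d2 = d'
    · obtain ⟨rfl, rfl, rfl, rfl⟩ := he
      simp only [and_self, if_true]
      by_cases h5 : d = d2 <;> by_cases h6 : w = w2 <;> simp [h5, h6, hm]
    · rw [if_neg he, if_neg he, mul_zero]
  · by_cases hd : d = d'
    · subst hd
      by_cases hm0 : m = 0
      · simp [hm0]
      · obtain ⟨⟨hf, hg⟩, hh⟩ : (mat f i i' ≠ 0 ∧ mat g j j' ≠ 0) ∧ mat h k k' ≠ 0 := by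
          rwa [← Ne, hm, mul_ne_zero_iff, mul_ne_zero_iff] at hm0
        have ef := lab_eq f hf
        have eg := lab_eq g hg
        have eh := lab_eq h hh
        rw [Finset.sum_eq_single w, Finset.sum_eq_single v, if_pos, if_pos ⟨rfl, rfl⟩, if_pos,
          if_pos ⟨rfl, rfl⟩, ef, eg, eh]
        · exact ⟨by rw [eg, eh]; exact h1', by rw [ef]; exact h2'⟩
        · exact ⟨by rw [← ef, ← eg]; exact h1, by rw [← eh]; exact h2⟩
        · intro x _ hx
          simp [hx]
        · simp
        · intro x _ hx
          simp [hx.symm]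
        · simp
    · simp [hd]
  · rintro ⟨i2, ⟨j2, k2, v2, h3⟩, d2, h4⟩ -
    change (if i = i2 ∧ j = j2 ∧ k = k2 ∧ d = d2 then assocInvCoeff D _ _ _ d w v2 else 0) *
      (if d2 = d' then mat f i2 i' * (if v2 = v then mat g j2 j' * mat h k2 k' else 0) else 0) =
      if i = i2 ∧ j = j2 ∧ k = k2 ∧ d = d2 then _ else 0
    by_cases he : i = i2 ∧ j = j2 ∧ k = k2 ∧ d = d2
    · obtain ⟨rfl, rfl, rfl, rfl⟩ := he
      simp only [and_self, if_true]
      by_cases h5 : d = d' <;> by_cases h6 : v2 = v <;> simp [h5, h6, hm]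
      ring
    · rw [if_neg he, if_neg he, zero_mul]

theorem sum_idx_mid {W X Y Z : TY D} (i : W.ι) (j : X.ι) (k : Y.ι) (l : Z.ι) (v d : Label C)
    (c : Label C → ℂ) :
    ∑ q : TensorIdx (tensor W (tensor X Y)) Z,
      (if TensorIdx.left q.left = i ∧ TensorIdx.left (TensorIdx.right q.left) = j ∧
        TensorIdx.right (TensorIdx.right q.left) = k ∧ q.right = l ∧ TensorIdx.out q.left = v ∧
        q.out = d then c (TensorIdx.out (TensorIdx.right q.left)) else 0) =
      ∑ t, if Fuses (X.lab j) (Y.lab k) t ∧ Fuses (W.lab i) t v ∧ Fuses v (Z.lab l) d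
        then c t else 0 := by
  rw [← Finset.sum_filter, ← Finset.sum_filter]
  refine Finset.sum_bij (fun q _ => TensorIdx.out (TensorIdx.right q.left)) ?_ ?_ ?_
    (fun _ _ => rfl)
  · rintro ⟨⟨i', ⟨j', k', t, h1⟩, v', h2⟩, l', d', h3⟩ h
    simp only [Finset.mem_filter, Finset.mem_univ, true_and] at h ⊢
    obtain ⟨rfl, rfl, rfl, rfl, rfl, rfl⟩ := h
    exact ⟨h1, h2, h3⟩
  · rintro ⟨⟨i', ⟨j', k', t, h1⟩, v', h2⟩, l', d', h3⟩ h
      ⟨⟨i'', ⟨j'', k'', t', h1'⟩, v'', h2'⟩, l'', d'', h3'⟩ h' e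
    simp only [Finset.mem_filter, Finset.mem_univ, true_and] at h h' e
    obtain ⟨rfl, rfl, rfl, rfl, rfl, rfl⟩ := h
    obtain ⟨rfl, rfl, rfl, rfl, rfl, rfl⟩ := h'
    subst e
    rfl
  · intro t ht
    simp only [Finset.mem_filter, Finset.mem_univ, true_and] at ht
    exact ⟨⟨⟨i, ⟨j, k, t, ht.1⟩, v, ht.2.1⟩, l, d, ht.2.2⟩, by simp, rfl⟩

theorem card_filter_eq_one {α : Type*} [Fintype α] {p : α → Prop} [DecidablePred p] {a : α}
    (h : ∀ x, p x ↔ x = a) : (Finset.univ.filter p).card = 1 :=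
  Finset.card_eq_one.2 ⟨a, by ext; simp [h]⟩

/-- The pentagon equation for the scalars `assocInvCoeff`. -/
theorem coeff_pentagon {i j k l d u v v' u' : Label C} (h1 : Fuses i j u) (h2 : Fuses u k v)
    (h3 : Fuses v l d) (h4 : Fuses k l v') (h5 : Fuses j v' u') (h6 : Fuses i u' d) :
    (∑ t, if Fuses j k t ∧ Fuses i t v ∧ Fuses t l u' then
      assocInvCoeff D i j k v u t * (assocInvCoeff D i t l d v u' * assocInvCoeff D j k l u' t v')
      else 0) =
    if Fuses u v' d then assocInvCoeff D u k l d v v' * assocInvCoeff D i j v' d u u' else 0 := by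
  rw [sum_label]
  rcases i with i | _ <;> rcases j with j | _ <;> rcases k with k | _ <;> rcases l with l | _ <;>
    rcases d with d | _ <;> rcases u with u | _ <;> rcases v with v | _ <;>
    rcases v' with v' | _ <;> rcases u' with u' | _ <;>
    simp only [Fuses] at h1 h2 h3 h4 h5 h6 <;>
    simp [Fuses, assocInvCoeff]
  · subst h1 h2 h4
    have h7 : ∀ x, (j * k = x ∧ i * x = i * j * k ∧ x * l = u') ↔ x = j * k := fun x =>
      ⟨fun h => h.1.symm, by rintro rfl; exact ⟨rfl, (mul_assoc _ _ _).symm, by rw [← h5, mul_assoc]⟩⟩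
    rw [if_pos (by rw [← h3]; simp only [mul_assoc])]
    simp [card_filter_eq_one h7]
  · subst h1 h2
    have h7 : ∀ x, (j * k = x ∧ i * x = i * j * k) ↔ x = j * k := fun x =>
      ⟨fun h => h.1.symm, by rintro rfl; exact ⟨rfl, (mul_assoc _ _ _).symm⟩⟩
    simp [card_filter_eq_one h7]
  · subst h1; simp [mul_comm]
  · rw [← h1, ← h6, ← h5, mul_assoc]
  · subst h4; simp [mul_comm]
  · subst h6; simp [D.χ_symm k, mul_comm]
  · have h7 : ∀ x, (i * x = v ∧ x * l = u') ↔ x = i⁻¹ * v := fun x =>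
      ⟨fun h => by rw [← h.1]; simp, by
        rintro rfl
        refine ⟨by simp, ?_⟩
        rw [mul_assoc, h3, ← h6]
        simp⟩
    exact card_filter_eq_one h7
  · simp only [← eq_inv_mul_iff_mul_eq]
    simp [mul_comm, mul_assoc]
  · subst h4 h5
    have h7 : ∀ x, (j * k = x ∧ x * l = j * (k * l)) ↔ x = j * k := fun x =>
      ⟨fun h => h.1.symm, by rintro rfl; exact ⟨rfl, mul_assoc _ _ _⟩⟩
    simp [card_filter_eq_one h7]
  · subst h3; simp [mul_comm]
  · subst h5; rw [D.χ_symm j]; simp; field_simp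
  · rw [← h3, ← h2, ← h4, mul_assoc]
  · subst h2; simp; field_simp
  · simp only [← eq_mul_inv_iff_mul_eq]
    simp [mul_comm, mul_assoc]
  · have := char_sum D (u * v' * d⁻¹)
    rw [Finset.mul_sum] at this
    simp only [mul_inv_eq_one] at this
    rw [← this]
    refine Finset.sum_congr rfl fun z _ => ?_
    rw [D.χ_symm z d, D.χ_symm z v']
    simp
    ring

theorem pentagon_aux {W X Y Z : TY D} (q : TensorIdx (tensor W (tensor X Y)) Z)
    (r : TensorIdx W (tensor X (tensor Y Z))) :
    mat (assocHom W (tensor X Y) Z ≫ tensorMap (𝟙 W) (assocHom X Y Z)) q r =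
      if TensorIdx.left q.left = r.left ∧
          TensorIdx.left (TensorIdx.right q.left) = TensorIdx.left r.right ∧
          TensorIdx.right (TensorIdx.right q.left) = TensorIdx.left (TensorIdx.right r.right) ∧
          q.right = TensorIdx.right (TensorIdx.right r.right) ∧ q.out = r.out ∧
          Fuses (TensorIdx.out (TensorIdx.right q.left)) (Z.lab q.right) (TensorIdx.out r.right)
      then assocInvCoeff D (W.lab (TensorIdx.left q.left)) (TensorIdx.out (TensorIdx.right q.left))
          (Z.lab q.right) q.out (TensorIdx.out q.left) (TensorIdx.out r.right) *
        assocInvCoeff D (X.lab (TensorIdx.left (TensorIdx.right q.left)))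
          (Y.lab (TensorIdx.right (TensorIdx.right q.left))) (Z.lab q.right) (TensorIdx.out r.right)
          (TensorIdx.out (TensorIdx.right q.left)) (TensorIdx.out (TensorIdx.right r.right))
      else 0 := by
  obtain ⟨⟨i, ⟨j, k, t, h1⟩, v, h2⟩, l, d, h3⟩ := q
  obtain ⟨i', ⟨j', ⟨k', l', v', h4⟩, u', h5⟩, d', h6⟩ := r
  have R := sum_idx_right (X := W) (Y := tensor X Y) (Z := Z) i ⟨j, k, t, h1⟩ l d fun s =>
    if s = u' ∧ d = d' ∧ i = i' ∧ j = j' ∧ k = k' ∧ l = l' then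
      assocInvCoeff D (W.lab i) t (Z.lab l) d v s *
        assocInvCoeff D (X.lab j) (Y.lab k) (Z.lab l) s t v' else 0
  refine ((Finset.sum_congr rfl ?_).trans R).trans ?_
  · rintro ⟨i2, ⟨x2, l2, s2, h7⟩, d2, h8⟩ -
    change (if i = i2 ∧ (⟨j, k, t, h1⟩ : TensorIdx X Y) = x2 ∧ l = l2 ∧ d = d2 then
        assocInvCoeff D (W.lab i) t (Z.lab l) d v s2 else 0) *
      (if d2 = d' then (if i2 = i' then 1 else 0) *
        (if TensorIdx.left x2 = j' ∧ TensorIdx.right x2 = k' ∧ l2 = l' ∧ s2 = u' then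
          assocInvCoeff D _ _ _ s2 (TensorIdx.out x2) v' else 0) else 0) =
      if i = i2 ∧ (⟨j, k, t, h1⟩ : TensorIdx X Y) = x2 ∧ l = l2 ∧ d = d2 then _ else 0
    by_cases he : i = i2 ∧ (⟨j, k, t, h1⟩ : TensorIdx X Y) = x2 ∧ l = l2 ∧ d = d2
    · rw [if_pos he, if_pos he]
      obtain ⟨rfl, rfl, rfl, rfl⟩ := he
      by_cases e1 : d = d'
      · by_cases e2 : i = i'
        · by_cases e3 : j = j' ∧ k = k' ∧ l = l' ∧ s2 = u'
          · obtain ⟨e3, e4, e5, e6⟩ := e3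
            simp [e1, e2, e3, e4, e5, e6]
          · have e4 : ¬(s2 = u' ∧ d = d' ∧ i = i' ∧ j = j' ∧ k = k' ∧ l = l') :=
              fun h => e3 ⟨h.2.2.2.1, h.2.2.2.2.1, h.2.2.2.2.2, h.1⟩
            refine Eq.trans ?_ (if_neg e4).symm
            rw [if_neg e3]
            simp
        · simp [e2]
      · simp [e1]
    · rw [if_neg he, if_neg he, zero_mul]
  · rw [Finset.sum_eq_single u']
    · by_cases he : i = i' ∧ j = j' ∧ k = k' ∧ l = l' ∧ d = d'
      · obtain ⟨rfl, rfl, rfl, rfl, rfl⟩ := he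
        replace h6 : Fuses (W.lab i) u' d := h6
        change (if Fuses t (Z.lab l) u' ∧ Fuses (W.lab i) u' d then _ else 0) =
          if i = i ∧ j = j ∧ k = k ∧ l = l ∧ d = d ∧ Fuses t (Z.lab l) u' then _ else 0
        simp [h6]
      · refine Eq.trans ?_ (if_neg fun h => he
          ⟨h.1, h.2.1, h.2.2.1, h.2.2.2.1, h.2.2.2.2.1⟩).symm
        split_ifs with h7 h8
        · exact absurd ⟨h8.2.2.1, h8.2.2.2.1, h8.2.2.2.2.1, h8.2.2.2.2.2, h8.2.1⟩ he
        · rfl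
        · rfl
    · intro s _ hs
      simp [hs]
    · simp

theorem pentagon_eq (W X Y Z : TY D) :
    tensorMap (assocHom W X Y) (𝟙 Z) ≫ assocHom W (tensor X Y) Z ≫
      tensorMap (𝟙 W) (assocHom X Y Z) =
    assocHom (tensor W X) Y Z ≫ assocHom W X (tensor Y Z) := by
  refine hom_ext (Matrix.ext fun (p : TensorIdx (tensor (tensor W X) Y) Z)
    (r : TensorIdx W (tensor X (tensor Y Z))) => ?_)
  obtain ⟨⟨⟨i, j, u, h1⟩, k, v, h2⟩, l, d, h3⟩ := p
  obtain ⟨i', ⟨j', ⟨k', l', v', h4⟩, u', h5⟩, d', h6⟩ := r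
  have L := sum_idx_mid (W := W) (X := X) (Y := Y) (Z := Z) i j k l v d fun t =>
    if i = i' ∧ j = j' ∧ k = k' ∧ l = l' ∧ d = d' ∧ Fuses t (Z.lab l) u' then
      assocInvCoeff D (W.lab i) (X.lab j) (Y.lab k) v u t *
      (assocInvCoeff D (W.lab i) t (Z.lab l) d v u' *
        assocInvCoeff D (X.lab j) (Y.lab k) (Z.lab l) u' t v') else 0
  have R := sum_idx_right (X := tensor W X) (Y := Y) (Z := Z) ⟨i, j, u, h1⟩ k l d fun s =>
    if i = i' ∧ j = j' ∧ k = k' ∧ l = l' ∧ d = d' ∧ s = v' then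
      assocInvCoeff D u (Y.lab k) (Z.lab l) d v s *
        assocInvCoeff D (W.lab i) (X.lab j) s d u u' else 0
  refine Eq.trans ((Finset.sum_congr rfl ?_).trans L)
    (Eq.trans ?_ ((Finset.sum_congr rfl ?_).trans R).symm)
  · intro q _
    refine (congrArg (_ * ·) (pentagon_aux q _)).trans ?_
    obtain ⟨⟨i2, ⟨j2, k2, t, h7⟩, v2, h8⟩, l2, d2, h9⟩ := q
    change (if d = d2 then (if i = i2 ∧ j = j2 ∧ k = k2 ∧ v = v2 then
        assocInvCoeff D _ _ _ v u t else 0) * (if l = l2 then 1 else 0) else 0) *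
      (if i2 = i' ∧ j2 = j' ∧ k2 = k' ∧ l2 = l' ∧ d2 = d' ∧ Fuses t (Z.lab l2) u' then
        assocInvCoeff D _ t _ d2 v2 u' * assocInvCoeff D _ _ _ u' t v' else 0) =
      if i2 = i ∧ j2 = j ∧ k2 = k ∧ l2 = l ∧ v2 = v ∧ d2 = d then _ else 0
    by_cases he : i2 = i ∧ j2 = j ∧ k2 = k ∧ l2 = l ∧ v2 = v ∧ d2 = d
    · obtain ⟨rfl, rfl, rfl, rfl, rfl, rfl⟩ := he
      simp
    · rw [if_neg he]
      by_cases e1 : d = d2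
      · by_cases e2 : l = l2
        · by_cases e3 : i = i2 ∧ j = j2 ∧ k = k2 ∧ v = v2
          · exact absurd ⟨e3.1.symm, e3.2.1.symm, e3.2.2.1.symm, e2.symm, e3.2.2.2.symm,
              e1.symm⟩ he
          · rw [if_neg e3]; simp
        · simp [e2]
      · simp [e1]
  · by_cases he : i = i' ∧ j = j' ∧ k = k' ∧ l = l' ∧ d = d'
    · obtain ⟨rfl, rfl, rfl, rfl, rfl⟩ := he
      replace h2 : Fuses u (Y.lab k) v := h2
      replace h3 : Fuses v (Z.lab l) d := h3
      replace h5 : Fuses (X.lab j) v' u' := h5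
      replace h6 : Fuses (W.lab i) u' d := h6
      have := coeff_pentagon (D := D) h1 h2 h3 h4 h5 h6
      refine Eq.trans (Eq.trans (Finset.sum_congr rfl fun t _ => ?_) this) ?_
      · by_cases e1 : Fuses (X.lab j) (Y.lab k) t <;> by_cases e2 : Fuses (W.lab i) t v <;>
          by_cases e3 : Fuses t (Z.lab l) u' <;> simp [e1, e2, e3, h3]
      · rw [Finset.sum_eq_single v']
        · change _ = if Fuses (Y.lab k) (Z.lab l) v' ∧ Fuses u v' d then _ else 0
          simp [h4]
        · intro s _ hs
          simp [hs]
        · simp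
    · rw [Finset.sum_eq_zero, Finset.sum_eq_zero]
      · intro s _
        rw [if_neg (c := i = i' ∧ _)]
        · simp
        · exact fun h => he ⟨h.1, h.2.1, h.2.2.1, h.2.2.2.1, h.2.2.2.2.1⟩
      · intro s _
        rw [if_neg (c := i = i' ∧ _)]
        · simp
        · exact fun h => he ⟨h.1, h.2.1, h.2.2.1, h.2.2.2.1, h.2.2.2.2.1⟩
  · rintro ⟨x2, ⟨k2, l2, s, h7⟩, d2, h8⟩ -
    change (if (⟨i, j, u, h1⟩ : TensorIdx W X) = x2 ∧ k = k2 ∧ l = l2 ∧ d = d2 then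
        assocInvCoeff D u _ _ d v s else 0) *
      (if TensorIdx.left x2 = i' ∧ TensorIdx.right x2 = j' ∧
        (⟨k2, l2, s, h7⟩ : TensorIdx Y Z) = ⟨k', l', v', h4⟩ ∧
        d2 = d' then assocInvCoeff D _ _ s d2 (TensorIdx.out x2) u' else 0) =
      if (⟨i, j, u, h1⟩ : TensorIdx W X) = x2 ∧ k = k2 ∧ l = l2 ∧ d = d2 then _ else 0
    by_cases he : (⟨i, j, u, h1⟩ : TensorIdx W X) = x2 ∧ k = k2 ∧ l = l2 ∧ d = d2
    · rw [if_pos he, if_pos he]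
      obtain ⟨rfl, rfl, rfl, rfl⟩ := he
      have e : ((⟨k, l, s, h7⟩ : TensorIdx Y Z) = ⟨k', l', v', h4⟩) ↔
          k = k' ∧ l = l' ∧ s = v' := by
        simp
      by_cases e1 : i = i' ∧ j = j' ∧ k = k' ∧ l = l' ∧ d = d' ∧ s = v'
      · rw [if_pos e1, if_pos ⟨e1.1, e1.2.1, e.2 ⟨e1.2.2.1, e1.2.2.2.1, e1.2.2.2.2.2⟩,
          e1.2.2.2.2.1⟩]
      · rw [if_neg e1, if_neg, mul_zero]
        intro h
        have h9 := e.1 h.2.2.1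
        exact e1 ⟨h.1, h.2.1, h9.1, h9.2.1, h.2.2.2, h9.2.2⟩
    · rw [if_neg he, if_neg he, zero_mul]

theorem fuses_one_left {s w : Label C} : Fuses (elt 1) s w ↔ s = w := by
  cases s <;> cases w <;> simp [Fuses]

theorem fuses_one_right {s w : Label C} : Fuses s (elt 1) w ↔ s = w := by
  cases s <;> cases w <;> simp [Fuses]

def leftUnitor (X : TY D) : tensor (single D (elt 1)) X ≅ X :=
  isoOfEquiv ⟨TensorIdx.right, fun i => ⟨PUnit.unit, i, X.lab i, fuses_one_left.2 rfl⟩,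
    fun p => TensorIdx.ext rfl rfl (fuses_one_left.1 p.fuses), fun _ => rfl⟩
    fun p => (fuses_one_left.1 p.fuses).symm

def rightUnitor (X : TY D) : tensor X (single D (elt 1)) ≅ X :=
  isoOfEquiv ⟨TensorIdx.left, fun i => ⟨i, PUnit.unit, X.lab i, fuses_one_right.2 rfl⟩,
    fun p => TensorIdx.ext rfl rfl (fuses_one_right.1 p.fuses), fun _ => rfl⟩
    fun p => (fuses_one_right.1 p.fuses).symm

instance : MonoidalCategoryStruct (TY D) where
  tensorObj := tensor
  whiskerLeft X _ _ f := tensorMap (𝟙 X) f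
  whiskerRight f Y := tensorMap f (𝟙 Y)
  tensorHom := tensorMap
  tensorUnit := single D (elt 1)
  associator X Y Z := ⟨assocHom X Y Z, assocInv X Y Z, assocHom_inv X Y Z, assocInv_hom X Y Z⟩
  leftUnitor := leftUnitor
  rightUnitor := rightUnitor

theorem leftUnitor_nat {X Y : TY D} (f : X ⟶ Y) :
    tensorMap (𝟙 (single D (elt 1))) f ≫ (leftUnitor Y).hom = (leftUnitor X).hom ≫ f := by
  refine hom_ext (Matrix.ext fun (p : TensorIdx (single D (elt 1)) X) j => ?_)
  refine Eq.trans (b := mat f p.right j) ?_ ?_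
  · refine (Finset.sum_eq_single (⟨PUnit.unit, j, Y.lab j, fuses_one_left.2 rfl⟩ :
      TensorIdx (single D (elt 1)) Y) ?_ ?_).trans ?_
    · intro q _ hq
      refine mul_eq_zero_of_right _ (if_neg ?_)
      rintro rfl
      exact hq (TensorIdx.ext rfl rfl (fuses_one_left.1 q.fuses).symm)
    · exact fun h => absurd (Finset.mem_univ _) h
    · change (if p.out = Y.lab j then mat (𝟙 (single D (elt 1))) PUnit.unit PUnit.unit *
        mat f p.right j else 0) * (if j = j then ((1 : ℂˣ) : ℂ) else 0) = _
      by_cases h : p.out = Y.lab j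
      · rw [if_pos h, show mat (𝟙 (single D (elt 1))) PUnit.unit PUnit.unit = 1 from
          (mat_id_apply _ _ _).trans (if_pos rfl)]
        simp
      · rw [if_neg h, zero_mul]
        refine (mat_homog f ?_).symm
        rwa [fuses_one_left.1 p.fuses]
  · refine ((Finset.sum_eq_single p.right ?_ ?_).trans ?_).symm
    · intro q _ hq
      exact mul_eq_zero_of_left (if_neg hq.symm) _
    · exact fun h => absurd (Finset.mem_univ _) h
    · change (if p.right = p.right then ((1 : ℂˣ) : ℂ) else 0) * _ = _
      simp
      rfl

theorem rightUnitor_nat {X Y : TY D} (f : X ⟶ Y) :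
    tensorMap f (𝟙 (single D (elt 1))) ≫ (rightUnitor Y).hom = (rightUnitor X).hom ≫ f := by
  refine hom_ext (Matrix.ext fun (p : TensorIdx X (single D (elt 1))) j => ?_)
  refine Eq.trans (b := mat f p.left j) ?_ ?_
  · refine (Finset.sum_eq_single (⟨j, PUnit.unit, Y.lab j, fuses_one_right.2 rfl⟩ :
      TensorIdx Y (single D (elt 1))) ?_ ?_).trans ?_
    · intro q _ hq
      refine mul_eq_zero_of_right _ (if_neg ?_)
      rintro rfl
      exact hq (TensorIdx.ext rfl rfl (fuses_one_right.1 q.fuses).symm)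
    · exact fun h => absurd (Finset.mem_univ _) h
    · change (if p.out = Y.lab j then mat f p.left j *
        mat (𝟙 (single D (elt 1))) PUnit.unit PUnit.unit else 0) * (if j = j then ((1 : ℂˣ) : ℂ) else 0) = _
      by_cases h : p.out = Y.lab j
      · rw [if_pos h, show mat (𝟙 (single D (elt 1))) PUnit.unit PUnit.unit = 1 from
          (mat_id_apply _ _ _).trans (if_pos rfl)]
        simp
      · rw [if_neg h, zero_mul]
        refine (mat_homog f ?_).symm
        rwa [fuses_one_right.1 p.fuses]
  · refine ((Finset.sum_eq_single p.left ?_ ?_).trans ?_).symm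
    · intro q _ hq
      exact mul_eq_zero_of_left (if_neg hq.symm) _
    · exact fun h => absurd (Finset.mem_univ _) h
    · change (if p.left = p.left then ((1 : ℂˣ) : ℂ) else 0) * _ = _
      simp
      rfl

theorem assocInvCoeff_unit (s r d w v : Label C) : assocInvCoeff D s (elt 1) r d w v = 1 := by
  cases s <;> cases r <;> cases d <;> simp [assocInvCoeff]

theorem triangle_eq (X Y : TY D) :
    assocHom X (single D (elt 1)) Y ≫ tensorMap (𝟙 X) (leftUnitor Y).hom =
      tensorMap (rightUnitor X).hom (𝟙 Y) := by
  refine hom_ext (Matrix.ext fun (p : TensorIdx (tensor X (single D (elt 1))) Y)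
    (r : TensorIdx X Y) => ?_)
  obtain ⟨⟨i, _, u, h1⟩, k, d, h2⟩ := p
  obtain ⟨i', k', d', h3⟩ := r
  obtain rfl := fuses_one_right.1 h1
  have R := sum_idx_right (X := X) (Y := single D (elt 1)) (Z := Y) i PUnit.unit k d fun _ =>
    if i = i' ∧ k = k' ∧ d = d' then 1 else 0
  refine ((Finset.sum_congr rfl ?_).trans R).trans ?_
  · rintro ⟨i2, ⟨x2, l2, s2, h7⟩, d2, h8⟩ -
    change (if i = i2 ∧ PUnit.unit = x2 ∧ k = l2 ∧ d = d2 then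
        assocInvCoeff D _ (elt 1) _ _ _ _ else 0) *
      (if d2 = d' then (if i2 = i' then 1 else 0) *
        (if l2 = k' then ((1 : ℂˣ) : ℂ) else 0) else 0) =
      if i = i2 ∧ PUnit.unit = x2 ∧ k = l2 ∧ d = d2 then
        (if i = i' ∧ k = k' ∧ d = d' then 1 else 0) else 0
    rw [assocInvCoeff_unit]
    split_ifs <;> simp_all
  · change (∑ v, if Fuses (elt 1) (Y.lab k) v ∧ Fuses (X.lab i) v d then
      (if i = i' ∧ k = k' ∧ d = d' then (1 : ℂ) else 0) else 0) =
      if d = d' then (if i = i' then ((1 : ℂˣ) : ℂ) else 0) * (if k = k' then 1 else 0) else 0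
    rw [Finset.sum_eq_single (Y.lab k)]
    · rw [if_pos ⟨fuses_one_left.2 rfl, h2⟩]
      split_ifs <;> simp_all
    · intro s _ hs
      exact if_neg fun h => hs (fuses_one_left.1 h.1).symm
    · simp

instance : MonoidalCategory (TY D) :=
  MonoidalCategory.ofTensorHom
    (id_tensorHom_id := tensorMap_id)
    (id_tensorHom := fun _ _ _ _ => rfl)
    (tensorHom_id := fun _ _ => rfl)
    (tensorHom_comp_tensorHom := fun f g f' g' => tensorMap_comp f f' g g')
    (associator_naturality := assocHom_naturality)
    (leftUnitor_naturality := leftUnitor_nat)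
    (rightUnitor_naturality := rightUnitor_nat)
    (pentagon := pentagon_eq)
    (triangle := triangle_eq)

/-! ### The strict `ℤ/2`-action -/

theorem iso_comp_apply {X Y Z : TY D} (e : X.ι ≃ Y.ι) (he : ∀ i, X.lab i = Y.lab (e i)) (c : ℂˣ)
    (f : Y ⟶ Z) (i : X.ι) (k : Z.ι) :
    mat ((isoOfEquiv e he c).hom ≫ f) i k = c * mat f (e i) k := by
  refine (Finset.sum_eq_single (e i) ?_ ?_).trans ?_
  · intro j _ hj
    exact mul_eq_zero_of_left (if_neg hj.symm) _
  · exact fun h => absurd (Finset.mem_univ _) h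
  · exact congrArg (· * _) (if_pos rfl)

theorem comp_iso_apply {X Y Z : TY D} (e : Y.ι ≃ Z.ι) (he : ∀ i, Y.lab i = Z.lab (e i)) (c : ℂˣ)
    (f : X ⟶ Y) (i : X.ι) (k : Z.ι) :
    mat (f ≫ (isoOfEquiv e he c).hom) i k = mat f i (e.symm k) * c := by
  refine (Finset.sum_eq_single (e.symm k) ?_ ?_).trans ?_
  · intro j _ hj
    refine mul_eq_zero_of_right _ (if_neg ?_)
    rintro rfl
    simp at hj
  · exact fun h => absurd (Finset.mem_univ _) h
  · exact congrArg (_ * ·) (if_pos (e.apply_symm_apply k))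

theorem id_eq_iso (X : TY D) : 𝟙 X = (isoOfEquiv (Equiv.refl X.ι) fun _ => rfl).hom := rfl

def tensorEquiv {X X' Y Y' : TY D} (e : X.ι ≃ X'.ι) (he : ∀ i, X.lab i = X'.lab (e i))
    (e' : Y.ι ≃ Y'.ι) (he' : ∀ i, Y.lab i = Y'.lab (e' i)) : TensorIdx X Y ≃ TensorIdx X' Y' where
  toFun p := ⟨e p.left, e' p.right, p.out, he p.left ▸ he' p.right ▸ p.fuses⟩
  invFun p := ⟨e.symm p.left, e'.symm p.right, p.out, by
    rw [he, he', e.apply_symm_apply, e'.apply_symm_apply]; exact p.fuses⟩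
  left_inv p := TensorIdx.ext (e.symm_apply_apply _) (e'.symm_apply_apply _) rfl
  right_inv p := TensorIdx.ext (e.apply_symm_apply _) (e'.apply_symm_apply _) rfl

theorem tensorMap_iso {X X' Y Y' : TY D} (e : X.ι ≃ X'.ι) (he : ∀ i, X.lab i = X'.lab (e i))
    (e' : Y.ι ≃ Y'.ι) (he' : ∀ i, Y.lab i = Y'.lab (e' i)) :
    tensorMap (isoOfEquiv e he).hom (isoOfEquiv e' he').hom =
      (isoOfEquiv (X := tensor X Y) (Y := tensor X' Y') (tensorEquiv e he e' he')
        fun _ => rfl).hom := by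
  refine hom_ext (Matrix.ext fun (p : TensorIdx X Y) (r : TensorIdx X' Y') => ?_)
  change (if p.out = r.out then (if e p.left = r.left then ((1 : ℂˣ) : ℂ) else 0) *
    (if e' p.right = r.right then ((1 : ℂˣ) : ℂ) else 0) else 0) =
    if tensorEquiv e he e' he' p = r then ((1 : ℂˣ) : ℂ) else 0
  have : tensorEquiv e he e' he' p = r ↔
      e p.left = r.left ∧ e' p.right = r.right ∧ p.out = r.out := TensorIdx.ext_iff
  rw [this]
  split_ifs <;> simp_all

theorem tensorMap_iso_comp {X X' Y Y' W : TY D} (e : X.ι ≃ X'.ι)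
    (he : ∀ i, X.lab i = X'.lab (e i)) (e' : Y.ι ≃ Y'.ι) (he' : ∀ i, Y.lab i = Y'.lab (e' i))
    (f : tensor X' Y' ⟶ W) (p : TensorIdx X Y) (r : W.ι) :
    mat (tensorMap (isoOfEquiv e he).hom (isoOfEquiv e' he').hom ≫ f) p r =
      mat f (tensorEquiv e he e' he' p) r := by
  rw [tensorMap_iso]
  exact (iso_comp_apply _ _ _ _ _ _).trans (one_mul _)

theorem tensorMap_iso_id_comp {X X' Y W : TY D} (e : X.ι ≃ X'.ι)
    (he : ∀ i, X.lab i = X'.lab (e i)) (f : tensor X' Y ⟶ W) (p : TensorIdx X Y) (r : W.ι) :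
    mat (tensorMap (isoOfEquiv e he).hom (𝟙 Y) ≫ f) p r =
      mat f (tensorEquiv e he (Equiv.refl Y.ι) (fun _ => rfl) p) r :=
  tensorMap_iso_comp e he (Equiv.refl Y.ι) (fun _ => rfl) f p r

theorem tensorMap_id_iso_comp {X Y Y' W : TY D} (e' : Y.ι ≃ Y'.ι)
    (he' : ∀ i, Y.lab i = Y'.lab (e' i)) (f : tensor X Y' ⟶ W) (p : TensorIdx X Y) (r : W.ι) :
    mat (tensorMap (𝟙 X) (isoOfEquiv e' he').hom ≫ f) p r =
      mat f (tensorEquiv (Equiv.refl X.ι) (fun _ => rfl) e' he' p) r :=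
  tensorMap_iso_comp (Equiv.refl X.ι) (fun _ => rfl) e' he' f p r

theorem comp_tensorMap_id_iso {X Y Y' W : TY D} (e' : Y.ι ≃ Y'.ι)
    (he' : ∀ i, Y.lab i = Y'.lab (e' i)) (f : W ⟶ tensor X Y) (r : W.ι) (p : TensorIdx X Y') :
    mat (f ≫ tensorMap (𝟙 X) (isoOfEquiv e' he').hom) r p =
      mat f r ((tensorEquiv (Equiv.refl X.ι) (fun _ => rfl) e' he').symm p) := by
  have h : tensorMap (𝟙 X) (isoOfEquiv e' he').hom = _ :=
    tensorMap_iso (Equiv.refl X.ι) (fun _ => rfl) e' he'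
  rw [h]
  exact (comp_iso_apply _ _ _ _ _ _).trans (mul_one _)

/-- The autoequivalence `ρ_g`: it acts on labels and is the identity on matrices, so that `ρ_{-1}`
sends `a` to `a⁻¹` and fixes `σ`. -/
def act (g : ℤˣ) : TY D ⥤ TY D where
  obj X := ⟨X.ι, fun i => g • X.lab i⟩
  map {X Y} f := ⟨mat (X := X) (Y := Y) f, fun i j h => mat_homog (X := X) (Y := Y) f fun h' =>
    h (congrArg (g • ·) h')⟩

/-- The isomorphism `ρ_g(X) ⊗ ρ_g(Y) ≅ ρ_g(X ⊗ Y)`, the identity on simple summands. -/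
def actMu (g : ℤˣ) (X Y : TY D) :
    (act g).obj X ⊗ (act g).obj Y ≅ (act g).obj (X ⊗ Y) :=
  isoOfEquiv
    ⟨fun (p : TensorIdx ((act g).obj X) ((act g).obj Y)) =>
        (⟨p.left, p.right, g⁻¹ • p.out, by
          have h := p.fuses.smul g⁻¹
          change Fuses (g⁻¹ • g • X.lab p.left) (g⁻¹ • g • Y.lab p.right) _ at h
          rwa [inv_smul_smul, inv_smul_smul] at h⟩ : TensorIdx X Y),
      fun (p : TensorIdx X Y) =>
        (⟨p.left, p.right, g • p.out, p.fuses.smul g⟩ :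
          TensorIdx ((act g).obj X) ((act g).obj Y)),
      fun p => TensorIdx.ext rfl rfl (smul_inv_smul g p.out),
      fun p => TensorIdx.ext rfl rfl (inv_smul_smul g p.out)⟩
    fun p => (smul_inv_smul g (TensorIdx.out p)).symm

/-- The isomorphism `𝟙 ≅ ρ_g(𝟙)`, an identity. -/
def actEps (g : ℤˣ) : 𝟙_ (TY D) ≅ (act g).obj (𝟙_ (TY D)) :=
  isoOfEquiv (Equiv.refl PUnit) fun _ => by
    change elt 1 = g • (elt 1 : Label C)
    simp

/-- The isomorphism `ρ_g(ρ_h(X)) ≅ ρ_{hg}(X)`, an identity. -/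
def actComp (g h : ℤˣ) (X : TY D) : (act g).obj ((act h).obj X) ≅ (act (h * g)).obj X :=
  isoOfEquiv (Equiv.refl X.ι) fun i => by
    change g • h • X.lab i = (h * g) • X.lab i
    rw [smul_smul, mul_comm]

theorem assocInvCoeff_smul (g : ℤˣ) (s t r d w v : Label C) :
    assocInvCoeff D (g • s) (g • t) (g • r) (g • d) (g • w) (g • v) =
      assocInvCoeff D s t r d w v := by
  rcases Int.units_eq_one_or g with rfl | rfl
  · simp only [one_smul]
  · rcases s with s | _ <;> rcases t with t | _ <;> rcases r with r | _ <;> rcases d with d | _ <;>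
      rcases w with w | _ <;> rcases v with v | _ <;> simp [assocInvCoeff]

theorem actMu_natural (g : ℤˣ) {X X' Y Y' : TY D} (f : X ⟶ X') (h : Y ⟶ Y') :
    tensorMap ((act g).map f) ((act g).map h) ≫ (actMu g X' Y').hom =
      (actMu g X Y).hom ≫ (act g).map (tensorMap f h) := by
  refine hom_ext (Matrix.ext fun (p : TensorIdx ((act g).obj X) ((act g).obj Y))
    (r : TensorIdx X' Y') => ?_)
  refine (comp_iso_apply _ _ _ _ _ _).trans (Eq.trans ?_ (iso_comp_apply _ _ _ _ _ _).symm)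
  change (if p.out = g • r.out then mat f p.left r.left * mat h p.right r.right else 0) *
    ((1 : ℂˣ) : ℂ) = ((1 : ℂˣ) : ℂ) *
    (if g⁻¹ • p.out = r.out then mat f p.left r.left * mat h p.right r.right else 0)
  simp only [inv_smul_eq_iff, Units.val_one, mul_one, one_mul]

theorem actMu_assoc (g : ℤˣ) (X Y Z : TY D) :
    tensorMap (actMu g X Y).hom (𝟙 ((act g).obj Z)) ≫ (actMu g (X ⊗ Y) Z).hom ≫
        (act g).map (assocHom X Y Z) =
      assocHom ((act g).obj X) ((act g).obj Y) ((act g).obj Z) ≫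
        tensorMap (𝟙 ((act g).obj X)) (actMu g Y Z).hom ≫ (actMu g X (Y ⊗ Z)).hom := by
  refine hom_ext (Matrix.ext fun (p : TensorIdx (tensor ((act g).obj X) ((act g).obj Y))
    ((act g).obj Z)) (r : TensorIdx X (tensor Y Z)) => ?_)
  rw [← Category.assoc (assocHom _ _ _)]
  refine ((tensorMap_iso_id_comp _ _ _ _ _).trans (iso_comp_apply _ _ _ _ _ _)).trans
    (Eq.trans ?_ ((comp_iso_apply _ _ _ _ _ _).trans
      (congrArg (· * _) (comp_tensorMap_id_iso _ _ _ _ _))).symm)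
  obtain ⟨⟨i, j, w, h1⟩, k, d, h2⟩ := p
  obtain ⟨i', ⟨j', k', v, h1'⟩, d', h2'⟩ := r
  change ((1 : ℂˣ) : ℂ) * (if i = i' ∧ j = j' ∧ k = k' ∧ g⁻¹ • d = d' then
      assocInvCoeff D (X.lab i) (Y.lab j) (Z.lab k) (g⁻¹ • d) (g⁻¹ • w) v else 0) =
    (if i = i' ∧ j = j' ∧ k = k' ∧ d = g • d' then
      assocInvCoeff D (g • X.lab i) (g • Y.lab j) (g • Z.lab k) d w (g • v) else 0) *
      ((1 : ℂˣ) : ℂ)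
  rw [← assocInvCoeff_smul g]
  simp only [smul_inv_smul, inv_smul_eq_iff, Units.val_one, mul_one, one_mul]

theorem act_left_unit (g : ℤˣ) (X : TY D) :
    (leftUnitor ((act g).obj X)).hom = tensorMap (actEps g).hom (𝟙 ((act g).obj X)) ≫
      (actMu g (𝟙_ (TY D)) X).hom ≫ (act g).map (leftUnitor X).hom := by
  refine hom_ext (Matrix.ext fun (p : TensorIdx (𝟙_ (TY D)) ((act g).obj X)) (j : X.ι) => ?_)
  refine Eq.trans ?_ ((tensorMap_iso_id_comp _ _ _ _ _).trans (iso_comp_apply _ _ _ _ _ _)).symm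
  exact (one_mul _).symm

theorem act_right_unit (g : ℤˣ) (X : TY D) :
    (rightUnitor ((act g).obj X)).hom = tensorMap (𝟙 ((act g).obj X)) (actEps g).hom ≫
      (actMu g X (𝟙_ (TY D))).hom ≫ (act g).map (rightUnitor X).hom := by
  refine hom_ext (Matrix.ext fun (p : TensorIdx ((act g).obj X) (𝟙_ (TY D))) (j : X.ι) => ?_)
  refine Eq.trans ?_ ((tensorMap_id_iso_comp _ _ _ _ _).trans (iso_comp_apply _ _ _ _ _ _)).symm
  exact (one_mul _).symm

instance (g : ℤˣ) : (act (D := D) g).Monoidal :=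
  Functor.CoreMonoidal.toMonoidal
    { εIso := actEps g
      μIso := actMu g
      μIso_hom_natural_left := fun f X' => by
        have := actMu_natural g f (𝟙 X')
        rwa [CategoryTheory.Functor.map_id] at this
      μIso_hom_natural_right := fun X' f => by
        have := actMu_natural g (𝟙 X') f
        rwa [CategoryTheory.Functor.map_id] at this
      associativity := actMu_assoc g
      left_unitality := act_left_unit g
      right_unitality := act_right_unit g }

theorem actComp_natural (g h : ℤˣ) {X Y : TY D} (f : X ⟶ Y) :
    (act g).map ((act h).map f) ≫ (actComp g h Y).hom =
      (actComp g h X).hom ≫ (act (h * g)).map f := by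
  refine hom_ext (Matrix.ext fun (i : X.ι) (j : Y.ι) => ?_)
  refine (comp_iso_apply _ _ _ _ _ _).trans (Eq.trans ?_ (iso_comp_apply _ _ _ _ _ _).symm)
  exact (mul_one _).trans (one_mul _).symm

theorem actComp_mu (g h : ℤˣ) (X Y : TY D) :
    ((actComp g h X).hom ⊗ₘ (actComp g h Y).hom) ≫ (actMu (h * g) X Y).hom =
      (actMu g _ _).hom ≫ (act g).map (actMu h X Y).hom ≫ (actComp g h (X ⊗ Y)).hom := by
  refine hom_ext (Matrix.ext fun (p : TensorIdx ((act g).obj ((act h).obj X))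
    ((act g).obj ((act h).obj Y))) (r : TensorIdx X Y) => ?_)
  refine (tensorMap_iso_comp _ _ _ _ _ _ _).trans (Eq.trans ?_ ((iso_comp_apply _ _ _ _ _ _).trans
    (congrArg (_ * ·) (comp_iso_apply _ _ _ _ _ _))).symm)
  obtain ⟨i, k, w, h1⟩ := p
  obtain ⟨i', k', w', h1'⟩ := r
  change (if (⟨i, k, (h * g)⁻¹ • w, _⟩ : TensorIdx X Y) = ⟨i', k', w', h1'⟩ then
      ((1 : ℂˣ) : ℂ) else 0) = ((1 : ℂˣ) : ℂ) *
    ((if (⟨i, k, h⁻¹ • g⁻¹ • w, _⟩ : TensorIdx X Y) = ⟨i', k', w', h1'⟩ then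
      ((1 : ℂˣ) : ℂ) else 0) * ((1 : ℂˣ) : ℂ))
  have : (h * g)⁻¹ • w = h⁻¹ • g⁻¹ • w := by rw [smul_smul, mul_inv_rev, mul_comm]
  simp only [this, mul_one, Units.val_one]
  exact (one_mul _).symm

theorem actComp_eps (g h : ℤˣ) :
    (actEps (D := D) g).hom ≫ (act g).map (actEps h).hom ≫ (actComp g h _).hom =
      (actEps (h * g)).hom := by
  refine hom_ext (Matrix.ext fun (i : PUnit) (j : PUnit) => ?_)
  refine ((iso_comp_apply _ _ _ _ _ _).trans (congrArg (_ * ·) (comp_iso_apply _ _ _ _ _ _))).trans ?_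
  exact (one_mul _).trans (mul_one _)

end TY

open TY

/-! ### The equivariantisation -/

/-- A `ℤ/2`-equivariant object `(X, u)`. -/
structure EqObj (D : Datum C) where
  X : TY D
  u : ∀ g : ℤˣ, (act g).obj X ≅ X
  comm : ∀ g h : ℤˣ, (act g).map (u h).hom ≫ (u g).hom = (actComp g h X).hom ≫ (u (h * g)).hom

namespace EqObj

/-- A morphism of equivariant objects. -/
@[ext]
structure Hom (M N : EqObj D) where
  hom : M.X ⟶ N.X
  comm : ∀ g : ℤˣ, (M.u g).hom ≫ hom = (act g).map hom ≫ (N.u g).hom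

instance : Category (EqObj D) where
  Hom M N := Hom M N
  id M := ⟨𝟙 M.X, fun g => by simp⟩
  comp f h := ⟨f.hom ≫ h.hom, fun g => by
    rw [← Category.assoc, f.comm, Category.assoc, h.comm, Functor.map_comp, Category.assoc]⟩
  id_comp f := Hom.ext (Category.id_comp f.hom)
  comp_id f := Hom.ext (Category.comp_id f.hom)
  assoc f g h := Hom.ext (Category.assoc f.hom g.hom h.hom)

/-- The underlying morphism of `TY(C,q,κ,δ)`. -/
def toHom {M N : EqObj D} (f : M ⟶ N) : M.X ⟶ N.X := Hom.hom f

@[ext] theorem hom_ext {M N : EqObj D} {f g : M ⟶ N} (h : toHom f = toHom g) : f = g := Hom.ext h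

theorem toHom_comm {M N : EqObj D} (f : M ⟶ N) (g : ℤˣ) :
    (M.u g).hom ≫ toHom f = (act g).map (toHom f) ≫ (N.u g).hom := Hom.comm f g

@[simp] theorem toHom_id (M : EqObj D) : toHom (𝟙 M) = 𝟙 M.X := rfl

@[simp] theorem toHom_comp {M N P : EqObj D} (f : M ⟶ N) (g : N ⟶ P) :
    toHom (f ≫ g) = toHom f ≫ toHom g := rfl

/-- Isomorphisms of equivariant objects from equivariant isomorphisms of underlying objects. -/
def mkIso {M N : EqObj D} (f : M.X ≅ N.X)
    (hf : ∀ g : ℤˣ, (M.u g).hom ≫ f.hom = (act g).map f.hom ≫ (N.u g).hom) : M ≅ N where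
  hom := ⟨f.hom, hf⟩
  inv := ⟨f.inv, fun g => by
    rw [← cancel_mono f.hom, Category.assoc, Category.assoc, hf, ← Functor.map_comp_assoc,
      f.inv_hom_id, Category.comp_id, CategoryTheory.Functor.map_id, Category.id_comp]⟩
  hom_inv_id := Hom.ext f.hom_inv_id
  inv_hom_id := Hom.ext f.inv_hom_id

/-! #### Additive structure -/

instance (M N : EqObj D) : Zero (M ⟶ N) :=
  ⟨⟨0, fun g => by
    rw [comp_zero]
    exact (zero_comp (f := (N.u g).hom)).symm⟩⟩

theorem act_map_add (g : ℤˣ) {X Y : TY D} (f h : X ⟶ Y) :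
    (act g).map (f + h) = (act g).map f + (act g).map h := rfl

theorem act_map_neg (g : ℤˣ) {X Y : TY D} (f : X ⟶ Y) :
    (act g).map (-f) = -(act g).map f := rfl

instance (M N : EqObj D) : Add (M ⟶ N) :=
  ⟨fun f h => ⟨toHom f + toHom h, fun g => by
    rw [Preadditive.comp_add, toHom_comm, toHom_comm, act_map_add, Preadditive.add_comp]⟩⟩

instance (M N : EqObj D) : Neg (M ⟶ N) :=
  ⟨fun f => ⟨-toHom f, fun g => by
    rw [Preadditive.comp_neg, toHom_comm, act_map_neg, Preadditive.neg_comp]⟩⟩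

instance (M N : EqObj D) : AddCommGroup (M ⟶ N) where
  add_assoc _ _ _ := hom_ext (add_assoc _ _ _)
  zero_add _ := hom_ext (zero_add _)
  add_zero _ := hom_ext (add_zero _)
  neg_add_cancel _ := hom_ext (neg_add_cancel _)
  add_comm _ _ := hom_ext (add_comm _ _)
  nsmul := nsmulRec
  zsmul := zsmulRec

@[simp] theorem toHom_zero (M N : EqObj D) : toHom (0 : M ⟶ N) = 0 := rfl
@[simp] theorem toHom_add {M N : EqObj D} (f g : M ⟶ N) : toHom (f + g) = toHom f + toHom g := rfl

instance : Preadditive (EqObj D) where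
  add_comp _ _ _ f f' g := hom_ext (by simp [Preadditive.add_comp])
  comp_add _ _ _ f g g' := hom_ext (by simp [Preadditive.comp_add])

/-- The matrix of `u g`. -/
def uMat (M : EqObj D) (g : ℤˣ) : Matrix M.X.ι M.X.ι ℂ := mat (X := (act g).obj M.X) (M.u g).hom

theorem uMat_homog (M : EqObj D) (g : ℤˣ) {i j : M.X.ι} (h : g • M.X.lab i ≠ M.X.lab j) :
    M.uMat g i j = 0 := mat_homog (M.u g).hom h

theorem uMat_mul (M : EqObj D) (g h : ℤˣ) : M.uMat h * M.uMat g = M.uMat (h * g) := by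
  refine (congrArg mat (M.comm g h)).trans (Matrix.ext fun i j => ?_)
  exact (iso_comp_apply _ _ _ _ _ _).trans (one_mul _)

theorem uMat_one (M : EqObj D) : M.uMat 1 = 1 := by
  have h1 := M.uMat_mul 1 1
  rw [mul_one] at h1
  let V : Matrix M.X.ι M.X.ι ℂ := mat (Y := (act 1).obj M.X) (M.u 1).inv
  have h2 : M.uMat 1 * V = 1 := congrArg mat (M.u 1).hom_inv_id
  calc M.uMat 1 = M.uMat 1 * (M.uMat 1 * V) := by rw [h2, Matrix.mul_one]
    _ = 1 := by rw [← Matrix.mul_assoc, h1, h2]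

/-- An equivariant object from the matrices of the `u g`. -/
def ofMat (X : TY D) (U : ℤˣ → Matrix X.ι X.ι ℂ)
    (hU : ∀ g i j, g • X.lab i ≠ X.lab j → U g i j = 0) (h1 : U 1 = 1)
    (hmul : ∀ g h, U h * U g = U (h * g)) : EqObj D where
  X := X
  u g :=
    { hom := ⟨U g, hU g⟩
      inv := ⟨U g⁻¹, fun i j h => hU g⁻¹ i j fun h' => h (by
        change X.lab i = g • X.lab j
        rw [← h', smul_inv_smul])⟩
      hom_inv_id := TY.hom_ext (by
        refine (hmul g⁻¹ g).trans ?_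
        rw [mul_inv_cancel, h1]; rfl)
      inv_hom_id := TY.hom_ext (by
        refine (hmul g g⁻¹).trans ?_
        rw [inv_mul_cancel, h1]; rfl) }
  comm g h := TY.hom_ext ((hmul g h).trans (Matrix.ext fun i j =>
    ((iso_comp_apply _ _ _ _ _ _).trans (one_mul _)).symm))

/-- A morphism of equivariant objects, with equivariance checked on matrices. -/
def mkHom {M N : EqObj D} (f : M.X ⟶ N.X)
    (hf : ∀ g, M.uMat g * mat f = mat f * N.uMat g) : M ⟶ N :=
  ⟨f, fun g => TY.hom_ext (hf g)⟩

theorem toHom_mat (M N : EqObj D) (f : M ⟶ N) (g : ℤˣ) :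
    M.uMat g * mat (toHom f) = mat (toHom f) * N.uMat g := congrArg mat (toHom_comm f g)

/-- The direct sum of a finite family of equivariant objects. -/
def directSum {n : ℕ} (F : Fin n → EqObj D) : EqObj D :=
  ofMat ⟨Σ j, (F j).X.ι, fun p => (F p.1).X.lab p.2⟩
    (fun g => Matrix.blockDiagonal' fun j => (F j).uMat g)
    (by
      rintro g ⟨i, a⟩ ⟨j, b⟩ h
      by_cases hij : i = j
      · subst hij
        rw [Matrix.blockDiagonal'_apply_eq]
        exact uMat_homog _ _ h
      · exact Matrix.blockDiagonal'_apply_ne _ _ _ hij)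
    (by
      simp only [uMat_one]
      ext ⟨i, a⟩ ⟨j, b⟩
      by_cases hij : i = j
      · subst hij
        simp [Matrix.one_apply]
      · refine (Matrix.blockDiagonal'_apply_ne _ _ _ hij).trans (if_neg fun h => hij ?_).symm
        exact congrArg Sigma.fst h)
    (fun g h => by
      rw [← Matrix.blockDiagonal'_mul]
      simp only [uMat_mul])

theorem blockDiagonal'_mul_apply {n : ℕ} {m : Fin n → Type u} [∀ j, Fintype (m j)] {β : Type*}
    (U : ∀ j, Matrix (m j) (m j) ℂ) (f : Matrix (Σ j, m j) β ℂ) (j : Fin n) (a : m j) (b : β) :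
    (Matrix.blockDiagonal' U * f) ⟨j, a⟩ b = ∑ c, U j a c * f ⟨j, c⟩ b := by
  rw [Matrix.mul_apply, Fintype.sum_sigma, Finset.sum_eq_single j]
  · simp only [Matrix.blockDiagonal'_apply_eq]
  · intro k _ hk
    exact Finset.sum_eq_zero fun c _ => by
      rw [Matrix.blockDiagonal'_apply_ne _ _ _ hk.symm, zero_mul]
  · simp

theorem mul_blockDiagonal'_apply {n : ℕ} {m : Fin n → Type u} [∀ j, Fintype (m j)] {β : Type*}
    (U : ∀ j, Matrix (m j) (m j) ℂ) (f : Matrix β (Σ j, m j) ℂ) (j : Fin n) (a : m j) (b : β) :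
    (f * Matrix.blockDiagonal' U) b ⟨j, a⟩ = ∑ c, f b ⟨j, c⟩ * U j c a := by
  rw [Matrix.mul_apply, Fintype.sum_sigma, Finset.sum_eq_single j]
  · simp only [Matrix.blockDiagonal'_apply_eq]
  · intro k _ hk
    exact Finset.sum_eq_zero fun c _ => by
      rw [Matrix.blockDiagonal'_apply_ne _ _ _ hk, mul_zero]
  · simp

/-- The projections of a direct sum. -/
def directSumπ {n : ℕ} (F : Fin n → EqObj D) (j : Fin n) : directSum F ⟶ F j :=
  mkHom ⟨Matrix.of fun (p : Σ j, (F j).X.ι) (b : (F j).X.ι) => if p = ⟨j, b⟩ then 1 else 0, by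
      rintro p b h
      refine if_neg ?_
      rintro rfl
      exact h rfl⟩ (fun g => by
    refine Matrix.ext fun (p : Σ j, (F j).X.ι) b => ?_
    obtain ⟨i, a⟩ := p
    refine (blockDiagonal'_mul_apply (fun j => (F j).uMat g) _ _ _ _).trans ?_
    refine Eq.trans ?_ (Matrix.mul_apply).symm
    change ∑ c, (F i).uMat g a c * (if (⟨i, c⟩ : Σ j, (F j).X.ι) = ⟨j, b⟩ then 1 else 0) =
      ∑ c, (if (⟨i, a⟩ : Σ j, (F j).X.ι) = ⟨j, c⟩ then 1 else 0) * (F j).uMat g c b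
    by_cases hij : i = j
    · subst hij
      simp
    · simp [hij])

/-- The inclusions of a direct sum. -/
def directSumι {n : ℕ} (F : Fin n → EqObj D) (j : Fin n) : F j ⟶ directSum F :=
  mkHom ⟨Matrix.of fun (b : (F j).X.ι) (p : Σ j, (F j).X.ι) => if p = ⟨j, b⟩ then 1 else 0, by
      rintro b p h
      refine if_neg ?_
      rintro rfl
      exact h rfl⟩ (fun g => by
    refine Matrix.ext fun b (p : Σ j, (F j).X.ι) => ?_
    obtain ⟨i, a⟩ := p
    refine Eq.trans ?_ (mul_blockDiagonal'_apply (fun j => (F j).uMat g) _ _ _ _).symm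
    refine (Matrix.mul_apply).trans ?_
    change ∑ c, (F j).uMat g b c * (if (⟨i, a⟩ : Σ j, (F j).X.ι) = ⟨j, c⟩ then 1 else 0) =
      ∑ c, (if (⟨i, c⟩ : Σ j, (F j).X.ι) = ⟨j, b⟩ then 1 else 0) * (F i).uMat g c a
    by_cases hij : i = j
    · subst hij
      simp
    · simp [hij])

theorem toHom_sum {M N : EqObj D} {J : Type*} (s : Finset J) (f : J → (M ⟶ N)) :
    mat (toHom (∑ j ∈ s, f j)) = ∑ j ∈ s, mat (toHom (f j)) := by
  induction s using Finset.induction_on with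
  | empty => rfl
  | insert a s h ih =>
    rw [Finset.sum_insert h, Finset.sum_insert h, ← ih]
    rfl

theorem directSum_ι_π {n : ℕ} (F : Fin n → EqObj D) (j k : Fin n) :
    directSumι F j ≫ directSumπ F k = if h : j = k then eqToHom (congrArg F h) else 0 := by
  refine hom_ext (TY.hom_ext (Matrix.ext fun (a : (F j).X.ι) (b : (F k).X.ι) => ?_))
  refine (Finset.sum_eq_single (⟨j, a⟩ : Σ j, (F j).X.ι) ?_ ?_).trans ?_
  · intro p _ hp
    exact mul_eq_zero_of_left (if_neg hp) _
  · exact fun h => absurd (Finset.mem_univ _) h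
  · change (if (⟨j, a⟩ : Σ j, (F j).X.ι) = ⟨j, a⟩ then (1 : ℂ) else 0) *
      (if (⟨j, a⟩ : Σ j, (F j).X.ι) = ⟨k, b⟩ then 1 else 0) = _
    rw [if_pos rfl, one_mul]
    by_cases h : j = k
    · subst h
      rw [dif_pos rfl]
      refine Eq.trans ?_ (mat_id_apply (F j).X a b).symm
      simp
    · rw [dif_neg h, if_neg (by simp [h])]
      rfl

theorem directSum_total {n : ℕ} (F : Fin n → EqObj D) :
    ∑ j, directSumπ F j ≫ directSumι F j = 𝟙 (directSum F) := by
  refine hom_ext (TY.hom_ext ?_)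
  refine (toHom_sum _ _).trans (Matrix.ext fun (p : Σ j, (F j).X.ι) (r : Σ j, (F j).X.ι) => ?_)
  refine (Matrix.sum_apply _ _ _ _).trans ?_
  refine Eq.trans ?_ (mat_id_apply (directSum F).X p r).symm
  change ∑ j, ∑ c : (F j).X.ι, (if p = ⟨j, c⟩ then (1 : ℂ) else 0) *
    (if r = ⟨j, c⟩ then 1 else 0) = _
  have h := Fintype.sum_sigma (fun z : (Σ j, (F j).X.ι) => (if p = z then (1 : ℂ) else 0) *
    (if r = z then 1 else 0))
  refine h.symm.trans ?_
  simp only [ite_mul, one_mul, zero_mul, Finset.sum_ite_eq, Finset.mem_univ, if_true]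
  by_cases hpr : p = r
  · subst hpr
    exact (if_pos rfl).trans (if_pos rfl).symm
  · exact (if_neg fun h => hpr h.symm).trans (if_neg hpr).symm

instance : HasFiniteBiproducts (EqObj D) where
  out _ := ⟨fun F => hasBiproduct_of_total
    { pt := directSum F
      π := directSumπ F
      ι := directSumι F
      ι_π := fun j k => by rw [directSum_ι_π]; congr } (directSum_total F)⟩

/-! #### Monoidal structure -/

theorem tensor_comm (M N : EqObj D) (g h : ℤˣ) :
    (act g).map ((actMu h M.X N.X).inv ≫ ((M.u h).hom ⊗ₘ (N.u h).hom)) ≫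
        (actMu g M.X N.X).inv ≫ ((M.u g).hom ⊗ₘ (N.u g).hom) =
      (actComp g h (M.X ⊗ N.X)).hom ≫ (actMu (h * g) M.X N.X).inv ≫
        ((M.u (h * g)).hom ⊗ₘ (N.u (h * g)).hom) := by
  have n1 : ((act g).map (M.u h).hom ⊗ₘ (act g).map (N.u h).hom) ≫ (actMu g M.X N.X).hom =
      (actMu g _ _).hom ≫ (act g).map ((M.u h).hom ⊗ₘ (N.u h).hom) :=
    actMu_natural g (M.u h).hom (N.u h).hom
  have n2 : (act g).map ((M.u h).hom ⊗ₘ (N.u h).hom) ≫ (actMu g M.X N.X).inv =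
      (actMu g _ _).inv ≫ ((act g).map (M.u h).hom ⊗ₘ (act g).map (N.u h).hom) := by
    rw [Iso.comp_inv_eq, Category.assoc, n1, Iso.inv_hom_id_assoc]
  have n3 : (act g).map (actMu h M.X N.X).inv ≫ (actMu g _ _).inv ≫
      ((actComp g h M.X).hom ⊗ₘ (actComp g h N.X).hom) =
      (actComp g h (M.X ⊗ N.X)).hom ≫ (actMu (h * g) M.X N.X).inv := by
    rw [← Category.assoc, Iso.eq_comp_inv, Category.assoc, actComp_mu, Category.assoc,
      Iso.inv_hom_id_assoc, ← Functor.map_comp_assoc, Iso.inv_hom_id,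
      CategoryTheory.Functor.map_id, Category.id_comp]
  rw [Functor.map_comp, Category.assoc, reassoc_of% n2, tensorHom_comp_tensorHom, M.comm, N.comm,
    ← tensorHom_comp_tensorHom, reassoc_of% n3]

/-- The tensor product `(X, u) ⊗ (Y, v) = (X ⊗ Y, (u_g ⊗ v_g) ∘ (ρ_g²)⁻¹)`. -/
def tensorObj (M N : EqObj D) : EqObj D where
  X := M.X ⊗ N.X
  u g := (actMu g M.X N.X).symm ≪≫ (M.u g ⊗ᵢ N.u g)
  comm := tensor_comm M N

/-- The unit `(𝟙, (ρ_g⁰)⁻¹)`. -/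
def unitObj (D : Datum C) : EqObj D where
  X := 𝟙_ (TY D)
  u g := (actEps g).symm
  comm g h := by
    change (act g).map (actEps h).inv ≫ (actEps g).inv =
      (actComp g h (𝟙_ (TY D))).hom ≫ (actEps (h * g)).inv
    rw [Iso.eq_comp_inv, ← actComp_eps, Category.assoc, Iso.inv_hom_id_assoc,
      ← Functor.map_comp_assoc, Iso.inv_hom_id, CategoryTheory.Functor.map_id, Category.id_comp]

theorem tensorHom_comm {M N M' N' : EqObj D} (f : M ⟶ M') (h : N ⟶ N') (g : ℤˣ) :
    ((tensorObj M N).u g).hom ≫ (toHom f ⊗ₘ toHom h) =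
      (act g).map (toHom f ⊗ₘ toHom h) ≫ ((tensorObj M' N').u g).hom := by
  have n1 : ((act g).map (toHom f) ⊗ₘ (act g).map (toHom h)) ≫ (actMu g M'.X N'.X).hom =
      (actMu g _ _).hom ≫ (act g).map (toHom f ⊗ₘ toHom h) :=
    actMu_natural g (toHom f) (toHom h)
  change ((actMu g M.X N.X).inv ≫ ((M.u g).hom ⊗ₘ (N.u g).hom)) ≫ _ =
    _ ≫ (actMu g M'.X N'.X).inv ≫ ((M'.u g).hom ⊗ₘ (N'.u g).hom)
  have n2 : (act g).map (toHom f ⊗ₘ toHom h) ≫ (actMu g M'.X N'.X).inv =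
      (actMu g _ _).inv ≫ ((act g).map (toHom f) ⊗ₘ (act g).map (toHom h)) := by
    rw [Iso.comp_inv_eq, Category.assoc, n1, Iso.inv_hom_id_assoc]
  rw [reassoc_of% n2, tensorHom_comp_tensorHom, ← toHom_comm, ← toHom_comm,
    ← tensorHom_comp_tensorHom, Category.assoc]

theorem associator_comm (M N P : EqObj D) (g : ℤˣ) :
    ((tensorObj (tensorObj M N) P).u g).hom ≫ (α_ M.X N.X P.X).hom =
      (act g).map (α_ M.X N.X P.X).hom ≫ ((tensorObj M (tensorObj N P)).u g).hom := by
  have n1 : (actMu g M.X N.X).hom ▷ ((act g).obj P.X) ≫ (actMu g (M.X ⊗ N.X) P.X).hom ≫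
        (act g).map (α_ M.X N.X P.X).hom =
      (α_ ((act g).obj M.X) ((act g).obj N.X) ((act g).obj P.X)).hom ≫
        ((act g).obj M.X) ◁ (actMu g N.X P.X).hom ≫ (actMu g M.X (N.X ⊗ P.X)).hom :=
    actMu_assoc g M.X N.X P.X
  change ((actMu g (M.X ⊗ N.X) P.X).inv ≫
      (((actMu g M.X N.X).inv ≫ ((M.u g).hom ⊗ₘ (N.u g).hom)) ⊗ₘ (P.u g).hom)) ≫ _ =
    _ ≫ (actMu g M.X (N.X ⊗ P.X)).inv ≫
      ((M.u g).hom ⊗ₘ ((actMu g N.X P.X).inv ≫ ((N.u g).hom ⊗ₘ (P.u g).hom)))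
  rw [← whiskerRight_comp_tensorHom, ← whiskerLeft_comp_tensorHom]
  simp only [Category.assoc]
  rw [associator_naturality, ← cancel_epi (actMu g (M.X ⊗ N.X) P.X).hom,
    ← cancel_epi ((actMu g M.X N.X).hom ▷ ((act g).obj P.X)), Iso.hom_inv_id_assoc,
    ← comp_whiskerRight_assoc, Iso.hom_inv_id, id_whiskerRight, Category.id_comp,
    reassoc_of% n1, Iso.hom_inv_id_assoc, ← whiskerLeft_comp_assoc, Iso.hom_inv_id, 
    whiskerLeft_id, Category.id_comp]

theorem leftUnitor_comm (M : EqObj D) (g : ℤˣ) :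
    ((tensorObj (unitObj D) M).u g).hom ≫ (λ_ M.X).hom =
      (act g).map (λ_ M.X).hom ≫ (M.u g).hom := by
  have n1 : (λ_ ((act g).obj M.X)).hom = (actEps g).hom ▷ ((act g).obj M.X) ≫
      (actMu g (𝟙_ (TY D)) M.X).hom ≫ (act g).map (λ_ M.X).hom := act_left_unit g M.X
  change ((actMu g (𝟙_ (TY D)) M.X).inv ≫ ((actEps g).inv ⊗ₘ (M.u g).hom)) ≫ _ = _
  rw [← cancel_epi (actMu g (𝟙_ (TY D)) M.X).hom,
    ← cancel_epi ((actEps g).hom ▷ ((act g).obj M.X)), ← reassoc_of% n1, Category.assoc,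
    Iso.hom_inv_id_assoc, whiskerRight_comp_tensorHom_assoc, Iso.hom_inv_id, id_tensorHom,
    leftUnitor_naturality]

theorem rightUnitor_comm (M : EqObj D) (g : ℤˣ) :
    ((tensorObj M (unitObj D)).u g).hom ≫ (ρ_ M.X).hom =
      (act g).map (ρ_ M.X).hom ≫ (M.u g).hom := by
  have n1 : (ρ_ ((act g).obj M.X)).hom = ((act g).obj M.X) ◁ (actEps g).hom ≫
      (actMu g M.X (𝟙_ (TY D))).hom ≫ (act g).map (ρ_ M.X).hom := act_right_unit g M.X
  change ((actMu g M.X (𝟙_ (TY D))).inv ≫ ((M.u g).hom ⊗ₘ (actEps g).inv)) ≫ _ = _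
  rw [← cancel_epi (actMu g M.X (𝟙_ (TY D))).hom,
    ← cancel_epi (((act g).obj M.X) ◁ (actEps g).hom), ← reassoc_of% n1, Category.assoc,
    Iso.hom_inv_id_assoc, whiskerLeft_comp_tensorHom_assoc, Iso.hom_inv_id, tensorHom_id,
    rightUnitor_naturality]

instance : MonoidalCategoryStruct (EqObj D) where
  tensorObj := tensorObj
  tensorUnit := unitObj D
  tensorHom f h := ⟨toHom f ⊗ₘ toHom h, tensorHom_comm f h⟩
  whiskerLeft M _ _ f := ⟨M.X ◁ toHom f, fun g => by
    rw [← id_tensorHom]; exact tensorHom_comm (𝟙 M) f g⟩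
  whiskerRight f N := ⟨toHom f ▷ N.X, fun g => by
    rw [← tensorHom_id]; exact tensorHom_comm f (𝟙 N) g⟩
  associator M N P := mkIso (M := tensorObj (tensorObj M N) P) (N := tensorObj M (tensorObj N P))
    (α_ M.X N.X P.X) (associator_comm M N P)
  leftUnitor M := mkIso (M := tensorObj (unitObj D) M) (λ_ M.X) (leftUnitor_comm M)
  rightUnitor M := mkIso (M := tensorObj M (unitObj D)) (ρ_ M.X) (rightUnitor_comm M)

instance : MonoidalCategory (EqObj D) where
  tensorHom_def f g := hom_ext (MonoidalCategory.tensorHom_def (toHom f) (toHom g))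
  id_tensorHom_id M N := hom_ext (MonoidalCategory.id_tensorHom_id M.X N.X)
  tensorHom_comp_tensorHom f g f' g' := hom_ext
    (MonoidalCategory.tensorHom_comp_tensorHom (toHom f) (toHom g) (toHom f') (toHom g'))
  whiskerLeft_id M N := hom_ext (MonoidalCategory.whiskerLeft_id M.X N.X)
  id_whiskerRight M N := hom_ext (MonoidalCategory.id_whiskerRight M.X N.X)
  associator_naturality f g h := hom_ext
    (MonoidalCategory.associator_naturality (toHom f) (toHom g) (toHom h))
  leftUnitor_naturality f := hom_ext (MonoidalCategory.leftUnitor_naturality (toHom f))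
  rightUnitor_naturality f := hom_ext (MonoidalCategory.rightUnitor_naturality (toHom f))
  pentagon M N P Q := hom_ext (MonoidalCategory.pentagon M.X N.X P.X Q.X)
  triangle M N := hom_ext (MonoidalCategory.triangle M.X N.X)

/-! #### Duality and dimensions -/

end EqObj

/-- Duals of simple objects. -/
def Label.dual : Label C → Label C
  | elt a => elt a⁻¹
  | sigma => sigma

theorem Label.dual_smul (g : ℤˣ) (s : Label C) : (g • s).dual = g • s.dual := by
  cases s <;> simp [Label.dual, inv_zpow]

theorem Label.fuses_dual_left (s : Label C) : Fuses s.dual s (elt 1) := by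
  cases s <;> simp [Label.dual, Fuses]

theorem Label.fuses_dual_right (s : Label C) : Fuses s s.dual (elt 1) := by
  cases s <;> simp [Label.dual, Fuses]

/-- The evaluation of a simple object as a scalar: `1` for `a`, `κ⁻¹` for `σ`. -/
def evCoeff (D : Datum C) : Label C → ℂ
  | elt _ => 1
  | sigma => ((D.κ : ℂ))⁻¹

/-- The pivotal structure on simple objects: `1` for `a`, `sgn κ` for `σ`. -/
def pivCoeff (D : Datum C) : Label C → ℂ
  | elt _ => 1
  | sigma => ((SignType.sign D.κ : ℝ) : ℂ)

namespace TY

/-- The dual object. -/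
def dual (X : TY D) : TY D := ⟨X.ι, fun i => (X.lab i).dual⟩

/-- The evaluation `X* ⊗ X ⟶ 𝟙`. -/
def ev (X : TY D) : dual X ⊗ X ⟶ 𝟙_ (TY D) :=
  ⟨Matrix.of fun (p : TensorIdx (dual X) X) (_ : PUnit) =>
      if p.left = p.right ∧ p.out = elt 1 then evCoeff D (X.lab p.right) else 0,
    fun _ _ h => if_neg fun h' => h h'.2⟩

/-- The coevaluation `𝟙 ⟶ X ⊗ X*`. -/
def coev (X : TY D) : 𝟙_ (TY D) ⟶ X ⊗ dual X :=
  ⟨Matrix.of fun (_ : PUnit) (p : TensorIdx X (dual X)) =>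
      if p.left = p.right ∧ p.out = elt 1 then 1 else 0,
    fun _ _ h => if_neg fun h' => h h'.2.symm⟩

/-- The pivotal structure `X ⟶ X**`. -/
def piv (X : TY D) : X ⟶ dual (dual X) :=
  ⟨Matrix.of fun (i j : X.ι) => if i = j then pivCoeff D (X.lab i) else 0, fun i j h => by
    refine if_neg ?_
    rintro rfl
    refine h ?_
    change X.lab i = (X.lab i).dual.dual
    cases X.lab i <;> simp [Label.dual]⟩

theorem iso_inv_comp_apply {X Y Z : TY D} (e : X.ι ≃ Y.ι) (he : ∀ i, X.lab i = Y.lab (e i))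
    (c : ℂˣ) (f : X ⟶ Z) (j : Y.ι) (k : Z.ι) :
    mat ((isoOfEquiv e he c).inv ≫ f) j k = ((c⁻¹ : ℂˣ) : ℂ) * mat f (e.symm j) k := by
  refine (Finset.sum_eq_single (e.symm j) ?_ ?_).trans ?_
  · intro i _ hi
    refine mul_eq_zero_of_left (if_neg ?_) _
    rintro rfl
    simp at hi
  · exact fun h => absurd (Finset.mem_univ _) h
  · exact congrArg (· * _) (if_pos (e.apply_symm_apply j))

end TY

namespace EqObj

theorem uMat_tensor (M N : EqObj D) (g : ℤˣ) (p r : TensorIdx M.X N.X) :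
    (M ⊗ N).uMat g p r =
      if g • p.out = r.out then M.uMat g p.left r.left * N.uMat g p.right r.right else 0 := by
  refine (iso_inv_comp_apply _ (fun p => (smul_inv_smul g (TensorIdx.out p)).symm) _ _ _ _).trans ?_
  rw [inv_one, Units.val_one, one_mul]
  rfl

theorem uMat_unit (g : ℤˣ) (i j : PUnit) : (𝟙_ (EqObj D)).uMat g i j = 1 := by
  refine (if_pos rfl).trans ?_
  simp

theorem mul_uMat_unit {α : Type u} (f : Matrix α (𝟙_ (EqObj D)).X.ι ℂ) (g : ℤˣ) (p : α)
    (j : PUnit) : (f * (𝟙_ (EqObj D)).uMat g) p j = f p PUnit.unit := by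
  refine (Matrix.mul_apply).trans ?_
  change ∑ k : PUnit, f p k * (𝟙_ (EqObj D)).uMat g k j = _
  simp only [uMat_unit, mul_one]
  exact Finset.sum_singleton _ _

theorem uMat_unit_mul {α : Type u} (f : Matrix (𝟙_ (EqObj D)).X.ι α ℂ) (g : ℤˣ) (p : α)
    (j : PUnit) : ((𝟙_ (EqObj D)).uMat g * f) j p = f PUnit.unit p := by
  refine (Matrix.mul_apply).trans ?_
  change ∑ k : PUnit, (𝟙_ (EqObj D)).uMat g j k * f k p = _
  simp only [uMat_unit, one_mul]
  exact Finset.sum_singleton _ _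

/-- The dual `(X*, (u_g⁻¹)*)`. -/
def dual (M : EqObj D) : EqObj D :=
  ofMat M.X.dual (fun g => (M.uMat g⁻¹).transpose)
    (fun g i j h => M.uMat_homog g⁻¹ fun h' => h (by
      change g • (M.X.lab i).dual = (M.X.lab j).dual
      rw [← Label.dual_smul, ← h', smul_inv_smul]))
    (by
      rw [inv_one, uMat_one]
      exact Matrix.transpose_one)
    (fun g h => by
      refine (Matrix.transpose_mul (M.uMat g⁻¹) (M.uMat h⁻¹)).symm.trans ?_
      rw [uMat_mul, mul_inv, mul_comm])

theorem uMat_mul_apply (M : EqObj D) (g : ℤˣ) (i j : M.X.ι) :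
    ∑ k, M.uMat g i k * M.uMat g⁻¹ k j = if i = j then 1 else 0 := by
  have h := M.uMat_mul g⁻¹ g
  rw [mul_inv_cancel, uMat_one] at h
  exact (congrFun (congrFun h i) j)

theorem label_coeff (M : EqObj D) (g : ℤˣ) (f : Label C → ℂ)
    (hf : ∀ g : ℤˣ, ∀ s, f (g • s) = f s) (i j : M.X.ι) :
    M.uMat g i j * f (M.X.lab j) = M.uMat g i j * f (M.X.lab i) := by
  by_cases h : g • M.X.lab i = M.X.lab j
  · rw [← h, hf]
  · rw [uMat_homog _ _ h, zero_mul, zero_mul]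

theorem evCoeff_smul (g : ℤˣ) (s : Label C) : evCoeff D (g • s) = evCoeff D s := by
  cases s <;> rfl

theorem pivCoeff_smul (g : ℤˣ) (s : Label C) : pivCoeff D (g • s) = pivCoeff D s := by
  cases s <;> rfl

theorem sum_tensorIdx_diag {X Y : TY D} (e : X.ι → Y.ι)
    (he : ∀ i, Fuses (X.lab i) (Y.lab (e i)) (elt 1)) (F : X.ι → Y.ι → Label C → ℂ)
    (hF : ∀ i k w, ¬(e i = k ∧ w = elt 1) → F i k w = 0) :
    ∑ p : TensorIdx X Y, F p.left p.right p.out = ∑ i, F i (e i) (elt 1) := by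
  rw [sum_tensorIdx]
  refine Finset.sum_congr rfl fun i _ => ?_
  rw [Finset.sum_eq_single (e i), Finset.sum_eq_single (elt 1), if_pos (he i)]
  · intro w _ hw
    rw [hF i (e i) w fun h => hw h.2, ite_self]
  · simp
  · intro k _ hk
    exact Finset.sum_eq_zero fun w _ => by rw [hF i k w fun h => hk h.1.symm, ite_self]
  · simp

theorem smul_eq_unit (g : ℤˣ) (s : Label C) : g • s = elt 1 ↔ s = elt 1 := by
  rw [← eq_inv_smul_iff, smul_elt, one_zpow]

theorem ev_aux (M : EqObj D) (g : ℤˣ) (l r i : M.X.ι) (o : Label C) :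
    (if g • o = elt 1 then M.uMat g⁻¹ i l * M.uMat g r i else 0) *
      (if i = i ∧ (elt 1 : Label C) = elt 1 then evCoeff D (M.X.lab i) else 0) =
      (if o = elt 1 then evCoeff D (M.X.lab r) else 0) * (M.uMat g r i * M.uMat g⁻¹ i l) := by
  simp only [and_self, if_true, smul_eq_unit g o]
  split_ifs
  · rw [mul_assoc, label_coeff M g (evCoeff D) evCoeff_smul]
    ring
  · simp

theorem coev_aux (M : EqObj D) (g : ℤˣ) (l r i : M.X.ι) (o : Label C) :
    (if i = i ∧ (elt 1 : Label C) = elt 1 then (1 : ℂ) else 0) *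
      (if g • (elt 1 : Label C) = o then M.uMat g i l * M.uMat g⁻¹ r i else 0) =
      (if o = elt 1 then 1 else 0) * (M.uMat g⁻¹ r i * M.uMat g⁻¹⁻¹ i l) := by
  simp only [and_self, if_true, inv_inv, smul_elt, one_zpow, one_mul, ite_mul, zero_mul]
  exact if_congr eq_comm (mul_comm _ _) rfl

theorem ev_comm (M : EqObj D) (g : ℤˣ) :
    (dual M ⊗ M).uMat g * mat (X := (dual M ⊗ M).X) (Y := (𝟙_ (EqObj D)).X) (ev M.X) =
      mat (X := (dual M ⊗ M).X) (Y := (𝟙_ (EqObj D)).X) (ev M.X) * (𝟙_ (EqObj D)).uMat g := by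
  refine Matrix.ext fun (p : TensorIdx M.X.dual M.X) (j : PUnit) => ?_
  have h1 := sum_tensorIdx_diag (X := M.X.dual) (Y := M.X) (fun i => i)
    (fun i => Label.fuses_dual_left (M.X.lab i)) (fun i k w =>
    (if g • p.out = w then M.uMat g⁻¹ i p.left * M.uMat g p.right k else 0) *
      (if i = k ∧ w = elt 1 then evCoeff D (M.X.lab k) else 0))
    (fun i k w h => mul_eq_zero_of_right _ (if_neg h))
  have h2 : ((dual M ⊗ M).uMat g *
      mat (X := (dual M ⊗ M).X) (Y := (𝟙_ (EqObj D)).X) (ev M.X)) p j = _ :=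
    (Finset.sum_congr rfl fun (r : TensorIdx M.X.dual M.X) _ =>
      congrArg (fun x : ℂ => x * if r.left = r.right ∧ r.out = elt 1 then
        evCoeff D (M.X.lab r.right) else 0) (uMat_tensor (dual M) M g p r)).trans h1
  have h3 : (mat (X := (dual M ⊗ M).X) (Y := (𝟙_ (EqObj D)).X) (ev M.X) *
      (𝟙_ (EqObj D)).uMat g) p j =
      if p.left = p.right ∧ p.out = elt 1 then evCoeff D (M.X.lab p.right) else 0 := by
    exact mul_uMat_unit _ g p j
  rw [h2, h3]
  refine (Finset.sum_congr rfl fun i _ => ev_aux M g p.left p.right i p.out).trans ?_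
  refine (Finset.mul_sum _ _ _).symm.trans ?_
  refine (congrArg (_ * ·) (uMat_mul_apply M g p.right p.left)).trans ?_
  by_cases h : p.left = p.right <;> by_cases ho : p.out = elt 1
  · exact (congrArg₂ (· * ·) (if_pos ho) (if_pos h.symm)).trans
      ((mul_one _).trans (if_pos ⟨h, ho⟩).symm)
  · exact (congrArg (· * _) (if_neg ho)).trans ((zero_mul _).trans (if_neg fun h' => ho h'.2).symm)
  all_goals
    exact (congrArg (_ * ·) (if_neg fun h' => h h'.symm)).trans
      ((mul_zero _).trans (if_neg fun h' => h h'.1).symm)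

theorem coev_comm (M : EqObj D) (g : ℤˣ) :
    (𝟙_ (EqObj D)).uMat g * mat (X := (𝟙_ (EqObj D)).X) (Y := (M ⊗ dual M).X) (coev M.X) =
      mat (X := (𝟙_ (EqObj D)).X) (Y := (M ⊗ dual M).X) (coev M.X) * (M ⊗ dual M).uMat g := by
  refine Matrix.ext fun (j : PUnit) (p : TensorIdx M.X M.X.dual) => ?_
  have h1 := sum_tensorIdx_diag (X := M.X) (Y := M.X.dual) (fun i => i)
    (fun i => Label.fuses_dual_right (M.X.lab i)) (fun i k w =>
    (if i = k ∧ w = elt 1 then (1 : ℂ) else 0) *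
    (if g • w = p.out then M.uMat g i p.left * M.uMat g⁻¹ p.right k else 0))
    (fun i k w h => mul_eq_zero_of_left (if_neg h) _)
  have h2 : (mat (X := (𝟙_ (EqObj D)).X) (Y := (M ⊗ dual M).X) (coev M.X) *
      (M ⊗ dual M).uMat g) j p = _ :=
    (Finset.sum_congr rfl fun (r : TensorIdx M.X M.X.dual) _ =>
      congrArg (fun x : ℂ => (if r.left = r.right ∧ r.out = elt 1 then (1 : ℂ) else 0) * x)
        (uMat_tensor M (dual M) g r p)).trans h1
  have h3 : ((𝟙_ (EqObj D)).uMat g *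
      mat (X := (𝟙_ (EqObj D)).X) (Y := (M ⊗ dual M).X) (coev M.X)) j p =
      if p.left = p.right ∧ p.out = elt 1 then 1 else 0 := by
    exact uMat_unit_mul _ g p j
  rw [h2, h3]
  refine Eq.symm ((Finset.sum_congr rfl fun i _ =>
    coev_aux M g p.left p.right i p.out).trans ?_)
  refine (Finset.mul_sum _ _ _).symm.trans ?_
  refine (congrArg (_ * ·) (uMat_mul_apply M g⁻¹ p.right p.left)).trans ?_
  by_cases h : p.left = p.right <;> by_cases ho : p.out = elt 1
  · exact (congrArg₂ (· * ·) (if_pos ho) (if_pos h.symm)).trans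
      ((mul_one _).trans (if_pos ⟨h, ho⟩).symm)
  · exact (congrArg (· * _) (if_neg ho)).trans ((zero_mul _).trans (if_neg fun h' => ho h'.2).symm)
  all_goals
    exact (congrArg (_ * ·) (if_neg fun h' => h h'.symm)).trans
      ((mul_zero _).trans (if_neg fun h' => h h'.1).symm)

theorem piv_comm (M : EqObj D) (g : ℤˣ) :
    M.uMat g * mat (Y := (dual (dual M)).X) (piv M.X) = mat (Y := (dual (dual M)).X) (piv M.X) * (dual (dual M)).uMat g := by
  refine Matrix.ext fun (i j : M.X.ι) => ?_
  have h : (dual (dual M)).uMat g = M.uMat g := by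
    change (M.uMat g⁻¹⁻¹) = _
    rw [inv_inv]
  have h1 : (M.uMat g * mat (Y := (dual (dual M)).X) (piv M.X)) i j = M.uMat g i j * pivCoeff D (M.X.lab j) := by
    refine (Finset.sum_eq_single j ?_ ?_).trans ?_
    · intro k _ hk
      exact mul_eq_zero_of_right _ (if_neg hk)
    · exact fun h => absurd (Finset.mem_univ _) h
    · exact congrArg (_ * ·) (if_pos rfl)
  have h2 : (mat (Y := (dual (dual M)).X) (piv M.X) * (dual (dual M)).uMat g) i j =
      pivCoeff D (M.X.lab i) * M.uMat g i j := by
    rw [h]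
    refine (Finset.sum_eq_single i ?_ ?_).trans ?_
    · intro k _ hk
      exact mul_eq_zero_of_left (if_neg hk.symm) _
    · exact fun h => absurd (Finset.mem_univ _) h
    · exact congrArg (· * _) (if_pos rfl)
  rw [h1, h2, label_coeff M g (pivCoeff D) pivCoeff_smul, mul_comm]

/-- The dimension `ev_{M*} ∘ (j_M ⊗ id) ∘ coev_M ∈ End(𝟙) = ℂ`, where evaluation, coevaluation and
pivotal structure `j` are those of the underlying objects. -/
def dim (M : EqObj D) : ℂ :=
  let coevM : 𝟙_ (EqObj D) ⟶ M ⊗ dual M := mkHom (coev M.X) (coev_comm M)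
  let pivM : M ⟶ dual (dual M) := mkHom (piv M.X) (piv_comm M)
  let evM : dual (dual M) ⊗ dual M ⟶ 𝟙_ (EqObj D) := mkHom (ev M.X.dual) (ev_comm (dual M))
  mat (toHom (coevM ≫ pivM ▷ dual M ≫ evM)) PUnit.unit PUnit.unit

/-! #### The objects `X_±`, `Y_a`, `Z_±` -/

/-- The character of `ℤ/2` with value `s` at `-1`. -/
def signChar (s g : ℤˣ) : ℂˣ := if g = 1 then 1 else Units.map (Int.castRingHom ℂ).toMonoidHom s

theorem signChar_mul (s g h : ℤˣ) : signChar s h * signChar s g = signChar s (h * g) := by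
  rcases Int.units_eq_one_or s with rfl | rfl <;> rcases Int.units_eq_one_or g with rfl | rfl <;>
    rcases Int.units_eq_one_or h with rfl | rfl <;> simp [signChar]

theorem single_comm (t : Label C) (s : ℤˣ) (ht : ∀ g : ℤˣ, g • t = t) (g h : ℤˣ) :
    (act g).map (isoOfEquiv (X := (act h).obj (single D t)) (Y := single D t) (Equiv.refl PUnit)
        (fun _ => ht h) (signChar s h)).hom ≫
      (isoOfEquiv (X := (act g).obj (single D t)) (Y := single D t) (Equiv.refl PUnit)
        (fun _ => ht g) (signChar s g)).hom =
    (actComp g h (single D t)).hom ≫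
      (isoOfEquiv (X := (act (h * g)).obj (single D t)) (Y := single D t) (Equiv.refl PUnit)
        (fun _ => ht (h * g)) (signChar s (h * g))).hom := by
  refine TY.hom_ext (Matrix.ext fun (i : PUnit) (j : PUnit) => ?_)
  refine (comp_iso_apply _ _ _ _ _ _).trans (Eq.trans ?_ (iso_comp_apply _ _ _ _ _ _).symm)
  refine (congrArg (· * _) (if_pos rfl)).trans
    (Eq.trans ?_ (congrArg (_ * ·) (if_pos rfl)).symm)
  rw [Units.val_one, one_mul, ← Units.val_mul, signChar_mul]

/-- `X_± = (e, u_{-1} = ± id)`. -/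
def Xobj (D : Datum C) (s : ℤˣ) : EqObj D where
  X := single D (elt 1)
  u g := isoOfEquiv (Equiv.refl PUnit) (fun _ => congrArg elt (one_zpow (g : ℤ))) (signChar s g)
  comm := single_comm (elt 1) s fun g => congrArg elt (one_zpow (g : ℤ))

/-- `Z_± = (σ, u_{-1} = ± id)`. -/
def Zobj (D : Datum C) (s : ℤˣ) : EqObj D where
  X := single D sigma
  u g := isoOfEquiv (Equiv.refl PUnit) (fun _ => rfl) (signChar s g)
  comm := single_comm sigma s fun _ => rfl

/-- `Y_a = (a ⊕ a⁻¹, id)`. The summands are indexed by `t = ±1`, the summand `t` being `a ^ t`. The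
identity `ρ_{-1}(a ⊕ a⁻¹) = a⁻¹ ⊕ a ⟶ a ⊕ a⁻¹` sends the summand `t` to the summand `-t`. -/
def Yobj (D : Datum C) (a : C) : EqObj D where
  X := ⟨ULift.{u} ℤˣ, fun t => elt (a ^ (t.down : ℤ))⟩
  u g := isoOfEquiv ((Equiv.ulift.trans (Equiv.mulRight g)).trans Equiv.ulift.symm) fun t => by
    change elt ((a ^ (t.down : ℤ)) ^ (g : ℤ)) = elt (a ^ ((t.down * g : ℤˣ) : ℤ))
    rw [← zpow_mul, Units.val_mul]
  comm g h := by
    refine TY.hom_ext (Matrix.ext fun (i : ULift.{u} ℤˣ) (j : ULift.{u} ℤˣ) => ?_)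
    refine (comp_iso_apply _ _ _ _ _ _).trans (Eq.trans ?_ (iso_comp_apply _ _ _ _ _ _).symm)
    have : (⟨i.down * h⟩ : ULift.{u} ℤˣ) = ⟨j.down * g⁻¹⟩ ↔
        (⟨i.down * (h * g)⟩ : ULift.{u} ℤˣ) = j := by
      rw [ULift.ext_iff, ULift.ext_iff, eq_mul_inv_iff_mul_eq, mul_assoc]
    by_cases hc : (⟨i.down * (h * g)⟩ : ULift.{u} ℤˣ) = j
    · refine (congrArg (· * _) (if_pos (this.2 hc))).trans
        (Eq.trans ?_ (congrArg (_ * ·) (if_pos hc)).symm)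
      rfl
    · refine (congrArg (· * _) (if_neg fun h' => hc (this.1 h'))).trans
        (Eq.trans ?_ (congrArg (_ * ·) (if_neg hc)).symm)
      rw [zero_mul, mul_zero]

instance : HasBinaryBiproducts (EqObj D) := hasBinaryBiproducts_of_finite_biproducts _

/-- The entries `Y_c` of the fusion table, with the convention `Y_e = X_+ ⊕ X_-`. -/
def Ytable (D : Datum C) (c : C) : EqObj D :=
  if c = 1 then Xobj D 1 ⊞ Xobj D (-1) else Yobj D c

end EqObj

/-- The orbits of the action `a ↦ a⁻¹` on `C ∖ {e}`. -/
def orbitSetoid (C : Type u) [CommGroup C] : Setoid {a : C // a ≠ 1} where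
  r a b := b.1 = a.1 ∨ b.1 = a.1⁻¹
  iseqv :=
    { refl := fun _ => Or.inl rfl
      symm := by
        rintro a b (h | h)
        · exact Or.inl h.symm
        · exact Or.inr (by rw [h, inv_inv])
      trans := by
        rintro a b c (h | h) (h' | h')
        · exact Or.inl (h'.trans h)
        · exact Or.inr (by rw [h', h])
        · exact Or.inr (h'.trans h)
        · exact Or.inl (by rw [h', h, inv_inv]) }

/-- The set of orbits on `C ∖ {e}`. -/
abbrev YOrbit (C : Type u) [CommGroup C] : Type u := Quotient (orbitSetoid C)

instance : Finite (YOrbit C) := Quotient.finite _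

namespace EqObj

/-- `⨁ Y_x`, where every orbit of `C ∖ {e}` occurs exactly once. -/
def Ysum (D : Datum C) : EqObj D := ⨁ fun o : YOrbit C => Yobj D o.out.1

end EqObj

/-! ### The braiding -/

/-- The value `q(x)` on the label `x ∈ C`, and `0` on `σ` (which is not a summand of `σ ⊗ σ`). -/
def qLabel (D : Datum C) : Label C → ℂ
  | elt x => D.q x
  | sigma => 0

/-- The components of the crossed braiding on simple objects `s, t`: the scalar on the summand `w`
of `s ⊗ t`. -/
def braidCoeff (D : Datum C) : (s t w : Label C) → ℂ
  | elt a, elt b, _ => D.χ a b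
  | elt a, sigma, _ => ((D.q a)⁻¹ : ℂˣ)
  | sigma, elt a, _ => ((D.q a)⁻¹ : ℂˣ)
  | sigma, sigma, elt x => D.δ * D.q x
  | sigma, sigma, sigma => 0

namespace TY

/-- The crossed braiding `c_{X,Y_h} : X ⊗ Y_h ⟶ Y_h ⊗ ρ_h(X)`, where `Y_h` is the degree `h` part
of `Y`, as a morphism `X ⊗ Y ⟶ Y ⊗ ρ_h(X)` which is zero on the other summands of `Y`. -/
def crossBraid (h : ℤˣ) (X Y : TY D) : X ⊗ Y ⟶ Y ⊗ (act h).obj X :=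
  ⟨Matrix.of fun (p : TensorIdx X Y) (r : TensorIdx Y ((act h).obj X)) =>
      if (Y.lab p.right).deg = h ∧ r.left = p.right ∧ r.right = p.left ∧ p.out = r.out then
        braidCoeff D (X.lab p.left) (Y.lab p.right) p.out
      else 0,
    fun _ _ h => if_neg fun h' => h h'.2.2.2⟩

/-- The morphism `X ⊗ Y ⟶ Y ⊗ X` which sends the summand `w` of `X_i ⊗ Y_k` to the summand `w` of
`Y_k ⊗ X_{e(i)}` with the scalar `c i k w` (and is zero if there is no such summand). -/
def swapHom (X Y : TY D) (e : X.ι → X.ι) (c : X.ι → Y.ι → Label C → ℂ) : X ⊗ Y ⟶ Y ⊗ X :=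
  ⟨Matrix.of fun (p : TensorIdx X Y) (r : TensorIdx Y X) =>
      if r.left = p.right ∧ r.right = e p.left ∧ p.out = r.out then c p.left p.right p.out else 0,
    fun _ _ h => if_neg fun h' => h h'.2.2⟩

end TY

namespace EqObj

/-- The underlying morphism `⨁_h (id_{Y_h} ⊗ u_h) ∘ c_{X,Y}` of the braiding. -/
def braid (M N : EqObj D) : M.X ⊗ N.X ⟶ N.X ⊗ M.X :=
  ∑ h : ℤˣ, crossBraid h M.X N.X ≫ N.X ◁ (M.u h).hom

end EqObj

end TambaraYamagami

end

open TambaraYamagami TambaraYamagami.TY TambaraYamagami.EqObj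

noncomputable section

namespace TambaraYamagami

open scoped Classical

open Label

variable {C : Type u} [CommGroup C] [Fintype C]

/-! ### Quadratic forms and the Gauss sum -/

namespace Datum

variable (D : Datum C)

/-! An equivariant object is a finite family of labels together with matrices `u_g`, so every
assertion becomes an identity between matrix entries. The argument has three strands.

Braiding. An entry of `braid` is a scalar depending only on labels times an entry of `u_h`, where
`h` is the degree of the right-hand label (`braid_apply`). Non-zero entries of `u_h` join a label
`s` only to `h • s`, and the matrices compose by the rule `uMat_mul`. Hence invertibility,
equivariance, naturality and both hexagons split into a matrix part, which follows from the
representation property of `u`, and a scalar part. The scalar part consists of the hexagons of a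
`ℤ/2`-crossed braiding, `coeff_hexagon_forward` and `coeff_hexagon_reverse`. Unless all three labels
are `σ`, these follow from q(ab) = χ(a,b)q(a)q(b) and χ(a,a) = q(a)². For three copies of `σ` a sum
over the group appears. It is a Gauss sum twisted by a character, and completing the square gives
its value δ²q(w) up to κ (`gauss`); this is what the condition on δ is for. The product of the Gauss
sums of q and of its inverse is n, so δ ≠ 0 and the braiding is invertible.

Simple objects. Averaging an elementary matrix over `ℤ/2` gives a morphism, and the trace of its
product with `f` is twice an entry of `f` (`trace_mul_linkHom`). So an object with scalar
endomorphisms splits off any object to or from which it has a non-zero morphism: this is Maschke's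
theorem and Schur's lemma in one. It yields the simplicity of the listed objects and identifies a
simple object from any one of its labels. A label fixed by inversion (`e` or `σ`) carries one of the
two characters of `ℤ/2`. A label a ≠ e satisfies a ≠ a⁻¹ because n is odd, and its orbit carries the
single object `Yobj D a`.

Fusion rules. On all the tensor products involved the action permutes the summands up to scalars
(`Monomial`), so a decomposition is a matching of summands (`Monomial.nonempty_iso`). A sign on a
free orbit is removed by rescaling its summands by a character. Two copies of a fixed label
exchanged by the action form the regular representation, which splits into its two eigenlines.
Finally, inversion fixes only `e` among the summands of σ ⊗ σ, which gives one `X` and one `Y` for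
every other orbit. -/

theorem q_one : D.q 1 = 1 := by
  have h := D.q_mul 1 1
  rw [map_one, mul_one, eq_div_iff_mul_eq', one_mul] at h
  exact mul_eq_left.1 h

theorem q_mul_eq (a b : C) : D.q (a * b) = D.χ a b * (D.q a * D.q b) := by
  rw [D.q_mul, div_mul_cancel]

/-- Expand q(a a⁻¹) = 1 and use that q is even. -/
theorem χ_self (a : C) : D.χ a a = D.q a ^ 2 := by
  have h := D.q_mul_eq a a⁻¹
  rw [mul_inv_cancel, q_one, D.q_inv, map_inv, ← pow_two] at h
  exact (inv_mul_eq_one.1 h.symm)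

theorem q_zpow (a : C) (g : ℤˣ) : D.q (a ^ (g : ℤ)) = D.q a := by
  rcases Int.units_eq_one_or g with rfl | rfl <;> simp [D.q_inv]

/-- The Gauss sum twisted by a character. -/
theorem sum_χ_mul_q_inv (w : C) :
    ∑ z, (D.χ w z : ℂ) * ((D.q z)⁻¹ : ℂˣ) = D.q w * ∑ z, (D.q z : ℂ)⁻¹ := by
  -- Completing the square: χ(w,z)/q(z) = q(w)/q(w/z), so the substitution z ↦ w/z removes the
  -- character.
  rw [Finset.mul_sum, ← Equiv.sum_comp (Equiv.divLeft w)]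
  refine Finset.sum_congr rfl fun z _ => ?_
  have h : D.χ w (w / z) * (D.q (w / z))⁻¹ = D.q w * (D.q z)⁻¹ := by
    rw [div_eq_mul_inv, D.q_mul_eq, map_mul, map_inv, D.q_inv, χ_self, mul_inv, mul_inv]
    generalize D.q w = x
    generalize (D.χ w) z = y
    refine Units.ext ?_
    push_cast
    field_simp
  rw [Equiv.divLeft_apply, ← Units.val_mul, h]
  simp

theorem κ_mul_self_ne_zero : (D.κ : ℂ) * D.κ ≠ 0 := by
  have h := char_sum D 1
  rw [if_pos rfl] at h
  exact left_ne_zero_of_mul (h ▸ one_ne_zero)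

theorem κ_ne_zero : (D.κ : ℂ) ≠ 0 := left_ne_zero_of_mul D.κ_mul_self_ne_zero

/-- Each product of the first sum with q(z) is a twisted Gauss sum. Summing over z first,
orthogonality of characters leaves only the term w = 1. No absolute value of q enters. -/
theorem sum_q_inv_mul_sum_q : (∑ w, (D.q w : ℂ)⁻¹) * ∑ z, (D.q z : ℂ) = Fintype.card C := by
  have h : ∀ z : C, (∑ w, (D.q w : ℂ)⁻¹) * (D.q z : ℂ) = ∑ w, (D.χ z w : ℂ) * ((D.q w)⁻¹ : ℂˣ) :=
    fun z => by rw [sum_χ_mul_q_inv, mul_comm]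
  rw [Finset.mul_sum]
  simp_rw [h]
  rw [Finset.sum_comm]
  have h2 : ∀ w : C, ∑ z, (D.χ z w : ℂ) * ((D.q w)⁻¹ : ℂˣ) =
      if w = 1 then (Fintype.card C : ℂ) else 0 := fun w => by
    have h3 := char_sum D w
    simp_rw [D.χ_symm _ w]
    rw [← Finset.sum_mul]
    split_ifs with hw
    · subst hw
      simp [q_one]
    · rw [if_neg hw] at h3
      rw [(mul_eq_zero.1 h3).resolve_left D.κ_mul_self_ne_zero, zero_mul]
  simp_rw [h2]
  simp

/-- If δ vanished, so would the Gauss sum, contradicting the product formula. This makes c_{σ,σ}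
invertible. -/
theorem δ_ne_zero : D.δ ≠ 0 := by
  intro h
  have h1 := D.δ_sq
  rw [h, zero_pow two_ne_zero, eq_comm, mul_eq_zero, or_iff_right D.κ_ne_zero] at h1
  have h2 := D.sum_q_inv_mul_sum_q
  rw [h1, zero_mul, eq_comm, Nat.cast_eq_zero] at h2
  exact Fintype.card_ne_zero h2

/-- The only analytic input of the hexagons; it is used precisely when all three labels are `σ`. -/
theorem gauss (w : C) :
    (D.κ : ℂ) * ∑ z, (D.χ w z : ℂ) * ((D.q z)⁻¹ : ℂˣ) = D.δ ^ 2 * D.q w := by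
  rw [sum_χ_mul_q_inv, D.δ_sq]
  ring

end Datum

/-! ### The hexagon equations for the scalars -/

/-- The combinatorial shadow of the crossed braiding: passing `t` acts on `s` by the degree of `t`,
and the possible outputs do not change. -/
theorem fuses_braid {s t w : Label C} : Fuses t (t.deg • s) w ↔ Fuses s t w := by
  cases s <;> cases t <;> cases w <;> simp [Fuses, Label.deg, mul_comm]

@[simp] theorem Label.deg_smul (g : ℤˣ) (s : Label C) : (g • s).deg = s.deg := by
  cases s <;> rfl

theorem Fuses.deg {s t w : Label C} (h : Fuses s t w) : w.deg = s.deg * t.deg := by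
  cases s <;> cases t <;> cases w <;> simp_all [Fuses, Label.deg]

/-- Inverting both arguments does not change χ, and q is even. This is the scalar part of the
equivariance of the braiding. -/
theorem braidCoeff_smul (D : Datum C) (g : ℤˣ) (s t w : Label C) :
    braidCoeff D (g • s) (g • t) (g • w) = braidCoeff D s t w := by
  rcases Int.units_eq_one_or g with rfl | rfl
  · simp only [one_smul]
  · cases s <;> cases t <;> cases w <;> simp [braidCoeff, D.q_inv]

theorem braidCoeff_ne_zero (D : Datum C) {s t w : Label C} (h : Fuses s t w) :
    braidCoeff D s t w ≠ 0 := by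
  cases s <;> cases t <;> cases w <;> simp_all [braidCoeff, Fuses, D.δ_ne_zero]

/-- The hexagon for moving `s` past `t` and then `r`, with `s` twisted by each degree on the way.
Unless all three labels are `σ`, only one intermediate label `x` is admissible and the identity is a
rule for q and χ. -/
theorem coeff_hexagon_forward (D : Datum C) {s t r d u v : Label C} (h1 : Fuses s t u)
    (h2 : Fuses u r d) (h3 : Fuses r (r.deg • t.deg • s) v) (h4 : Fuses t v d) :
    (∑ x, if Fuses t r x ∧ Fuses s x d then
      assocInvCoeff D s t r d u x * braidCoeff D s x d *
        assocInvCoeff D t r (r.deg • t.deg • s) d x v else 0) =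
    braidCoeff D s t u * assocInvCoeff D t (t.deg • s) r d u v *
      braidCoeff D (t.deg • s) r v := by
  rw [sum_label]
  rcases s with s | _ <;> rcases t with t | _ <;> rcases r with r | _ <;>
    rcases d with d | _ <;> rcases u with u | _ <;> rcases v with v | _ <;>
    simp only [Fuses, Label.deg, smul_elt, smul_sigma] at h1 h2 h3 h4 <;>
    simp [Fuses, assocInvCoeff, braidCoeff, Label.deg]
  · subst h1 h2
    have h7 : ∀ x, (t * r = x ∧ s * x = s * t * r) ↔ x = t * r := fun x =>
      ⟨fun h => h.1.symm, by rintro rfl; exact ⟨rfl, (mul_assoc _ _ _).symm⟩⟩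
    simp [h7]
  · rw [D.χ_symm t, mul_comm]
  · exact mul_comm _ _
  · simp only [← eq_inv_mul_iff_mul_eq]
    simp [D.χ_self, D.q_inv]
    field_simp
  · rw [D.q_mul_eq]
    push_cast
    field_simp
  · subst h4
    simp only [D.q_mul_eq, map_mul, D.χ_self]
    push_cast
    field_simp
  · subst h2
    simp only [D.q_mul_eq, map_mul, D.χ_self, D.χ_symm u r]
    push_cast
    field_simp
  -- Three copies of `σ`: the sum over `x` is the Gauss sum twisted by uv, and δ²q(uv) factors into
  -- δq(u), δq(v) and the entry χ(u,v) of the middle associator.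
  · have h := D.gauss (u * v)
    rw [D.q_mul_eq, Finset.mul_sum] at h
    calc _ = D.κ * ∑ x, (D.κ : ℂ) * ((D.χ (u * v) x : ℂ) * ((D.q x)⁻¹ : ℂˣ)) := by
          rw [Finset.mul_sum]
          refine Finset.sum_congr rfl fun x _ => ?_
          rw [D.χ_symm x v]
          simp
          ring
      _ = _ := by
          rw [h]
          push_cast
          ring

/-- Now the product of `s` and `t` moves past `r`, so the intermediate label `w` is itself twisted
and reappears as `r.deg • w` in the last associator. -/
theorem coeff_hexagon_reverse (D : Datum C) {s t r d v w' : Label C} (h1 : Fuses t r v)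
    (h2 : Fuses s v d) (h3 : Fuses r (r.deg • s) w') (h4 : Fuses w' (r.deg • t) d) :
    (∑ w, if Fuses s t w ∧ Fuses w r d then
      assocCoeff D s t r d v w * braidCoeff D w r d *
        assocCoeff D r (r.deg • s) (r.deg • t) d (r.deg • w) w' else 0) =
    braidCoeff D t r v * assocCoeff D s r (r.deg • t) d v w' * braidCoeff D s r w' := by
  rw [sum_label]
  rcases s with s | _ <;> rcases t with t | _ <;> rcases r with r | _ <;>
    rcases d with d | _ <;> rcases v with v | _ <;> rcases w' with w' | _ <;>
    simp only [Fuses, Label.deg, smul_elt, smul_sigma] at h1 h2 h3 h4 <;>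
    simp [Fuses, assocCoeff, braidCoeff, Label.deg]
  · subst h1 h2
    have h7 : ∀ x, (s * t = x ∧ x * r = s * (t * r)) ↔ x = s * t := fun x =>
      ⟨fun h => h.1.symm, by rintro rfl; exact ⟨rfl, mul_assoc _ _ _⟩⟩
    simp only [h7, Finset.sum_ite_eq', Finset.mem_univ, if_true, map_mul, MonoidHom.mul_apply,
      Units.val_mul]
    exact mul_comm _ _
  · rw [D.q_mul_eq]
    push_cast
    field_simp
  · exact mul_comm _ _
  · subst h2
    simp only [D.q_mul_eq, map_mul, D.χ_self]
    push_cast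
    field_simp
  · rw [D.χ_symm t, mul_comm]
  · obtain rfl : w' = t * d := by rw [← h4]; simp
    rw [D.q_mul_eq]
    push_cast
    field_simp
  · simp only [← eq_mul_inv_iff_mul_eq]
    simp [D.χ_self, D.χ_symm d r]
    field_simp
  -- The twist turns x into x⁻¹ in the last associator, so the two characters combine to that of
  -- v⁻¹w'.
  · have h := D.gauss (v⁻¹ * w')
    rw [D.q_mul_eq, Finset.mul_sum] at h
    calc _ = D.κ * ∑ x, (D.κ : ℂ) * ((D.χ (v⁻¹ * w') x : ℂ) * ((D.q x)⁻¹ : ℂˣ)) := by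
          rw [Finset.mul_sum]
          refine Finset.sum_congr rfl fun x _ => ?_
          rw [D.χ_symm x w']
          simp
          ring
      _ = _ := by
          rw [h, D.q_inv]
          simp
          ring

variable {D : Datum C}

/-! ### Matrix entries of compositions -/

namespace TY

/-- Summands with prescribed left index and output are parametrised by the right indices that
satisfy a fusion condition. If `F` vanishes elsewhere the condition can be dropped, which leaves an
ordinary sum as in a matrix product. -/
theorem sum_fix_left {X Y : TY D} (k : X.ι) (w : Label C) (F : Y.ι → ℂ)
    (hF : ∀ i, ¬Fuses (X.lab k) (Y.lab i) w → F i = 0) :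
    ∑ q : TensorIdx X Y, (if q.left = k ∧ q.out = w then F q.right else 0) = ∑ i, F i := by
  rw [sum_tensorIdx fun i j v => if i = k ∧ v = w then F j else 0, Finset.sum_eq_single k]
  · refine Finset.sum_congr rfl fun i _ => ?_
    rw [Finset.sum_eq_single w]
    · by_cases h : Fuses (X.lab k) (Y.lab i) w
      · simp [h]
      · simp [h, hF]
    · intro v _ hv
      simp [hv]
    · simp
  · intro j _ hj
    simp [hj]
  · simp

theorem sum_fix_right {X Y : TY D} (k : Y.ι) (w : Label C) (F : X.ι → ℂ)
    (hF : ∀ i, ¬Fuses (X.lab i) (Y.lab k) w → F i = 0) :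
    ∑ q : TensorIdx X Y, (if q.right = k ∧ q.out = w then F q.left else 0) = ∑ i, F i := by
  rw [sum_tensorIdx fun i j v => if j = k ∧ v = w then F i else 0]
  refine Finset.sum_congr rfl fun i _ => ?_
  rw [Finset.sum_eq_single k]
  · rw [Finset.sum_eq_single w]
    · by_cases h : Fuses (X.lab i) (Y.lab k) w
      · simp [h]
      · simp [h, hF]
    · intro v _ hv
      simp [hv]
    · simp
  · intro j _ hj
    simp [hj]
  · simp

end TY

/-! ### Entries, inverse and equivariance of the braiding -/

namespace EqObj

theorem uMat_lab {M : EqObj D} {g : ℤˣ} {i j : M.X.ι} (h : M.uMat g i j ≠ 0) :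
    g • M.X.lab i = M.X.lab j := by
  by_contra h'
  exact h (M.uMat_homog g h')

theorem uMat_mul_sum (M : EqObj D) (g h : ℤˣ) (i j : M.X.ι) :
    ∑ k, M.uMat h i k * M.uMat g k j = M.uMat (h * g) i j :=
  congrFun (congrFun (M.uMat_mul g h) i) j

/-- Only the term with `h` equal to the degree of the right-hand label survives, and in it only the
intermediate summand obtained by exchanging the two indices. That summand is admissible by
`fuses_braid`. -/
theorem braid_apply (M N : EqObj D) (p : TensorIdx M.X N.X) (r : TensorIdx N.X M.X) :
    mat (braid M N) p r = if r.left = p.right ∧ r.out = p.out then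
      braidCoeff D (M.X.lab p.left) (N.X.lab p.right) p.out *
        M.uMat (N.X.lab p.right).deg p.left r.right else 0 := by
  have h1 : ∀ h : ℤˣ, mat (crossBraid h M.X N.X ≫ N.X ◁ (M.u h).hom) p r =
      if (N.X.lab p.right).deg = h ∧ r.left = p.right ∧ r.out = p.out then
        braidCoeff D (M.X.lab p.left) (N.X.lab p.right) p.out * M.uMat h p.left r.right
      else 0 := by
    intro h
    have S := sum_fix_left (X := N.X) (Y := (act h).obj M.X) p.right p.out (fun i : M.X.ι =>
      if (N.X.lab p.right).deg = h ∧ i = p.left ∧ r.left = p.right ∧ r.out = p.out then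
        braidCoeff D (M.X.lab p.left) (N.X.lab p.right) p.out * M.uMat h i r.right else 0)
      (by
        intro i hi
        refine if_neg ?_
        rintro ⟨rfl, rfl, -⟩
        exact hi (fuses_braid.2 p.fuses))
    refine ((Finset.sum_congr rfl ?_).trans S).trans ?_
    · clear S
      rintro ⟨k, (i : M.X.ι), w, hf⟩ -
      change (if (N.X.lab p.right).deg = h ∧ k = p.right ∧ i = p.left ∧ p.out = w then _ else 0) *
        (if w = r.out then (if k = r.left then 1 else 0) * M.uMat h i r.right else 0) =
        if k = p.right ∧ w = p.out then
          (if (N.X.lab p.right).deg = h ∧ i = p.left ∧ r.left = p.right ∧ r.out = p.out then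
            braidCoeff D (M.X.lab p.left) (N.X.lab p.right) p.out * M.uMat h i r.right else 0)
        else 0
      by_cases hk : k = p.right ∧ w = p.out
      · obtain ⟨rfl, rfl⟩ := hk
        simp only [and_self, if_true, true_and, and_true, eq_comm (a := r.left),
          eq_comm (a := r.out)]
        by_cases h1 : (N.X.lab p.right).deg = h ∧ i = p.left
        · simp only [h1, true_and]
          by_cases h2 : p.out = r.out <;> by_cases h3 : p.right = r.left <;> simp [h2, h3]
        · rw [if_neg h1, zero_mul]
          exact (if_neg fun h => h1 ⟨h.1, h.2.1⟩).symm
      · rw [if_neg (c := _ ∧ _), if_neg (c := _ ∧ _), zero_mul]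
        · exact hk
        · exact fun h => hk ⟨h.2.1, h.2.2.2.symm⟩
    · change ∑ i : M.X.ι, _ = _
      rw [Finset.sum_eq_single p.left]
      · simp only [true_and]
      · intro i _ hi
        exact if_neg fun h => hi h.2.1
      · exact fun h => absurd (Finset.mem_univ _) h
  have h2 : mat (braid M N) p r = ∑ h : ℤˣ, mat (crossBraid h M.X N.X ≫ N.X ◁ (M.u h).hom) p r := by
    simp only [braid, UnitsInt.univ]
    rfl
  rw [h2]
  simp_rw [h1]
  rw [Finset.sum_eq_single (N.X.lab p.right).deg]
  · simp only [true_and]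
  · intro g _ hg
    exact if_neg fun h => hg h.1.symm
  · exact fun h => absurd (Finset.mem_univ _) h

/-- The inverse of the braiding. -/
def braidInv (M N : EqObj D) : N.X ⊗ M.X ⟶ M.X ⊗ N.X :=
  ⟨Matrix.of fun (r : TensorIdx N.X M.X) (p : TensorIdx M.X N.X) =>
      if r.left = p.right ∧ r.out = p.out then
        (braidCoeff D (M.X.lab p.left) (N.X.lab p.right) p.out)⁻¹ *
          M.uMat (N.X.lab p.right).deg⁻¹ r.right p.left
      else 0,
    fun _ _ h => if_neg fun h' => h h'.2⟩

theorem braidInv_apply (M N : EqObj D) (r : TensorIdx N.X M.X) (p : TensorIdx M.X N.X) :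
    mat (braidInv M N) r p = if r.left = p.right ∧ r.out = p.out then
        (braidCoeff D (M.X.lab p.left) (N.X.lab p.right) p.out)⁻¹ *
          M.uMat (N.X.lab p.right).deg⁻¹ r.right p.left
      else 0 := rfl

/-- A non-zero entry forces the label of `j` to be the twisted label of `i`. In the matrix
computations below this shows that indices with inadmissible fusion contribute zero. -/
theorem fuses_of_uMat {M : EqObj D} {i j : M.X.ι} {t w : Label C} (hM : M.uMat t.deg i j ≠ 0) :
    Fuses t (M.X.lab j) w ↔ Fuses (M.X.lab i) t w := by
  rw [← uMat_lab hM, fuses_braid]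

theorem fuses_of_uMat_inv {M : EqObj D} {i j : M.X.ι} {t w : Label C}
    (hM : M.uMat t.deg⁻¹ j i ≠ 0) : Fuses t (M.X.lab j) w ↔ Fuses (M.X.lab i) t w := by
  rw [← uMat_lab hM, ← fuses_braid (s := t.deg⁻¹ • M.X.lab j), smul_inv_smul]

/-- The scalars cancel, and the remaining sum over the index in `M` is an entry of the product of
`u_h` with its inverse. -/
theorem braid_hom_inv (M N : EqObj D) : braid M N ≫ braidInv M N = 𝟙 _ := by
  refine TY.hom_ext (Matrix.ext fun (p : TensorIdx M.X N.X) (p' : TensorIdx M.X N.X) => ?_)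
  have S := sum_fix_left (X := N.X) (Y := M.X) p.right p.out (fun i =>
    if p.right = p'.right ∧ p.out = p'.out then
      braidCoeff D (M.X.lab p.left) (N.X.lab p.right) p.out *
        (braidCoeff D (M.X.lab p'.left) (N.X.lab p.right) p.out)⁻¹ *
        (M.uMat (N.X.lab p.right).deg p.left i * M.uMat (N.X.lab p.right).deg⁻¹ i p'.left)
      else 0) (by
        intro i hi
        have : M.uMat (N.X.lab p.right).deg p.left i = 0 := by
          by_contra h
          exact hi ((fuses_of_uMat h).2 p.fuses)
        simp [this])
  refine (Finset.sum_congr rfl fun r _ => ?_).trans (S.trans ?_)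
  · refine (congrArg₂ (· * ·) (braid_apply _ _ _ _) (braidInv_apply _ _ _ _)).trans ?_
    by_cases hr : r.left = p.right ∧ r.out = p.out
    · rw [if_pos hr, if_pos hr, hr.1, hr.2]
      by_cases hp : p.right = p'.right ∧ p.out = p'.out
      · rw [if_pos hp, if_pos hp, ← hp.1, ← hp.2]
        ring
      · rw [if_neg hp, if_neg hp, mul_zero]
    · rw [if_neg hr, if_neg hr, zero_mul]
  · refine Eq.trans ?_ (mat_id_apply (M.X ⊗ N.X) p p').symm
    have e : p = p' ↔ (p.right = p'.right ∧ p.out = p'.out) ∧ p.left = p'.left := by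
      rw [TensorIdx.ext_iff]; tauto
    by_cases hp : p.right = p'.right ∧ p.out = p'.out
    · simp only [if_pos hp]
      rw [← Finset.mul_sum, uMat_mul_apply]
      by_cases hl : p.left = p'.left
      · rw [if_pos hl, ← hl, mul_one, mul_inv_cancel₀ (braidCoeff_ne_zero D p.fuses)]
        exact (if_pos (e.2 ⟨hp, hl⟩)).symm
      · rw [if_neg hl, mul_zero]
        exact (if_neg fun h => hl (e.1 h).2).symm
    · simp only [if_neg hp, Finset.sum_const_zero]
      exact (if_neg fun h => hp (e.1 h).1).symm

theorem braid_inv_hom (M N : EqObj D) : braidInv M N ≫ braid M N = 𝟙 _ := by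
  refine TY.hom_ext (Matrix.ext fun (r : TensorIdx N.X M.X) (r' : TensorIdx N.X M.X) => ?_)
  have S := sum_fix_right (X := M.X) (Y := N.X) r.left r.out (fun i =>
    if r.left = r'.left ∧ r.out = r'.out then
        (M.uMat (N.X.lab r.left).deg⁻¹ r.right i * M.uMat (N.X.lab r.left).deg i r'.right)
      else 0) (by
        intro i hi
        have : M.uMat (N.X.lab r.left).deg⁻¹ r.right i = 0 := by
          by_contra h
          exact hi ((fuses_of_uMat_inv h).1 r.fuses)
        rw [this, zero_mul, ite_self])
  refine (Finset.sum_congr rfl fun p _ => ?_).trans (S.trans ?_)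
  · refine (congrArg₂ (· * ·) (braidInv_apply _ _ _ _) (braid_apply _ _ _ _)).trans ?_
    by_cases hr : p.right = r.left ∧ p.out = r.out
    · have h0 := braidCoeff_ne_zero D p.fuses
      rw [if_pos hr, if_pos ⟨hr.1.symm, hr.2.symm⟩]
      rw [hr.1, hr.2] at h0 ⊢
      by_cases hp : r.left = r'.left ∧ r.out = r'.out
      · rw [if_pos hp, if_pos ⟨hp.1.symm, hp.2.symm⟩]
        field_simp
      · rw [if_neg hp, if_neg fun h => hp ⟨h.1.symm, h.2.symm⟩, mul_zero]
    · rw [if_neg hr, if_neg fun h => hr ⟨h.1.symm, h.2.symm⟩, zero_mul]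
  · refine Eq.trans ?_ (mat_id_apply (N.X ⊗ M.X) r r').symm
    have e : r = r' ↔ (r.left = r'.left ∧ r.out = r'.out) ∧ r.right = r'.right := by
      rw [TensorIdx.ext_iff]; tauto
    by_cases hp : r.left = r'.left ∧ r.out = r'.out
    · simp only [if_pos hp]
      have h := uMat_mul_apply M (N.X.lab r.left).deg⁻¹ r.right r'.right
      rw [inv_inv] at h
      rw [h]
      by_cases hl : r.right = r'.right
      · rw [if_pos hl]
        exact (if_pos (e.2 ⟨hp, hl⟩)).symm
      · rw [if_neg hl]
        exact (if_neg fun h => hl (e.1 h).2).symm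
    · simp only [if_neg hp, Finset.sum_const_zero]
      exact (if_neg fun h => hp (e.1 h).1).symm

/-- Both sides contain the same entry of `N.uMat g` and the same scalar, as the coefficient is
invariant under the action. What is left is that `u_g` and `u_h` on `M` commute. -/
theorem braid_comm (M N : EqObj D) (g : ℤˣ) :
    (M ⊗ N).uMat g * mat (X := (M ⊗ N).X) (Y := (N ⊗ M).X) (braid M N) =
      mat (X := (M ⊗ N).X) (Y := (N ⊗ M).X) (braid M N) * (N ⊗ M).uMat g := by
  refine Matrix.ext fun (p : TensorIdx M.X N.X) (r : TensorIdx N.X M.X) => ?_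
  set h := (N.X.lab r.left).deg with hh
  set A := N.uMat g p.right r.left with hA
  set B := braidCoeff D (M.X.lab p.left) (N.X.lab p.right) p.out with hB
  have hdeg : A ≠ 0 → (N.X.lab p.right).deg = h := fun h' => by
    rw [hh, ← uMat_lab h', deg_smul]
  have L := sum_fix_right (X := M.X) (Y := N.X) r.left r.out (fun i =>
    if g • p.out = r.out then A * B * (M.uMat g p.left i * M.uMat h i r.right) else 0) (by
      intro i hi
      have : M.uMat h i r.right = 0 := by
        by_contra h
        exact hi ((fuses_of_uMat h).1 r.fuses)
      simp [this])
  have R := sum_fix_left (X := N.X) (Y := M.X) p.right p.out (fun i =>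
    if g • p.out = r.out then A * B * (M.uMat h p.left i * M.uMat g i r.right) else 0) (by
      intro i hi
      by_cases hA0 : A = 0
      · simp [hA0]
      · have : M.uMat h p.left i = 0 := by
          by_contra h
          rw [← hdeg hA0] at h
          exact hi ((fuses_of_uMat h).2 p.fuses)
        simp [this])
  refine Eq.trans ((Finset.sum_congr rfl fun (q : TensorIdx M.X N.X) _ => ?_).trans L)
    (Eq.trans ?_ ((Finset.sum_congr rfl fun (q : TensorIdx N.X M.X) _ => ?_).trans R).symm)
  · refine (congrArg₂ (· * ·) (uMat_tensor _ _ _ _ _) (braid_apply _ _ _ _)).trans ?_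
    have hq' : (r.left = q.right ∧ r.out = q.out) ↔ q.right = r.left ∧ q.out = r.out :=
      and_congr eq_comm eq_comm
    by_cases hq : q.right = r.left ∧ q.out = r.out
    · rw [if_pos hq, if_pos (hq'.2 hq), hq.1, hq.2]
      by_cases ho : g • p.out = r.out
      · rw [if_pos ho, if_pos ho]
        by_cases hA0 : A = 0
        · rw [← hA, hA0]
          ring
        by_cases hM0 : M.uMat g p.left q.left = 0
        · rw [hM0]
          ring
        -- When both entries are non-zero, `g` carries the three labels of `p` to those of the
        -- intermediate summand, so invariance of the coefficient applies.
        · rw [hB, ← braidCoeff_smul D g (M.X.lab p.left), uMat_lab hM0, uMat_lab hA0, ho]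
          ring
      · rw [if_neg ho, if_neg ho, zero_mul]
    · rw [if_neg hq, if_neg (mt hq'.1 hq), mul_zero]
  · split_ifs with ho
    -- Commutativity of `ℤ/2` enters here.
    · rw [← Finset.mul_sum, ← Finset.mul_sum, uMat_mul_sum, uMat_mul_sum, mul_comm g]
    · rfl
  · refine (congrArg₂ (· * ·) (braid_apply _ _ _ _) (uMat_tensor _ _ _ _ _)).trans ?_
    by_cases hq : q.left = p.right ∧ q.out = p.out
    · rw [if_pos hq, if_pos hq, hq.1, hq.2]
      by_cases ho : g • p.out = r.out
      · rw [if_pos ho, if_pos ho]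
        by_cases hA0 : A = 0
        · rw [← hA, hA0]
          ring
        · rw [hdeg hA0]
          ring
      · rw [if_neg ho, if_neg ho, mul_zero]
    · rw [if_neg hq, if_neg hq, zero_mul]

/-- The braiding isomorphism of equivariant objects. -/
def braidIso (M N : EqObj D) : M ⊗ N ≅ N ⊗ M :=
  mkIso (M := M ⊗ N) (N := N ⊗ M) ⟨braid M N, braidInv M N, braid_hom_inv M N, braid_inv_hom M N⟩
    fun g => TY.hom_ext (braid_comm M N g)

end EqObj

/-! ### Naturality of the braiding -/

namespace EqObj

theorem whiskerRight_apply {X X' : TY D} (f : X ⟶ X') (Y : TY D) (p : TensorIdx X Y)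
    (r : TensorIdx X' Y) :
    mat (f ▷ Y) p r = if p.right = r.right ∧ p.out = r.out then mat f p.left r.left else 0 := by
  refine (tensorMap_apply f (𝟙 Y) p r).trans ?_
  rw [mat_id_apply]
  split_ifs <;> simp_all

theorem whiskerLeft_apply (X : TY D) {Y Y' : TY D} (f : Y ⟶ Y') (p : TensorIdx X Y)
    (r : TensorIdx X Y') :
    mat (X ◁ f) p r = if p.left = r.left ∧ p.out = r.out then mat f p.right r.right else 0 := by
  refine (tensorMap_apply (𝟙 X) f p r).trans ?_
  rw [mat_id_apply]
  split_ifs <;> simp_all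

theorem mat_comm_apply {M N : EqObj D} (f : M ⟶ N) (g : ℤˣ) (i : M.X.ι) (j : N.X.ι) :
    ∑ k, M.uMat g i k * mat (toHom f) k j = ∑ k, mat (toHom f) i k * N.uMat g k j :=
  congrFun (congrFun (toHom_mat M N f g) i) j

/-- The coefficient sees only labels, which `f` preserves, so the claim reduces to `f` intertwining
the matrices `u_h`. Here equivariance of `f` is indispensable. -/
theorem braid_naturality_left {M M' : EqObj D} (f : M ⟶ M') (N : EqObj D) :
    toHom f ▷ N.X ≫ braid M' N = braid M N ≫ N.X ◁ toHom f := by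
  refine TY.hom_ext (Matrix.ext fun (p : TensorIdx M.X N.X) (r : TensorIdx N.X M'.X) => ?_)
  have L := sum_fix_right (X := M'.X) (Y := N.X) p.right p.out (fun i =>
    if r.left = p.right ∧ r.out = p.out then
      braidCoeff D (M.X.lab p.left) (N.X.lab p.right) p.out *
        (mat (toHom f) p.left i * M'.uMat (N.X.lab p.right).deg i r.right) else 0) (by
      intro i hi
      have : mat (toHom f) p.left i = 0 := by
        by_contra h
        exact hi (lab_eq _ h ▸ p.fuses)
      simp [this])
  have R := sum_fix_left (X := N.X) (Y := M.X) p.right p.out (fun i =>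
    if r.left = p.right ∧ r.out = p.out then
      braidCoeff D (M.X.lab p.left) (N.X.lab p.right) p.out *
        (M.uMat (N.X.lab p.right).deg p.left i * mat (toHom f) i r.right) else 0) (by
      intro i hi
      have : M.uMat (N.X.lab p.right).deg p.left i = 0 := by
        by_contra h
        exact hi ((fuses_of_uMat h).2 p.fuses)
      simp [this])
  refine Eq.trans ((Finset.sum_congr rfl fun (q : TensorIdx M'.X N.X) _ => ?_).trans L)
    (Eq.trans ?_ ((Finset.sum_congr rfl fun (q : TensorIdx N.X M.X) _ => ?_).trans R).symm)
  · refine (congrArg₂ (· * ·) (whiskerRight_apply _ _ _ _) (braid_apply _ _ _ _)).trans ?_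
    have hq' : (p.right = q.right ∧ p.out = q.out) ↔ q.right = p.right ∧ q.out = p.out :=
      and_congr eq_comm eq_comm
    by_cases hq : q.right = p.right ∧ q.out = p.out
    · rw [if_pos hq, if_pos (hq'.2 hq), hq.1, hq.2]
      by_cases hr : r.left = p.right ∧ r.out = p.out
      · rw [if_pos hr, if_pos hr]
        by_cases hf : mat (toHom f) p.left q.left = 0
        · rw [hf]
          ring
        · rw [lab_eq _ hf]
          ring
      · rw [if_neg hr, if_neg hr, mul_zero]
    · rw [if_neg hq, if_neg (mt hq'.1 hq), zero_mul]
  · split_ifs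
    · rw [← Finset.mul_sum, ← Finset.mul_sum, mat_comm_apply]
    · rw [Finset.sum_const_zero, Finset.sum_const_zero]
  · refine (congrArg₂ (· * ·) (braid_apply _ _ _ _) (whiskerLeft_apply _ _ _ _)).trans ?_
    by_cases hq : q.left = p.right ∧ q.out = p.out
    · have hr' : (p.right = r.left ∧ p.out = r.out) ↔ r.left = p.right ∧ r.out = p.out :=
        and_congr eq_comm eq_comm
      rw [if_pos hq, if_pos hq, hq.1, hq.2]
      by_cases hr : r.left = p.right ∧ r.out = p.out
      · rw [if_pos hr, if_pos (hr'.2 hr)]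
        ring
      · rw [if_neg hr, if_neg (mt hr'.1 hr), mul_zero]
    · rw [if_neg hq, if_neg hq, zero_mul]

/-- Since `f` preserves labels, both the degree and the scalar are the same on either side. Each
side has a single contributing index, and equivariance of `f` plays no role. -/
theorem braid_naturality_right (M : EqObj D) {N N' : EqObj D} (f : N ⟶ N') :
    M.X ◁ toHom f ≫ braid M N' = braid M N ≫ toHom f ▷ M.X := by
  refine TY.hom_ext (Matrix.ext fun (p : TensorIdx M.X N.X) (r : TensorIdx N'.X M.X) => ?_)
  have L := sum_fix_left (X := M.X) (Y := N'.X) p.left p.out (fun k =>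
    if k = r.left then if r.out = p.out then
      braidCoeff D (M.X.lab p.left) (N.X.lab p.right) p.out *
        (mat (toHom f) p.right k * M.uMat (N.X.lab p.right).deg p.left r.right) else 0 else 0) (by
      intro i hi
      have : mat (toHom f) p.right i = 0 := by
        by_contra h
        exact hi (lab_eq _ h ▸ p.fuses)
      simp [this])
  have R := sum_fix_left (X := N.X) (Y := M.X) p.right p.out (fun i =>
    if i = r.right then if r.out = p.out then
      braidCoeff D (M.X.lab p.left) (N.X.lab p.right) p.out *
        (mat (toHom f) p.right r.left * M.uMat (N.X.lab p.right).deg p.left i) else 0 else 0) (by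
      intro i hi
      have : M.uMat (N.X.lab p.right).deg p.left i = 0 := by
        by_contra h
        exact hi ((fuses_of_uMat h).2 p.fuses)
      simp [this])
  refine Eq.trans ((Finset.sum_congr rfl fun (q : TensorIdx M.X N'.X) _ => ?_).trans L)
    (Eq.trans ?_ ((Finset.sum_congr rfl fun (q : TensorIdx N.X M.X) _ => ?_).trans R).symm)
  · refine (congrArg₂ (· * ·) (whiskerLeft_apply _ _ _ _) (braid_apply _ _ _ _)).trans ?_
    have hq' : (p.left = q.left ∧ p.out = q.out) ↔ q.left = p.left ∧ q.out = p.out :=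
      and_congr eq_comm eq_comm
    by_cases hq : q.left = p.left ∧ q.out = p.out
    · rw [if_pos hq, if_pos (hq'.2 hq), hq.1, hq.2]
      by_cases hr : q.right = r.left
      · rw [if_pos hr]
        by_cases ho : r.out = p.out
        · rw [if_pos ho, if_pos ⟨hr.symm, ho⟩]
          by_cases hf : mat (toHom f) p.right q.right = 0
          · rw [hf]
            ring
          · rw [lab_eq _ hf]
            ring
        · rw [if_neg ho, if_neg (fun h => ho h.2), mul_zero]
      · rw [if_neg hr, if_neg (fun h => hr h.1.symm), mul_zero]
    · rw [if_neg hq, if_neg (mt hq'.1 hq), zero_mul]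
  · rw [Finset.sum_ite_eq', Finset.sum_ite_eq', if_pos (Finset.mem_univ _),
      if_pos (Finset.mem_univ _)]
  · refine (congrArg₂ (· * ·) (braid_apply _ _ _ _) (whiskerRight_apply _ _ _ _)).trans ?_
    by_cases hq : q.left = p.right ∧ q.out = p.out
    · rw [if_pos hq, if_pos hq, hq.1, hq.2]
      by_cases hr : q.right = r.right
      · rw [if_pos hr]
        by_cases ho : r.out = p.out
        · rw [if_pos ho, if_pos ⟨hr, ho.symm⟩]
          ring
        · rw [if_neg ho, if_neg (fun h => ho h.2.symm), mul_zero]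
      · rw [if_neg hr, if_neg (fun h => hr h.1), mul_zero]
    · rw [if_neg hq, if_neg hq, zero_mul]

end EqObj

/-! ### The forward hexagon -/

namespace EqObj

/-- The braiding leaves the summand of N ⊗ P untouched and the associator leaves the index of `M`
untouched, so at most one intermediate summand contributes. -/
theorem assoc_comp_braid_apply (M N P : EqObj D) (p : TensorIdx (M.X ⊗ N.X) P.X)
    (q : TensorIdx (N.X ⊗ P.X) M.X) :
    mat (assocHom M.X N.X P.X ≫ braid M (N ⊗ P)) p q =
      if TensorIdx.right p.left = TensorIdx.left q.left ∧ p.right = TensorIdx.right q.left ∧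
          p.out = q.out then
        assocInvCoeff D (M.X.lab (TensorIdx.left p.left)) (N.X.lab (TensorIdx.right p.left))
            (P.X.lab p.right) p.out (TensorIdx.out p.left) (TensorIdx.out q.left) *
          (braidCoeff D (M.X.lab (TensorIdx.left p.left)) (TensorIdx.out q.left) p.out *
            M.uMat (TensorIdx.out q.left).deg (TensorIdx.left p.left) q.right)
      else 0 := by
  obtain ⟨⟨i, j, u, h1⟩, k, d, h2⟩ := p
  obtain ⟨⟨j', k', v, h3⟩, i', d', h4⟩ := q
  change Fuses v (M.X.lab i') d' at h4
  change _ = if j = j' ∧ k = k' ∧ d = d' then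
    assocInvCoeff D (M.X.lab i) (N.X.lab j) (P.X.lab k) d u v *
      (braidCoeff D (M.X.lab i) v d * M.uMat v.deg i i') else 0
  have S := sum_fix_right (X := M.X) (Y := N.X ⊗ P.X) ⟨j', k', v, h3⟩ d' (fun x =>
    if x = i then if j = j' ∧ k = k' ∧ d = d' then
      assocInvCoeff D (M.X.lab i) (N.X.lab j) (P.X.lab k) d u v *
      (braidCoeff D (M.X.lab i) v d * M.uMat v.deg i i') else 0 else 0) (by
      intro x hx
      by_cases hxi : x = i
      · subst hxi
        have : M.uMat v.deg x i' = 0 := by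
          by_contra h
          exact hx ((fuses_of_uMat h).1 h4)
        simp [this]
      · exact if_neg hxi)
  refine ((Finset.sum_congr rfl fun (x : TensorIdx M.X (N.X ⊗ P.X)) _ => ?_).trans S).trans ?_
  · refine (congrArg (_ * ·) (braid_apply _ _ _ _)).trans ?_
    obtain ⟨x, (y : TensorIdx N.X P.X), w, h5⟩ := x
    change (if i = x ∧ j = TensorIdx.left y ∧ k = TensorIdx.right y ∧ d = w then
        assocInvCoeff D (M.X.lab i) (N.X.lab j) (P.X.lab k) d u (TensorIdx.out y) else 0) *
      (if (⟨j', k', v, h3⟩ : TensorIdx N.X P.X) = y ∧ d' = w then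
        braidCoeff D (M.X.lab x) (TensorIdx.out y) w * M.uMat (TensorIdx.out y).deg x i' else 0) =
      if y = (⟨j', k', v, h3⟩ : TensorIdx N.X P.X) ∧ w = d' then _ else 0
    by_cases hy : y = (⟨j', k', v, h3⟩ : TensorIdx N.X P.X) ∧ w = d'
    · obtain ⟨rfl, rfl⟩ := hy
      by_cases hx : x = i
      · subst hx
        by_cases hj : j = j' ∧ k = k' ∧ d = w
        · obtain ⟨rfl, rfl, rfl⟩ := hj
          simp
        · rw [if_neg fun h => hj h.2, zero_mul]
          simp [hj]
      · rw [if_neg fun h => hx h.1.symm, zero_mul]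
        simp [hx]
    · rw [if_neg hy]
      exact mul_eq_zero_of_right _ (if_neg fun h => hy ⟨h.1.symm, h.2.symm⟩)
  · rw [Finset.sum_ite_eq', if_pos (Finset.mem_univ _)]

theorem whiskerRight_braid_apply (M N : EqObj D) (Z : TY D) (p : TensorIdx (M.X ⊗ N.X) Z)
    (r : TensorIdx (N.X ⊗ M.X) Z) :
    mat (braid M N ▷ Z) p r = if p.right = r.right ∧ p.out = r.out then
      if TensorIdx.left r.left = TensorIdx.right p.left ∧
          TensorIdx.out r.left = TensorIdx.out p.left then
        braidCoeff D (M.X.lab (TensorIdx.left p.left)) (N.X.lab (TensorIdx.right p.left))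
            (TensorIdx.out p.left) *
          M.uMat (N.X.lab (TensorIdx.right p.left)).deg (TensorIdx.left p.left)
            (TensorIdx.right r.left)
      else 0 else 0 := by
  exact (whiskerRight_apply _ _ _ _).trans
    (congrArg (fun z : ℂ => if p.right = r.right ∧ p.out = r.out then z else 0)
      (braid_apply M N p.left r.left))

theorem whiskerLeft_braid_apply (Z : TY D) (M N : EqObj D) (p : TensorIdx Z (M.X ⊗ N.X))
    (r : TensorIdx Z (N.X ⊗ M.X)) :
    mat (Z ◁ braid M N) p r = if p.left = r.left ∧ p.out = r.out then
      if TensorIdx.left r.right = TensorIdx.right p.right ∧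
          TensorIdx.out r.right = TensorIdx.out p.right then
        braidCoeff D (M.X.lab (TensorIdx.left p.right)) (N.X.lab (TensorIdx.right p.right))
            (TensorIdx.out p.right) *
          M.uMat (N.X.lab (TensorIdx.right p.right)).deg (TensorIdx.left p.right)
            (TensorIdx.right r.right)
      else 0 else 0 := by
  exact (whiskerLeft_apply _ _ _ _).trans
    (congrArg (fun z : ℂ => if p.left = r.left ∧ p.out = r.out then z else 0)
      (braid_apply M N p.right r.right))

/-- The braiding preserves the output `u`, and the associator preserves the indices, so the
intermediate summand is determined. It exists whenever the entry of `u_h` is non-zero. -/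
theorem braid_comp_assoc_apply (M N P : EqObj D) (p : TensorIdx (M.X ⊗ N.X) P.X)
    (r : TensorIdx N.X (M.X ⊗ P.X)) :
    mat (braid M N ▷ P.X ≫ assocHom N.X M.X P.X) p r =
      if TensorIdx.right p.left = r.left ∧ p.right = TensorIdx.right r.right ∧
          p.out = r.out then
        braidCoeff D (M.X.lab (TensorIdx.left p.left)) (N.X.lab (TensorIdx.right p.left))
            (TensorIdx.out p.left) *
          M.uMat (N.X.lab (TensorIdx.right p.left)).deg (TensorIdx.left p.left)
            (TensorIdx.left r.right) *
          assocInvCoeff D (N.X.lab (TensorIdx.right p.left)) (M.X.lab (TensorIdx.left r.right))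
            (P.X.lab p.right) p.out (TensorIdx.out p.left) (TensorIdx.out r.right)
      else 0 := by
  obtain ⟨⟨i, j, u, h1⟩, k, d, h2⟩ := p
  obtain ⟨j', ⟨i', k', v, h3⟩, d', h4⟩ := r
  change Fuses u (P.X.lab k) d at h2
  change _ = if j = j' ∧ k = k' ∧ d = d' then
    braidCoeff D (M.X.lab i) (N.X.lab j) u * M.uMat (N.X.lab j).deg i i' *
      assocInvCoeff D (N.X.lab j) (M.X.lab i') (P.X.lab k) d u v else 0
  have S := sum_idx_left (X := N.X) (Y := M.X) (Z := P.X) j' i' k' d' fun x =>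
    if x = u then if j = j' ∧ k = k' ∧ d = d' then
      braidCoeff D (M.X.lab i) (N.X.lab j) u * M.uMat (N.X.lab j).deg i i' *
      assocInvCoeff D (N.X.lab j) (M.X.lab i') (P.X.lab k) d u v else 0 else 0
  refine ((Finset.sum_congr rfl fun (x : TensorIdx (N.X ⊗ M.X) P.X) _ => ?_).trans S).trans ?_
  · refine (congrArg (· * _) (whiskerRight_braid_apply _ _ _ _ _)).trans ?_
    obtain ⟨⟨y, x, w, h5⟩, z, e, h6⟩ := x
    change (if k = z ∧ d = e then if y = j ∧ w = u then
      braidCoeff D (M.X.lab i) (N.X.lab j) u * M.uMat (N.X.lab j).deg i x else 0 else 0) *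
      (if y = j' ∧ x = i' ∧ z = k' ∧ e = d' then
        assocInvCoeff D (N.X.lab y) (M.X.lab x) (P.X.lab z) e w v else 0) =
      if y = j' ∧ x = i' ∧ z = k' ∧ e = d' then (if w = u then _ else 0) else 0
    by_cases hy : y = j' ∧ x = i' ∧ z = k' ∧ e = d'
    · obtain ⟨rfl, rfl, rfl, rfl⟩ := hy
      by_cases hw : w = u
      · subst hw
        by_cases hj : j = y ∧ k = z ∧ d = e
        · obtain ⟨rfl, rfl, rfl⟩ := hj
          simp
        · simp only [and_self, if_true, and_true, if_neg hj]
          by_cases hk : k = z ∧ d = e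
          · rw [if_pos hk, if_neg fun h => hj ⟨h.symm, hk⟩, zero_mul]
          · rw [if_neg hk, zero_mul]
      · simp [hw]
    · rw [if_neg hy, if_neg hy, mul_zero]
  · rw [Finset.sum_eq_single u]
    · by_cases hj : j = j' ∧ k = k' ∧ d = d'
      · obtain ⟨rfl, rfl, rfl⟩ := hj
        simp only [and_self, if_true]
        by_cases hM : M.uMat (N.X.lab j).deg i i' = 0
        · simp [hM]
        · rw [if_pos ⟨(fuses_of_uMat hM).2 h1, h2⟩]
      · simp [hj]
    · intro x _ hx
      simp [hx]
    · simp

/-- The nested analogue of the two index lemmas: everything is fixed except the index in the middle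
factor, which the second braiding of the hexagon sums over. -/
theorem sum_idx_right_left {X Y Z : TY D} (j : X.ι) (k : Z.ι) (v d : Label C)
    (h : Fuses (X.lab j) v d) (F : Y.ι → ℂ) (hF : ∀ i, ¬Fuses (Y.lab i) (Z.lab k) v → F i = 0) :
    ∑ r : TensorIdx X (Y ⊗ Z), (if r.left = j ∧ TensorIdx.right r.right = k ∧
        TensorIdx.out r.right = v ∧ r.out = d then F (TensorIdx.left r.right) else 0) =
      ∑ i, F i := by
  have S := sum_fix_left (X := X) (Y := Y ⊗ Z) j d (fun (x : TensorIdx Y Z) =>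
    if x.right = k ∧ x.out = v then F x.left else 0) (by
      intro x hx
      refine if_neg ?_
      rintro ⟨-, rfl⟩
      exact hx h)
  refine (Finset.sum_congr rfl fun r _ => ?_).trans (S.trans (sum_fix_right k v F hF))
  by_cases h1 : r.left = j ∧ r.out = d
  · rw [if_pos h1]
    refine if_congr ?_ rfl rfl
    tauto
  · rw [if_neg h1]
    refine if_neg ?_
    tauto

/-- On the left the braiding with N ⊗ P uses `u` at the degree of the fused label; on the right two
successive braidings multiply `u` at the degrees of the factors. Degrees are multiplicative under
fusion, so both sides carry the same entry `U` of `u`, and the cofactors agree by the scalar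
hexagon. -/
theorem braid_hexagon_forward (M N P : EqObj D) :
    (assocHom M.X N.X P.X ≫ braid M (N ⊗ P)) ≫ assocHom N.X P.X M.X =
      (braid M N ▷ P.X ≫ assocHom N.X M.X P.X) ≫ N.X ◁ braid M P := by
  refine TY.hom_ext (Matrix.ext fun (p : TensorIdx (M.X ⊗ N.X) P.X)
    (r : TensorIdx N.X (P.X ⊗ M.X)) => ?_)
  obtain ⟨⟨i, j, u, h1⟩, k, d, h2⟩ := p
  obtain ⟨j', ⟨k', i', v, h3⟩, d', h4⟩ := r
  change Fuses u (P.X.lab k) d at h2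
  change Fuses (N.X.lab j') v d' at h4
  have L := sum_idx_left (X := N.X) (Y := P.X) (Z := M.X) j' k' i' d' fun x =>
    if j = j' ∧ k = k' ∧ d = d' then
      assocInvCoeff D (M.X.lab i) (N.X.lab j) (P.X.lab k) d u x *
      (braidCoeff D (M.X.lab i) x d * M.uMat x.deg i i') *
      assocInvCoeff D (N.X.lab j) (P.X.lab k) (M.X.lab i') d x v else 0
  have R := sum_idx_right_left (X := N.X) (Y := M.X) (Z := P.X) j' k' v d' h4 (fun x =>
    if j = j' ∧ k = k' ∧ d = d' then
      braidCoeff D (M.X.lab i) (N.X.lab j) u * M.uMat (N.X.lab j).deg i x *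
      assocInvCoeff D (N.X.lab j) (M.X.lab x) (P.X.lab k) d u v *
      (braidCoeff D (M.X.lab x) (P.X.lab k) v * M.uMat (P.X.lab k).deg x i') else 0) (by
      intro x hx
      refine (ite_eq_right_iff).2 ?_
      rintro ⟨rfl, rfl, rfl⟩
      have : M.uMat (P.X.lab k).deg x i' = 0 := by
        by_contra h
        exact hx ((fuses_of_uMat h).1 h3)
      simp [this])
  refine Eq.trans ((Finset.sum_congr rfl fun (q : TensorIdx (N.X ⊗ P.X) M.X) _ => ?_).trans L)
    (Eq.trans ?_ ((Finset.sum_congr rfl fun (q : TensorIdx N.X (M.X ⊗ P.X)) _ => ?_).trans R).symm)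
  · refine (congrArg (· * _) (assoc_comp_braid_apply _ _ _ _ _)).trans ?_
    obtain ⟨⟨y, z, w, h5⟩, x, e, h6⟩ := q
    change (if j = y ∧ k = z ∧ d = e then
      assocInvCoeff D (M.X.lab i) (N.X.lab j) (P.X.lab k) d u w *
      (braidCoeff D (M.X.lab i) w d * M.uMat w.deg i x) else 0) *
      (if y = j' ∧ z = k' ∧ x = i' ∧ e = d' then
        assocInvCoeff D (N.X.lab y) (P.X.lab z) (M.X.lab x) e w v else 0) =
      if y = j' ∧ z = k' ∧ x = i' ∧ e = d' then _ else 0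
    by_cases hy : y = j' ∧ z = k' ∧ x = i' ∧ e = d'
    · rw [if_pos hy, if_pos hy]
      obtain ⟨rfl, rfl, rfl, rfl⟩ := hy
      by_cases hj : j = y ∧ k = z ∧ d = e
      · obtain ⟨rfl, rfl, rfl⟩ := hj
        simp
      · rw [if_neg hj, zero_mul]
        exact (if_neg hj).symm
    · rw [if_neg hy, if_neg hy, mul_zero]
  · by_cases hj : j = j' ∧ k = k' ∧ d = d'
    · simp only [if_pos hj]
      obtain ⟨rfl, rfl, rfl⟩ := hj
      set U := M.uMat ((N.X.lab j).deg * (P.X.lab k).deg) i i' with hU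
      -- The degree of `x` does not depend on which admissible `x` is chosen, so `U` can be taken
      -- out of the sum.
      have hdeg : ∀ x, Fuses (N.X.lab j) (P.X.lab k) x → M.uMat x.deg i i' = U := fun x hx => by
        rw [hx.deg]
      have R : ∀ x, braidCoeff D (M.X.lab i) (N.X.lab j) u * M.uMat (N.X.lab j).deg i x *
          assocInvCoeff D (N.X.lab j) (M.X.lab x) (P.X.lab k) d u v *
          (braidCoeff D (M.X.lab x) (P.X.lab k) v * M.uMat (P.X.lab k).deg x i') =
          braidCoeff D (M.X.lab i) (N.X.lab j) u *
          assocInvCoeff D (N.X.lab j) ((N.X.lab j).deg • M.X.lab i) (P.X.lab k) d u v *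
          braidCoeff D ((N.X.lab j).deg • M.X.lab i) (P.X.lab k) v *
          (M.uMat (N.X.lab j).deg i x * M.uMat (P.X.lab k).deg x i') := fun x => by
        by_cases hx : M.uMat (N.X.lab j).deg i x = 0
        · simp [hx]
        · rw [uMat_lab hx]
          ring
      simp_rw [R]
      rw [← Finset.mul_sum, uMat_mul_sum, ← hU]
      -- If `U` is non-zero, it pins the label of `i'` to the twice twisted label of `i`, which is
      -- what the scalar hexagon needs; otherwise both sides vanish.
      by_cases hU0 : U = 0
      · rw [hU0, mul_zero]
        refine Finset.sum_eq_zero fun x _ => (ite_eq_right_iff).2 fun hx => ?_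
        rw [hdeg x hx.1, hU0]
        ring
      · have hi' : M.X.lab i' = (P.X.lab k).deg • (N.X.lab j).deg • M.X.lab i := by
          rw [← uMat_lab hU0, smul_smul, mul_comm]
        rw [hi'] at h3
        rw [← coeff_hexagon_forward D h1 h2 h3 h4, Finset.sum_mul]
        refine Finset.sum_congr rfl fun x _ => ?_
        by_cases hx : Fuses (N.X.lab j) (P.X.lab k) x
        · have e : Fuses x (M.X.lab i') d ↔ Fuses (M.X.lab i) x d :=
            fuses_of_uMat (by rwa [hdeg x hx])
          rw [hdeg x hx, if_congr (and_congr_right fun _ => e) rfl rfl, hi']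
          split_ifs <;> ring
        · rw [if_neg fun h => hx h.1, if_neg fun h => hx h.1, zero_mul]
    · simp [hj]
  · refine (congrArg₂ (· * ·) (braid_comp_assoc_apply _ _ _ _ _) 
      (whiskerLeft_braid_apply _ _ _ _ _)).trans ?_
    obtain ⟨y, ⟨x, z, w, h5⟩, e, h6⟩ := q
    change (if j = y ∧ k = z ∧ d = e then _ else 0) *
      (if y = j' ∧ e = d' then if k' = z ∧ v = w then
        braidCoeff D (M.X.lab x) (P.X.lab z) w * M.uMat (P.X.lab z).deg x i' else 0 else 0) =
      if y = j' ∧ z = k' ∧ w = v ∧ e = d' then _ else 0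
    by_cases hy : y = j' ∧ z = k' ∧ w = v ∧ e = d'
    · rw [if_pos hy]
      obtain ⟨rfl, rfl, rfl, rfl⟩ := hy
      by_cases hj : j = y ∧ k = z ∧ d = e
      · obtain ⟨rfl, rfl, rfl⟩ := hj
        simp
      · rw [if_neg hj, zero_mul]
        exact (if_neg hj).symm
    · rw [if_neg hy]
      refine mul_eq_zero_of_right _ ?_
      split_ifs with ha hb
      · exact absurd ⟨ha.1, hb.1.symm, hb.2.symm, ha.2⟩ hy
      all_goals rfl

end EqObj

/-! ### The reverse hexagon -/

namespace EqObj

/-- The moved object is M ⊗ N, whose action also moves the fused label. The final label `w'`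
therefore comes from `g⁻¹ • w'`, and this label enters the associator and the braiding coefficient.
-/
theorem assocInv_comp_braid_apply (M N P : EqObj D) (p : TensorIdx M.X (N.X ⊗ P.X))
    (q : TensorIdx P.X (M.X ⊗ N.X)) :
    mat (assocInv M.X N.X P.X ≫ braid (M ⊗ N) P) p q =
      if TensorIdx.right p.right = q.left ∧ p.out = q.out then
        assocCoeff D (M.X.lab p.left) (N.X.lab (TensorIdx.left p.right))
            (P.X.lab (TensorIdx.right p.right)) p.out (TensorIdx.out p.right)
            ((P.X.lab (TensorIdx.right p.right)).deg⁻¹ • TensorIdx.out q.right) *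
          braidCoeff D ((P.X.lab (TensorIdx.right p.right)).deg⁻¹ • TensorIdx.out q.right)
            (P.X.lab (TensorIdx.right p.right)) p.out *
          (M.uMat (P.X.lab (TensorIdx.right p.right)).deg p.left (TensorIdx.left q.right) *
            N.uMat (P.X.lab (TensorIdx.right p.right)).deg (TensorIdx.left p.right)
              (TensorIdx.right q.right))
      else 0 := by
  obtain ⟨i, ⟨j, k, v, h1⟩, d, h2⟩ := p
  obtain ⟨k', ⟨i', j', w', h3⟩, d', h4⟩ := q
  change Fuses (P.X.lab k') w' d' at h4
  set g := (P.X.lab k).deg with hg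
  change _ = if k = k' ∧ d = d' then
    assocCoeff D (M.X.lab i) (N.X.lab j) (P.X.lab k) d v (g⁻¹ • w') *
      braidCoeff D (g⁻¹ • w') (P.X.lab k) d * (M.uMat g i i' * N.uMat g j j') else 0
  have S := sum_fix_right (X := M.X ⊗ N.X) (Y := P.X) k' d' (fun (y : TensorIdx M.X N.X) =>
    if y.left = i ∧ y.right = j ∧ y.out = g⁻¹ • w' then if k = k' ∧ d = d' then
      assocCoeff D (M.X.lab i) (N.X.lab j) (P.X.lab k) d v (g⁻¹ • w') *
      braidCoeff D (g⁻¹ • w') (P.X.lab k) d * (M.uMat g i i' * N.uMat g j j') else 0 else 0) (by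
      intro y hy
      refine (ite_eq_right_iff).2 fun hy' => (ite_eq_right_iff).2 ?_
      rintro ⟨rfl, rfl⟩
      refine absurd ?_ hy
      change Fuses y.out _ _
      rw [hy'.2.2, ← fuses_braid, ← hg, smul_inv_smul]
      exact h4)
  refine ((Finset.sum_congr rfl fun (x : TensorIdx (M.X ⊗ N.X) P.X) _ => ?_).trans S).trans ?_
  · refine (congrArg (_ * ·) ((braid_apply _ _ _ _).trans
      (congrArg (fun z : ℂ => if k' = x.right ∧ d' = x.out then
        braidCoeff D (TensorIdx.out x.left) (P.X.lab x.right) x.out * z else 0)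
        (uMat_tensor M N _ x.left ⟨i', j', w', h3⟩)))).trans ?_
    obtain ⟨(y : TensorIdx M.X N.X), z, e, h5⟩ := x
    change (if y.left = i ∧ y.right = j ∧ z = k ∧ e = d then
        assocCoeff D (M.X.lab y.left) (N.X.lab y.right) (P.X.lab z) e v y.out else 0) *
      (if k' = z ∧ d' = e then braidCoeff D y.out (P.X.lab z) e *
        (if (P.X.lab z).deg • y.out = w' then
          M.uMat (P.X.lab z).deg y.left i' * N.uMat (P.X.lab z).deg y.right j' else 0) else 0) =
      if z = k' ∧ e = d' then (if y.left = i ∧ y.right = j ∧ y.out = g⁻¹ • w' then _ else 0) else 0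
    by_cases hz : z = k' ∧ e = d'
    · rw [if_pos hz]
      obtain ⟨rfl, rfl⟩ := hz
      by_cases hk : k = z ∧ d = e
      · obtain ⟨rfl, rfl⟩ := hk
        by_cases hy : y.left = i ∧ y.right = j
        · by_cases hw : y.out = g⁻¹ • w'
          · have hw2 : g • y.out = w' := by rw [hw, smul_inv_smul]
            simp only [hw, hy, and_self, if_true, ← hg, smul_inv_smul]
            ring
          · have hw2 : ¬g • y.out = w' := fun h => hw (by rw [← h, inv_smul_smul])
            rw [if_neg fun h : y.left = i ∧ y.right = j ∧ y.out = g⁻¹ • w' => hw h.2.2]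
            simp only [← hg, if_neg hw2, ite_self, mul_zero]
        · rw [if_neg fun h => hy ⟨h.1, h.2.1⟩, zero_mul]
          exact (if_neg fun h => hy ⟨h.1, h.2.1⟩).symm
      · rw [if_neg fun h => hk ⟨h.2.2.1.symm, h.2.2.2.symm⟩, zero_mul, if_neg hk]
        exact (ite_self _).symm
    · rw [if_neg hz]
      exact mul_eq_zero_of_right _ (if_neg fun h => hz ⟨h.1.symm, h.2.symm⟩)
  · by_cases hk : k = k' ∧ d = d'
    · simp only [if_pos hk]
      by_cases hM : M.uMat g i i' = 0
      · simp [hM]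
      by_cases hN : N.uMat g j j' = 0
      · simp [hN]
      have h5 : Fuses (M.X.lab i) (N.X.lab j) (g⁻¹ • w') := by
        have h6 := h3.smul g⁻¹
        rwa [← uMat_lab hM, ← uMat_lab hN, inv_smul_smul, inv_smul_smul] at h6
      refine (Finset.sum_eq_single (⟨i, j, g⁻¹ • w', h5⟩ : TensorIdx M.X N.X) ?_ ?_).trans ?_
      · exact fun y _ hy => if_neg fun h => hy (TensorIdx.ext h.1 h.2.1 h.2.2)
      · exact fun h => absurd (Finset.mem_univ _) h
      · exact if_pos ⟨rfl, rfl, rfl⟩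
    · simp only [if_neg hk, ite_self, Finset.sum_const_zero]

theorem braid_comp_assocInv_apply (M N P : EqObj D) (p : TensorIdx M.X (N.X ⊗ P.X))
    (r : TensorIdx (M.X ⊗ P.X) N.X) :
    mat (M.X ◁ braid N P ≫ assocInv M.X P.X N.X) p r =
      if p.left = TensorIdx.left r.left ∧ TensorIdx.right p.right = TensorIdx.right r.left ∧
          p.out = r.out then
        braidCoeff D (N.X.lab (TensorIdx.left p.right)) (P.X.lab (TensorIdx.right p.right))
            (TensorIdx.out p.right) *
          N.uMat (P.X.lab (TensorIdx.right p.right)).deg (TensorIdx.left p.right) r.right *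
          assocCoeff D (M.X.lab p.left) (P.X.lab (TensorIdx.right p.right)) (N.X.lab r.right) p.out
            (TensorIdx.out p.right) (TensorIdx.out r.left)
      else 0 := by
  obtain ⟨i, ⟨j, k, v, h1⟩, d, h2⟩ := p
  obtain ⟨⟨i', k', w', h3⟩, j', d', h4⟩ := r
  change Fuses (M.X.lab i) v d at h2
  change _ = if i = i' ∧ k = k' ∧ d = d' then
    braidCoeff D (N.X.lab j) (P.X.lab k) v * N.uMat (P.X.lab k).deg j j' *
      assocCoeff D (M.X.lab i) (P.X.lab k) (N.X.lab j') d v w' else 0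
  have S := sum_idx_right (X := M.X) (Y := P.X) (Z := N.X) i' k' j' d' fun x =>
    if x = v then if i = i' ∧ k = k' ∧ d = d' then
      braidCoeff D (N.X.lab j) (P.X.lab k) v * N.uMat (P.X.lab k).deg j j' *
      assocCoeff D (M.X.lab i) (P.X.lab k) (N.X.lab j') d v w' else 0 else 0
  refine ((Finset.sum_congr rfl fun (x : TensorIdx M.X (P.X ⊗ N.X)) _ => ?_).trans S).trans ?_
  · refine (congrArg (· * _) (whiskerLeft_braid_apply _ _ _ _ _)).trans ?_
    obtain ⟨x, ⟨z, y, w, h5⟩, e, h6⟩ := x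
    change (if i = x ∧ d = e then if z = k ∧ w = v then
      braidCoeff D (N.X.lab j) (P.X.lab k) v * N.uMat (P.X.lab k).deg j y else 0 else 0) *
      (if i' = x ∧ k' = z ∧ j' = y ∧ d' = e then
        assocCoeff D (M.X.lab i') (P.X.lab k') (N.X.lab j') d' w w' else 0) =
      if i' = x ∧ k' = z ∧ j' = y ∧ d' = e then (if w = v then _ else 0) else 0
    by_cases hy : i' = x ∧ k' = z ∧ j' = y ∧ d' = e
    · obtain ⟨rfl, rfl, rfl, rfl⟩ := hy
      by_cases hw : w = v
      · subst hw
        by_cases hj : i = i' ∧ k = k' ∧ d = d'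
        · obtain ⟨rfl, rfl, rfl⟩ := hj
          simp
        · simp only [and_self, if_true, and_true, if_neg hj]
          by_cases hk : i = i' ∧ d = d'
          · rw [if_pos hk, if_neg fun h => hj ⟨hk.1, h.symm, hk.2⟩, zero_mul]
          · rw [if_neg hk, zero_mul]
      · simp [hw]
    · rw [if_neg hy, if_neg hy, mul_zero]
  · rw [Finset.sum_eq_single v]
    · by_cases hj : i = i' ∧ k = k' ∧ d = d'
      · obtain ⟨rfl, rfl, rfl⟩ := hj
        simp only [and_self, if_true]
        by_cases hM : N.uMat (P.X.lab k).deg j j' = 0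
        · simp [hM]
        · rw [if_pos ⟨(fuses_of_uMat hM).2 h1, h2⟩]
      · simp [hj]
    · intro x _ hx
      simp [hx]
    · simp

/-- Both sides contain one entry of `u_g` on `M` and one on `N`, with the same `g`, the degree of
the label of `P`. If either vanishes there is nothing to show; otherwise they fix the labels of `i'`
and `j'`, and the scalar hexagon remains. -/
theorem braid_hexagon_reverse (M N P : EqObj D) :
    (assocInv M.X N.X P.X ≫ braid (M ⊗ N) P) ≫ assocInv P.X M.X N.X =
      (M.X ◁ braid N P ≫ assocInv M.X P.X N.X) ≫ braid M P ▷ N.X := by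
  refine TY.hom_ext (Matrix.ext fun (p : TensorIdx M.X (N.X ⊗ P.X))
    (r : TensorIdx (P.X ⊗ M.X) N.X) => ?_)
  obtain ⟨i, ⟨j, k, v, h1⟩, d, h2⟩ := p
  obtain ⟨⟨k', i', w', h3⟩, j', d', h4⟩ := r
  change Fuses (M.X.lab i) v d at h2
  change Fuses w' (N.X.lab j') d' at h4
  set g := (P.X.lab k).deg with hg
  have L := sum_idx_right (X := P.X) (Y := M.X) (Z := N.X) k' i' j' d' fun x =>
    if k = k' ∧ d = d' then
      assocCoeff D (M.X.lab i) (N.X.lab j) (P.X.lab k) d v (g⁻¹ • x) *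
      braidCoeff D (g⁻¹ • x) (P.X.lab k) d * (M.uMat g i i' * N.uMat g j j') *
      assocCoeff D (P.X.lab k) (M.X.lab i') (N.X.lab j') d x w' else 0
  have R := sum_idx_left (X := M.X) (Y := P.X) (Z := N.X) i k' j' d' fun x =>
    if x = w' then if k = k' ∧ d = d' then
      braidCoeff D (N.X.lab j) (P.X.lab k) v * N.uMat g j j' *
      assocCoeff D (M.X.lab i) (P.X.lab k) (N.X.lab j') d v w' *
      (braidCoeff D (M.X.lab i) (P.X.lab k) w' * M.uMat g i i') else 0 else 0
  refine Eq.trans ((Finset.sum_congr rfl fun (q : TensorIdx P.X (M.X ⊗ N.X)) _ => ?_).trans L)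
    (Eq.trans ?_ ((Finset.sum_congr rfl fun (q : TensorIdx (M.X ⊗ P.X) N.X) _ => ?_).trans R).symm)
  · refine (congrArg (· * _) (assocInv_comp_braid_apply _ _ _ _ _)).trans ?_
    obtain ⟨z, ⟨x, y, w, h5⟩, e, h6⟩ := q
    change (if k = z ∧ d = e then
      assocCoeff D (M.X.lab i) (N.X.lab j) (P.X.lab k) d v (g⁻¹ • w) *
      braidCoeff D (g⁻¹ • w) (P.X.lab k) d * (M.uMat g i x * N.uMat g j y) else 0) *
      (if k' = z ∧ i' = x ∧ j' = y ∧ d' = e then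
        assocCoeff D (P.X.lab k') (M.X.lab i') (N.X.lab j') d' w w' else 0) =
      if k' = z ∧ i' = x ∧ j' = y ∧ d' = e then _ else 0
    by_cases hy : k' = z ∧ i' = x ∧ j' = y ∧ d' = e
    · rw [if_pos hy, if_pos hy]
      obtain ⟨rfl, rfl, rfl, rfl⟩ := hy
      by_cases hj : k = k' ∧ d = d'
      · obtain ⟨rfl, rfl⟩ := hj
        simp
      · rw [if_neg hj, zero_mul]
        exact (if_neg hj).symm
    · rw [if_neg hy, if_neg hy, mul_zero]
  · refine Eq.trans ?_ (Finset.sum_eq_single w' (fun x _ hx => by rw [if_neg hx, ite_self])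
      fun h => absurd (Finset.mem_univ _) h).symm
    by_cases hj : k = k' ∧ d = d'
    · simp only [if_pos hj, if_true]
      obtain ⟨rfl, rfl⟩ := hj
      by_cases hM : M.uMat g i i' = 0
      · simp [hM]
      by_cases hN : N.uMat g j j' = 0
      · simp [hN]
      have hi' := uMat_lab hM
      have hj' := uMat_lab hN
      rw [if_pos ⟨(fuses_of_uMat hM).1 h3, h4⟩]
      rw [← hi'] at h3
      rw [← hj'] at h4
      have hc := coeff_hexagon_reverse D h1 h2 h3 h4
      rw [← hg, hi', hj'] at hc
      have e : ∀ x, (Fuses (M.X.lab i') (N.X.lab j') (g • x) ∧ Fuses (P.X.lab k) (g • x) d) ↔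
          Fuses (M.X.lab i) (N.X.lab j) x ∧ Fuses x (P.X.lab k) d := fun x => by
        rw [hg, fuses_braid, ← hg, ← hi', ← hj']
        refine and_congr_left' ⟨fun h => ?_, fun h => h.smul g⟩
        have h' := h.smul g⁻¹
        rwa [inv_smul_smul, inv_smul_smul, inv_smul_smul] at h'
      -- The matrix product sums over the label after the twist, the scalar hexagon over the label
      -- before it.
      refine (Equiv.sum_comp (MulAction.toPerm g) _).symm.trans ?_
      simp only [MulAction.toPerm_apply, inv_smul_smul, e]
      replace hc := congrArg (· * (M.uMat g i i' * N.uMat g j j')) hc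
      beta_reduce at hc
      rw [Finset.sum_mul] at hc
      refine Eq.trans ?_ (hc.trans (by ring))
      refine Finset.sum_congr rfl fun x _ => ?_
      split_ifs <;> ring
    · simp [hj]
  · refine (congrArg₂ (· * ·) (braid_comp_assocInv_apply _ _ _ _ _)
      (whiskerRight_braid_apply _ _ _ _ _)).trans ?_
    obtain ⟨⟨x, z, w, h5⟩, y, e, h6⟩ := q
    change (if i = x ∧ k = z ∧ d = e then _ else 0) *
      (if y = j' ∧ e = d' then if k' = z ∧ w' = w then
        braidCoeff D (M.X.lab x) (P.X.lab z) w * M.uMat (P.X.lab z).deg x i' else 0 else 0) =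
      if x = i ∧ z = k' ∧ y = j' ∧ e = d' then (if w = w' then _ else 0) else 0
    by_cases hy : x = i ∧ z = k' ∧ y = j' ∧ e = d'
    · rw [if_pos hy]
      obtain ⟨rfl, rfl, rfl, rfl⟩ := hy
      by_cases hw : w = w'
      · subst hw
        by_cases hj : k = z ∧ d = e
        · obtain ⟨rfl, rfl⟩ := hj
          simp [← hg]
        · rw [if_neg fun h => hj h.2, zero_mul, if_neg hj, ite_self]
      · rw [if_neg hw]
        refine mul_eq_zero_of_right _ ?_
        simp [Ne.symm hw]
    · rw [if_neg hy]
      by_cases hx : i = x ∧ k = z ∧ d = e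
      · refine mul_eq_zero_of_right _ ?_
        split_ifs with ha hb
        · exact absurd ⟨hx.1.symm, hb.1.symm, ha.1, ha.2⟩ hy
        all_goals rfl
      · rw [if_neg hx, zero_mul]

/-- The braiding of the equivariantisation. -/
abbrev braided (D : Datum C) : BraidedCategory (EqObj D) where
  braiding := braidIso
  braiding_naturality_right M _ _ f := EqObj.hom_ext (braid_naturality_right M f)
  braiding_naturality_left f N := EqObj.hom_ext (braid_naturality_left f N)
  hexagon_forward M N P := EqObj.hom_ext ((Category.assoc _ _ _).symm.trans
    ((braid_hexagon_forward M N P).trans (Category.assoc _ _ _)))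
  hexagon_reverse M N P := EqObj.hom_ext ((Category.assoc _ _ _).symm.trans
    ((braid_hexagon_reverse M N P).trans (Category.assoc _ _ _)))

end EqObj

namespace EqObj

/-! ### The action on the simple objects -/

@[simp] theorem signChar_one_left (g : ℤˣ) : signChar 1 g = 1 := by
  simp [signChar]

@[simp] theorem signChar_one_right (s : ℤˣ) : signChar s 1 = 1 := if_pos rfl

theorem signChar_neg_one (s : ℤˣ) : (signChar s (-1) : ℂ) = ((s : ℤ) : ℂ) := by
  rw [signChar, if_neg (by decide)]
  rfl

theorem uMat_Xobj (s g : ℤˣ) (i j : PUnit) : (Xobj D s).uMat g i j = signChar s g := if_pos rfl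

theorem uMat_Zobj (s g : ℤˣ) (i j : PUnit) : (Zobj D s).uMat g i j = signChar s g := if_pos rfl

theorem uMat_Yobj (a : C) (g : ℤˣ) (i j : ULift.{u} ℤˣ) :
    (Yobj D a).uMat g i j = if j = ⟨i.down * g⟩ then 1 else 0 := by
  by_cases h : j = ⟨i.down * g⟩
  · exact (if_pos h.symm).trans (if_pos h).symm
  · exact (if_neg fun h' => h h'.symm).trans (if_neg h).symm

/-! ### The components of the braiding -/

/-- On the simple objects each row of the relevant `u_h` has one non-zero entry, at column `e i`, so
the braiding is a scaled exchange of summands. Only for `Y` braided with `Z` is `e` not the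
identity. -/
theorem braid_eq_swapHom (M N : EqObj D) (e : M.X.ι → M.X.ι) (c : M.X.ι → N.X.ι → Label C → ℂ)
    (h : ∀ i k w, braidCoeff D (M.X.lab i) (N.X.lab k) w * M.uMat (N.X.lab k).deg i (e i) = c i k w)
    (h0 : ∀ i k i', i' ≠ e i → M.uMat (N.X.lab k).deg i i' = 0) :
    braid M N = swapHom M.X N.X e c := by
  refine TY.hom_ext (Matrix.ext fun (p : TensorIdx M.X N.X) (r : TensorIdx N.X M.X) => ?_)
  refine (braid_apply M N p r).trans ?_
  change _ = if r.left = p.right ∧ r.right = e p.left ∧ p.out = r.out then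
    c p.left p.right p.out else 0
  by_cases h3 : r.right = e p.left
  · rw [h3, h]
    refine if_congr ?_ rfl rfl
    rw [eq_comm (a := r.out)]
    tauto
  · rw [h0 _ _ _ h3, mul_zero, ite_self, if_neg fun h => h3 h.2.1]

theorem uMat_Yobj_of_ne (a : C) (g : ℤˣ) (i j : ULift.{u} ℤˣ) (h : j ≠ ⟨i.down * g⟩) :
    (Yobj D a).uMat g i j = 0 := (uMat_Yobj a g i j).trans (if_neg h)

theorem uMat_Yobj_mul (a : C) (g : ℤˣ) (i : ULift.{u} ℤˣ) :
    (Yobj D a).uMat g i (⟨i.down * g⟩ : ULift.{u} ℤˣ) = 1 :=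
  (uMat_Yobj a g i _).trans (if_pos rfl)

theorem braid_Xobj_Xobj (s : ℤˣ) (t : ℤˣ) :
    braid (Xobj D s) (Xobj D t) =
      swapHom (Xobj D s).X (Xobj D t).X id
        fun _ _ _ => 1 := by
  refine braid_eq_swapHom _ _ _ _ ?_ (fun i k i' h => absurd (Subsingleton.elim (α := PUnit) _ _) h)
  rintro (i : PUnit) (k : PUnit) w
  refine (congrArg (_ * ·) (uMat_Xobj s 1 i i)).trans ?_
  change (D.χ 1 1 : ℂ) * (signChar s 1 : ℂ) = 1
  simp

theorem braid_Xobj_Yobj (s : ℤˣ) (a : C) :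
    braid (Xobj D s) (Yobj D a) =
      swapHom (Xobj D s).X (Yobj D a).X id
        fun _ _ _ => 1 := by
  refine braid_eq_swapHom _ _ _ _ ?_ (fun i k i' h => absurd (Subsingleton.elim (α := PUnit) _ _) h)
  rintro (i : PUnit) (k : ULift.{u} ℤˣ) w
  refine (congrArg (_ * ·) (uMat_Xobj s 1 i i)).trans ?_
  change (D.χ 1 _ : ℂ) * (signChar s 1 : ℂ) = 1
  simp

theorem braid_Yobj_Xobj (a : C) (s : ℤˣ) :
    braid (Yobj D a) (Xobj D s) =
      swapHom (Yobj D a).X (Xobj D s).X id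
        fun _ _ _ => 1 := by
  refine braid_eq_swapHom _ _ _ _ ?_ (fun i k i' h => uMat_Yobj_of_ne a 1 i i' (by rwa [mul_one]))
  rintro (i : ULift.{u} ℤˣ) (k : PUnit) w
  refine (congrArg (_ * ·) (uMat_Yobj a 1 i _)).trans ?_
  rw [if_pos (by rw [mul_one]; rfl), mul_one]
  change (D.χ _ 1 : ℂ) = 1
  simp

theorem χ_zpow (D : Datum C) (a b : C) (s t : ℤˣ) :
    D.χ (a ^ (s : ℤ)) (b ^ (t : ℤ)) = if s = t then D.χ a b else D.χ a b⁻¹ := by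
  rcases Int.units_eq_one_or s with rfl | rfl <;> rcases Int.units_eq_one_or t with rfl | rfl <;>
    simp [show (-1 : ℤˣ) ≠ 1 by decide, show (1 : ℤˣ) ≠ -1 by decide]

theorem braid_Yobj_Yobj (a : C) (b : C) :
    braid (Yobj D a) (Yobj D b) =
      swapHom (Yobj D a).X (Yobj D b).X id
        fun (i k : ULift.{u} ℤˣ) _ => if i.down = k.down then (D.χ a b : ℂ) else (D.χ a b⁻¹ : ℂ) := by
  refine braid_eq_swapHom _ _ _ _ ?_ (fun i k i' h => uMat_Yobj_of_ne a 1 i i' (by rwa [mul_one]))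
  rintro (i : ULift.{u} ℤˣ) (k : ULift.{u} ℤˣ) w
  refine (congrArg (_ * ·) (uMat_Yobj a 1 i _)).trans ?_
  rw [if_pos (by rw [mul_one]; rfl), mul_one]
  change (D.χ (a ^ (i.down : ℤ)) (b ^ (k.down : ℤ)) : ℂ) = _
  rw [χ_zpow]
  split_ifs <;> rfl

theorem braid_Zobj_Xobj (s : ℤˣ) (t : ℤˣ) :
    braid (Zobj D s) (Xobj D t) =
      swapHom (Zobj D s).X (Xobj D t).X id
        fun _ _ _ => 1 := by
  refine braid_eq_swapHom _ _ _ _ ?_ (fun i k i' h => absurd (Subsingleton.elim (α := PUnit) _ _) h)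
  rintro (i : PUnit) (k : PUnit) w
  refine (congrArg (_ * ·) (uMat_Zobj s 1 i i)).trans ?_
  change (((D.q 1)⁻¹ : ℂˣ) : ℂ) * (signChar s 1 : ℂ) = 1
  simp [D.q_one]

theorem braid_Zobj_Yobj (s : ℤˣ) (a : C) :
    braid (Zobj D s) (Yobj D a) =
      swapHom (Zobj D s).X (Yobj D a).X id
        fun _ _ _ => (D.q a : ℂ)⁻¹ := by
  refine braid_eq_swapHom _ _ _ _ ?_ (fun i k i' h => absurd (Subsingleton.elim (α := PUnit) _ _) h)
  rintro (i : PUnit) (k : ULift.{u} ℤˣ) w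
  refine (congrArg (_ * ·) (uMat_Zobj s 1 i i)).trans ?_
  change (((D.q (a ^ (k.down : ℤ)))⁻¹ : ℂˣ) : ℂ) * (signChar s 1 : ℂ) = _
  simp [D.q_zpow]

theorem braid_Yobj_Zobj (a : C) (s : ℤˣ) :
    braid (Yobj D a) (Zobj D s) =
      swapHom (Yobj D a).X (Zobj D s).X (fun t : ULift.{u} ℤˣ => ⟨-t.down⟩)
        fun _ _ _ => (D.q a : ℂ)⁻¹ := by
  refine braid_eq_swapHom _ _ _ _ ?_ (fun i k i' h => uMat_Yobj_of_ne a (-1) i i' (by rwa [mul_neg_one]))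
  rintro (i : ULift.{u} ℤˣ) (k : PUnit) w
  refine (congrArg (_ * ·) (uMat_Yobj a (-1) i _)).trans ?_
  rw [if_pos (by rw [mul_neg_one]), mul_one]
  change (((D.q (a ^ (i.down : ℤ)))⁻¹ : ℂˣ) : ℂ) = _
  simp [D.q_zpow]

theorem braid_Xobj_Zobj (s : ℤˣ) (t : ℤˣ) :
    braid (Xobj D s) (Zobj D t) =
      swapHom (Xobj D s).X (Zobj D t).X id
        fun _ _ _ => ((s : ℤ) : ℂ) := by
  refine braid_eq_swapHom _ _ _ _ ?_ (fun i k i' h => absurd (Subsingleton.elim (α := PUnit) _ _) h)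
  rintro (i : PUnit) (k : PUnit) w
  refine (congrArg (_ * ·) (uMat_Xobj s (-1) i i)).trans ?_
  change (((D.q 1)⁻¹ : ℂˣ) : ℂ) * (signChar s (-1) : ℂ) = _
  simp [D.q_one, signChar_neg_one]

theorem braid_Zobj_Zobj (s : ℤˣ) (t : ℤˣ) :
    braid (Zobj D s) (Zobj D t) =
      swapHom (Zobj D s).X (Zobj D t).X id
        fun _ _ w => ((s : ℤ) : ℂ) * D.δ * qLabel D w := by
  refine braid_eq_swapHom _ _ _ _ ?_ (fun i k i' h => absurd (Subsingleton.elim (α := PUnit) _ _) h)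
  rintro (i : PUnit) (k : PUnit) w
  refine (congrArg (_ * ·) (uMat_Zobj s (-1) i i)).trans ?_
  change braidCoeff D sigma sigma w * (signChar s (-1) : ℂ) = _
  rw [signChar_neg_one]
  -- The label `σ` is no summand of σ ⊗ σ; there both default values are zero.
  cases w <;> simp only [braidCoeff, qLabel] <;> ring

/-! ### The unit and the dimensions -/

/-- A genuine equality of objects is available because the underlying objects agree definitionally,
so only the isomorphisms `u_g` have to be compared. -/
theorem Xobj_one (D : Datum C) : Xobj D 1 = 𝟙_ (EqObj D) := by
  have h : (Xobj D 1).u = (𝟙_ (EqObj D) : EqObj D).u := by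
    funext g
    refine Iso.ext (TY.hom_ext (Matrix.ext fun (i : PUnit) (j : PUnit) => ?_))
    refine (if_pos rfl).trans ?_
    rw [signChar_one_left]
    exact (uMat_unit (D := D) g i j).symm
  change EqObj.mk _ _ _ = EqObj.mk _ _ _
  congr 1

/-- The pivotal structure is diagonal, so only the summand with the same indices contributes. Double
dual labels are equal to the original ones only propositionally, which is why the fusion witness is
transported. -/
theorem piv_comp_ev_apply (X : TY D) (p : TensorIdx X (TY.dual X)) (j : PUnit) :
    mat (piv X ▷ TY.dual X ≫ ev (TY.dual X)) p j =
      if p.left = p.right ∧ p.out = elt 1 then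
        pivCoeff D (X.lab p.left) * evCoeff D (X.lab p.right).dual else 0 := by
  have hd : ∀ s : Label C, s.dual.dual = s := by rintro (a | _) <;> simp [Label.dual]
  refine (Finset.sum_eq_single (⟨p.left, p.right, p.out, by
    change Fuses (X.lab p.left).dual.dual _ _
    rw [hd]
    exact p.fuses⟩ : TensorIdx (TY.dual (TY.dual X)) (TY.dual X)) ?_ ?_).trans ?_
  · intro q _ hq
    refine mul_eq_zero_of_left ?_ _
    refine (tensorMap_apply _ _ _ _).trans ?_
    refine (ite_eq_right_iff).2 fun h1 => ?_
    by_cases h2 : p.left = q.left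
    · refine mul_eq_zero_of_right _ ((mat_id_apply _ _ _).trans (if_neg fun h3 => hq ?_))
      exact TensorIdx.ext h2.symm h3.symm h1.symm
    · exact mul_eq_zero_of_left (if_neg h2) _
  · exact fun h => absurd (Finset.mem_univ _) h
  · have h : mat (piv X ▷ TY.dual X) p (⟨p.left, p.right, p.out, by
        change Fuses (X.lab p.left).dual.dual _ _
        rw [hd]
        exact p.fuses⟩ : TensorIdx (TY.dual (TY.dual X)) (TY.dual X)) =
        pivCoeff D (X.lab p.left) := by
      refine (if_pos rfl).trans ?_
      refine (congrArg₂ (· * ·) (if_pos rfl) ((mat_id_apply _ _ _).trans (if_pos rfl))).trans ?_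
      exact mul_one _
    refine (congrArg (· * _) h).trans ?_
    refine (mul_ite _ _ _ _).trans ?_
    rw [mul_zero]
    rfl

/-- Coevaluation restricts to the diagonal summands with output `e`. The dimension is thus a sum of
contributions of labels and does not see the matrices `u_g`. -/
theorem dim_eq_sum (M : EqObj D) :
    dim M = ∑ i, pivCoeff D (M.X.lab i) * evCoeff D (M.X.lab i).dual := by
  refine Eq.trans ?_ (sum_tensorIdx_diag (X := M.X) (Y := TY.dual M.X) (fun i => i)
    (fun i => Label.fuses_dual_right (M.X.lab i)) (fun i k w =>
    if i = k ∧ w = elt 1 then pivCoeff D (M.X.lab i) * evCoeff D (M.X.lab k).dual else 0)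
    (fun i k w h => if_neg h) |>.trans ?_)
  · refine Finset.sum_congr rfl fun (p : TensorIdx M.X (TY.dual M.X)) _ => ?_
    refine (congrArg (_ * ·) (piv_comp_ev_apply M.X p PUnit.unit)).trans ?_
    change (if p.left = p.right ∧ p.out = elt 1 then 1 else 0) * _ = _
    split_ifs <;> simp
  · simp

theorem dim_Xobj (s : ℤˣ) : dim (Xobj D s) = 1 := by
  rw [dim_eq_sum]
  change ∑ i : PUnit.{u + 1}, (1 : ℂ) * 1 = 1
  simp

theorem dim_Yobj (a : C) : dim (Yobj D a) = 2 := by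
  rw [dim_eq_sum]
  change ∑ i : ULift.{u} ℤˣ, (1 : ℂ) * 1 = 2
  simp

theorem dim_Zobj (s : ℤˣ) : dim (Zobj D s) = (Real.sqrt (Fintype.card C) : ℂ) := by
  rw [dim_eq_sum]
  change ∑ i : PUnit.{u + 1}, ((SignType.sign D.κ : ℝ) : ℂ) * (D.κ : ℂ)⁻¹ = _
  rw [Fintype.sum_unique]
  -- The sign in the pivotal structure turns κ⁻¹ into |κ|⁻¹, which makes the dimension positive for
  -- either sign of κ.
  have h1 : Real.sqrt (Fintype.card C) = |D.κ|⁻¹ := by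
    rw [← Real.sqrt_sq_eq_abs, D.κ_sq, one_div, Real.sqrt_inv, inv_inv]
  have h2 : D.κ ≠ 0 := by exact_mod_cast D.κ_ne_zero
  rw [h1, ← Complex.ofReal_inv, ← Complex.ofReal_mul]
  congr 1
  rcases lt_or_gt_of_ne h2 with h | h
  · simp [sign_neg h, abs_of_neg h, inv_neg]
  · simp [sign_pos h, abs_of_pos h]

end EqObj

/-! ### Orbits of the inversion on a group of odd order -/

/-- The order of such an element divides both 2 and the odd number n. This is the only way in which
oddness enters the structure of the simple objects. -/
theorem eq_one_of_inv_eq (hodd : Odd (Fintype.card C)) {a : C} (h : a⁻¹ = a) : a = 1 := by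
  have h2 : a ^ 2 = 1 := by rw [pow_two, ← inv_eq_iff_mul_eq_one, h]
  have h3 := pow_gcd_eq_one.2 ⟨h2, pow_card_eq_one (x := a)⟩
  rwa [(Nat.coprime_two_left.2 hodd).gcd_eq_one, pow_one] at h3

theorem zpow_units_injective (hodd : Odd (Fintype.card C)) {a : C} (ha : a ≠ 1) {s t : ℤˣ}
    (h : a ^ (s : ℤ) = a ^ (t : ℤ)) : s = t := by
  rcases Int.units_eq_one_or s with rfl | rfl <;> rcases Int.units_eq_one_or t with rfl | rfl
  · rfl
  · simp only [Units.val_one, zpow_one, Units.val_neg, zpow_neg] at h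
    exact absurd (eq_one_of_inv_eq hodd h.symm) ha
  · simp only [Units.val_one, zpow_one, Units.val_neg, zpow_neg] at h
    exact absurd (eq_one_of_inv_eq hodd h) ha
  · rfl

theorem zpow_units_ne_one {a : C} (ha : a ≠ 1) (s : ℤˣ) : a ^ (s : ℤ) ≠ 1 := by
  rcases Int.units_eq_one_or s with rfl | rfl <;> simpa using ha

/-- Every non-trivial element is uniquely of the form `x ^ t` with `t = ±1` and `x` the chosen
representative of an orbit. -/
def orbitEquiv (hodd : Odd (Fintype.card C)) : YOrbit C × ℤˣ ≃ {a : C // a ≠ 1} :=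
  Equiv.ofBijective (fun p => ⟨p.1.out.1 ^ (p.2 : ℤ), zpow_units_ne_one p.1.out.2 _⟩) (by
    constructor
    · rintro ⟨o, t⟩ ⟨o', t'⟩ h
      replace h : o.out.1 ^ (t : ℤ) = o'.out.1 ^ (t' : ℤ) := congrArg Subtype.val h
      have ho : o = o' := by
        rw [← o.out_eq, ← o'.out_eq]
        refine Quotient.sound ?_
        change o'.out.1 = o.out.1 ∨ o'.out.1 = o.out.1⁻¹
        rcases Int.units_eq_one_or t with rfl | rfl <;>
          rcases Int.units_eq_one_or t' with rfl | rfl <;>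
          simp only [Units.val_one, zpow_one, Units.val_neg, zpow_neg, inv_inj] at h
        · exact Or.inl h.symm
        · exact Or.inr (by rw [h, inv_inv])
        · exact Or.inr h.symm
        · exact Or.inl h.symm
      subst ho
      rw [zpow_units_injective hodd o.out.2 h]
    · intro a
      -- The chosen representative is `a` or its inverse; the exponent 1 or -1 is taken accordingly.
      have h : (orbitSetoid C).r (Quotient.mk (orbitSetoid C) a).out a := Quotient.mk_out a
      rcases h with h | h
      · exact ⟨(Quotient.mk _ a, 1), Subtype.ext (by simp [← h])⟩
      · exact ⟨(Quotient.mk _ a, -1), Subtype.ext (by simp [h])⟩)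

/-- Inversion acts freely off the unit, so twice the number of orbits is n - 1 and the division is
exact. -/
theorem card_YOrbit (hodd : Odd (Fintype.card C)) :
    Nat.card (YOrbit C) = (Fintype.card C - 1) / 2 := by
  have h := Nat.card_congr (orbitEquiv hodd)
  rw [Nat.card_prod, Nat.card_eq_fintype_card (α := ℤˣ), Nat.card_eq_fintype_card (α := {a : C // a ≠ 1}),
    Fintype.card_subtype_compl, Fintype.card_subtype_eq] at h
  have h2 : Fintype.card ℤˣ = 2 := rfl
  rw [h2] at h
  omega

namespace EqObj

/-! ### Averaging and Schur's lemma -/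

/-- The average of the elementary matrix with entry `1` at `(k, i)`. -/
def linkHom (S M : EqObj D) (k : S.X.ι) (i : M.X.ι) (h : S.X.lab k = M.X.lab i) : S ⟶ M :=
  mkHom ⟨∑ g, S.uMat g * Matrix.single k i (1 : ℂ) * M.uMat g⁻¹, fun a b hab => by
    rw [Matrix.sum_apply]
    refine Finset.sum_eq_zero fun g _ => ?_
    rw [Matrix.mul_apply]
    refine Finset.sum_eq_zero fun c _ => ?_
    by_contra h0
    obtain ⟨h1, h2⟩ := mul_ne_zero_iff.1 h0
    by_cases hc : c = i
    · subst hc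
      rw [Matrix.mul_single_apply_same, mul_one] at h1
      refine hab ?_
      rw [← uMat_lab h2, ← h, ← uMat_lab h1, inv_smul_smul]
    · exact h1 (Matrix.mul_single_apply_of_ne _ _ _ _ _ hc _)⟩ (fun g => by
    change S.uMat g * (∑ g, S.uMat g * Matrix.single k i (1 : ℂ) * M.uMat g⁻¹) =
      (∑ g, S.uMat g * Matrix.single k i (1 : ℂ) * M.uMat g⁻¹) * M.uMat g
    -- The usual shift of the summation variable that makes an average equivariant.
    rw [Matrix.mul_sum, Matrix.sum_mul, ← Equiv.sum_comp (Equiv.mulLeft g⁻¹)]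
    refine Finset.sum_congr rfl fun h _ => ?_
    rw [Equiv.coe_mulLeft, ← Matrix.mul_assoc, ← Matrix.mul_assoc, uMat_mul, Matrix.mul_assoc _ _ (M.uMat g), uMat_mul,
      mul_inv_cancel_left, mul_inv_rev, inv_inv])

theorem mat_linkHom (S M : EqObj D) (k : S.X.ι) (i : M.X.ι) (h : S.X.lab k = M.X.lab i) :
    mat (toHom (linkHom S M k i h)) = ∑ g, S.uMat g * Matrix.single k i (1 : ℂ) * M.uMat g⁻¹ := rfl

theorem linkHom_apply (S M : EqObj D) (k : S.X.ι) (i : M.X.ι) (h : S.X.lab k = M.X.lab i)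
    (a : S.X.ι) (b : M.X.ι) :
    mat (toHom (linkHom S M k i h)) a b = ∑ g, S.uMat g a k * M.uMat g⁻¹ i b := by
  rw [mat_linkHom, Matrix.sum_apply]
  refine Finset.sum_congr rfl fun g _ => ?_
  rw [Matrix.mul_apply, Finset.sum_eq_single i]
  · rw [Matrix.mul_single_apply_same, mul_one]
  · intro c _ hc
    rw [Matrix.mul_single_apply_of_ne _ _ _ _ _ hc, zero_mul]
  · exact fun h => absurd (Finset.mem_univ _) h

/-- By equivariance of `f` and cyclicity of the trace, each term of the average contributes the same
entry of `f`; 2 is the order of the group. Hence every non-zero `f` is detected by some averaged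
morphism in the other direction. -/
theorem trace_mul_linkHom {S M : EqObj D} (f : M ⟶ S) (k : S.X.ι) (i : M.X.ι)
    (h : S.X.lab k = M.X.lab i) :
    (mat (toHom f) * mat (toHom (linkHom S M k i h))).trace = 2 * mat (toHom f) i k := by
  have h1 : ∀ g : ℤˣ, (mat (toHom f) * (S.uMat g * Matrix.single k i (1 : ℂ) * M.uMat g⁻¹)).trace =
      mat (toHom f) i k := fun g => by
    rw [← Matrix.mul_assoc, ← Matrix.mul_assoc, Matrix.trace_mul_comm, ← Matrix.mul_assoc,
      ← toHom_mat, ← Matrix.mul_assoc, uMat_mul, inv_mul_cancel, uMat_one, Matrix.one_mul,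
      Matrix.trace_mul_single]
    simp
  rw [mat_linkHom, Matrix.mul_sum, Matrix.trace_sum]
  simp_rw [h1]
  simp

theorem exists_entry_ne_zero {M N : EqObj D} {f : M ⟶ N} (hf : f ≠ 0) :
    ∃ i j, mat (toHom f) i j ≠ 0 := by
  by_contra! h
  exact hf (EqObj.hom_ext (TY.hom_ext (Matrix.ext fun i j => h i j)))

theorem ne_zero_of_entry {M N : EqObj D} {f : M ⟶ N} {i : M.X.ι} {j : N.X.ι}
    (h : mat (toHom f) i j ≠ 0) : f ≠ 0 := by
  rintro rfl
  exact h rfl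

/-- An object whose endomorphisms are the scalars. -/
def ScalarEnd (M : EqObj D) : Prop := ∀ f : M ⟶ M, ∃ c : ℂ, mat (toHom f) = c • 1

/-- Scalar multiples of morphisms. -/
def smulHom {M N : EqObj D} (c : ℂ) (f : M ⟶ N) : M ⟶ N :=
  mkHom ⟨c • mat (toHom f), fun i j h => by simp [mat_homog (toHom f) h]⟩ fun g => by
    change M.uMat g * (c • mat (toHom f)) = (c • mat (toHom f)) * N.uMat g
    rw [Matrix.mul_smul, Matrix.smul_mul, toHom_mat]

theorem mat_smulHom {M N : EqObj D} (c : ℂ) (f : M ⟶ N) :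
    mat (toHom (smulHom c f)) = c • mat (toHom f) := rfl

/-- Composing `f` with a suitable averaged morphism gives an endomorphism of `S` of non-zero trace.
It is a scalar, hence a non-zero one, and dividing by it gives the retraction. -/
theorem ScalarEnd.exists_retraction {S M : EqObj D} (hS : ScalarEnd S) {f : S ⟶ M} (hf : f ≠ 0) :
    ∃ g : M ⟶ S, f ≫ g = 𝟙 S := by
  obtain ⟨i, j, hij⟩ := exists_entry_ne_zero hf
  have htr := trace_mul_linkHom f j i (lab_eq _ hij).symm
  obtain ⟨c, hc⟩ := hS (f ≫ linkHom M S j i (lab_eq _ hij).symm)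
  have hc0 : c ≠ 0 := by
    rintro rfl
    rw [zero_smul] at hc
    rw [← mat_comp, ← toHom_comp, hc, Matrix.trace_zero] at htr
    exact hij (by simpa using htr.symm)
  refine ⟨smulHom c⁻¹ (linkHom M S j i (lab_eq _ hij).symm), EqObj.hom_ext (TY.hom_ext ?_)⟩
  rw [toHom_comp, mat_comp, mat_smulHom, Matrix.mul_smul, ← mat_comp, ← toHom_comp, hc, smul_smul,
    inv_mul_cancel₀ hc0, one_smul]
  rfl

theorem ScalarEnd.exists_section {S M : EqObj D} (hS : ScalarEnd S) {f : M ⟶ S} (hf : f ≠ 0) :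
    ∃ g : S ⟶ M, g ≫ f = 𝟙 S := by
  obtain ⟨i, j, hij⟩ := exists_entry_ne_zero hf
  have htr := trace_mul_linkHom f j i (lab_eq _ hij).symm
  obtain ⟨c, hc⟩ := hS (linkHom S M j i (lab_eq _ hij).symm ≫ f)
  have hc0 : c ≠ 0 := by
    rintro rfl
    rw [zero_smul] at hc
    rw [Matrix.trace_mul_comm, ← mat_comp, ← toHom_comp, hc, Matrix.trace_zero] at htr
    exact hij (by simpa using htr.symm)
  refine ⟨smulHom c⁻¹ (linkHom S M j i (lab_eq _ hij).symm), EqObj.hom_ext (TY.hom_ext ?_)⟩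
  rw [toHom_comp, mat_comp, mat_smulHom, Matrix.smul_mul, ← mat_comp, ← toHom_comp, hc, smul_smul,
    inv_mul_cancel₀ hc0, one_smul]
  rfl

theorem id_ne_zero {M : EqObj D} (i : M.X.ι) : 𝟙 M ≠ 0 :=
  ne_zero_of_entry (i := i) (j := i) (by
    refine (mat_id_apply M.X i i).trans_ne ?_
    simp)

/-- A non-zero monomorphism into `S` has a section, so it is an isomorphism. The index `i` excludes
the zero object, whose endomorphisms are scalar as well. -/
theorem ScalarEnd.simple {S : EqObj D} (hS : ScalarEnd S) (i : S.X.ι) : Simple S where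
  mono_isIso_iff_nonzero {M} f _ := by
    constructor
    · rintro _ rfl
      refine id_ne_zero i ?_
      rw [← IsIso.inv_hom_id (0 : M ⟶ S), comp_zero]
    · intro hf
      obtain ⟨g, hg⟩ := hS.exists_section hf
      have : IsSplitEpi f := ⟨⟨⟨g, hg⟩⟩⟩
      exact isIso_of_mono_of_isSplitEpi f

theorem ScalarEnd.nonempty_iso {S M : EqObj D} (hS : ScalarEnd S) (hM : Simple M) {f : S ⟶ M}
    (hf : f ≠ 0) : Nonempty (M ≅ S) := by
  obtain ⟨g, hg⟩ := hS.exists_retraction hf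
  have : IsSplitMono f := ⟨⟨⟨g, hg⟩⟩⟩
  have := isIso_of_mono_of_nonzero hf
  exact ⟨(asIso f).symm⟩

/-- A zero row is impossible in an invertible matrix. Since entries preserve labels, every label of
`M` occurs in `N`, and this separates objects with different labels. -/
theorem exists_entry_of_iso {M N : EqObj D} (e : M ≅ N) (i : M.X.ι) :
    ∃ j, mat (toHom e.hom) i j ≠ 0 := by
  by_contra! h
  have h1 : mat (toHom (e.hom ≫ e.inv)) i i = 1 := by
    rw [e.hom_inv_id]
    exact (mat_id_apply M.X i i).trans (if_pos rfl)
  rw [toHom_comp, mat_comp, Matrix.mul_apply, Finset.sum_eq_zero] at h1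
  · exact zero_ne_one h1
  · intro j _
    rw [h, zero_mul]

/-! ### Objects with one summand -/

/-- The object `(t, u_{-1} = s id)` on a label `t` fixed by the action. -/
def line (D : Datum C) (t : Label C) (ht : ∀ g : ℤˣ, g • t = t) (s : ℤˣ) : EqObj D where
  X := single D t
  u g := isoOfEquiv (Equiv.refl PUnit) (fun _ => ht g) (signChar s g)
  comm := single_comm t s ht

section Line

variable {t : Label C} {ht : ∀ g : ℤˣ, g • t = t}

theorem uMat_line (s g : ℤˣ) (i j : PUnit) : (line D t ht s).uMat g i j = signChar s g := if_pos rfl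

theorem scalarEnd_line (s : ℤˣ) : ScalarEnd (line D t ht s) := fun f => by
  refine ⟨mat (toHom f) PUnit.unit PUnit.unit, Matrix.ext fun (i : PUnit) (j : PUnit) => ?_⟩
  refine Eq.symm ((congrArg (_ * ·) (if_pos rfl)).trans (mul_one _))

theorem simple_line (s : ℤˣ) : Simple (line D t ht s) := (scalarEnd_line s).simple PUnit.unit

theorem signChar_injective {s s' : ℤˣ} (h : signChar s (-1) = signChar s' (-1)) : s = s' := by
  have h1 := signChar_neg_one s
  rw [h, signChar_neg_one] at h1
  exact Units.ext (by exact_mod_cast h1.symm)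

/-- A one-by-one intertwiner that is non-zero forces the two characters to agree at -1. -/
theorem nonempty_line_iso_iff (s s' : ℤˣ) :
    Nonempty (line D t ht s ≅ line D t ht s') ↔ s = s' := by
  refine ⟨?_, by rintro rfl; exact ⟨Iso.refl _⟩⟩
  rintro ⟨e⟩
  obtain ⟨(j : PUnit), hj⟩ := exists_entry_of_iso e PUnit.unit
  have h := mat_comm_apply e.hom (-1) PUnit.unit PUnit.unit
  replace h : ∑ k : PUnit, (line D t ht s).uMat (-1) PUnit.unit k * mat (toHom e.hom) k PUnit.unit =
    ∑ k : PUnit, mat (toHom e.hom) PUnit.unit k * (line D t ht s').uMat (-1) k PUnit.unit := h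
  rw [Fintype.sum_unique, Fintype.sum_unique, uMat_line, uMat_line, mul_comm] at h
  exact signChar_injective (Units.ext (mul_left_cancel₀ hj h))

/-- The two averaged morphisms from the lines to `M` cannot both vanish: they are projections of the
summand `i` onto the two eigenspaces of `u_{-1}`. -/
theorem exists_iso_line {M : EqObj D} (hM : Simple M) (i : M.X.ι) (hi : M.X.lab i = t) :
    ∃ s, Nonempty (M ≅ line D t ht s) := by
  by_contra! h
  have h0 : ∀ s, ∑ g, (signChar s g : ℂ) * M.uMat g⁻¹ i i = 0 := fun s => by
    by_contra hs
    have h1 : linkHom (line D t ht s) M PUnit.unit i hi.symm ≠ 0 :=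
      ne_zero_of_entry (i := PUnit.unit) (j := i) (by
        refine (linkHom_apply _ _ _ _ _ _ _).trans_ne ?_
        refine (Finset.sum_congr rfl fun g _ => congrArg (· * _) (uMat_line s g _ _)).trans_ne ?_
        exact hs)
    exact (not_nonempty_iff.2 (h s)) ((scalarEnd_line s).nonempty_iso hM h1)
  have h1 := h0 1
  have h2 := h0 (-1)
  rw [UnitsInt.univ, Finset.sum_pair (by decide), signChar_one_right] at h1 h2
  rw [inv_one, uMat_one, Matrix.one_apply_eq] at h1 h2
  rw [signChar_neg_one] at h1 h2
  simp only [Units.val_one, Int.cast_one, Units.val_neg, Int.cast_neg, one_mul] at h1 h2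
  -- The two vanishing entries are 1 ± u_{-1}(i,i); their sum is 2.
  have h3 : (1 : ℂ) + 1 = 0 := by linear_combination h1 + h2
  norm_num at h3

end Line

theorem simple_Xobj (s : ℤˣ) : Simple (Xobj D s) :=
  simple_line (ht := fun g => congrArg elt (one_zpow (g : ℤ))) s

theorem simple_Zobj (s : ℤˣ) : Simple (Zobj D s) := simple_line (ht := fun _ => rfl) s

theorem nonempty_Xobj_iso_iff (s t : ℤˣ) : Nonempty (Xobj D s ≅ Xobj D t) ↔ s = t :=
  nonempty_line_iso_iff (ht := fun g => congrArg elt (one_zpow (g : ℤ))) s t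

theorem nonempty_Zobj_iso_iff (s t : ℤˣ) : Nonempty (Zobj D s ≅ Zobj D t) ↔ s = t :=
  nonempty_line_iso_iff (ht := fun _ => rfl) s t

/-! ### The objects `Y_a` -/

/-- Since a ≠ a⁻¹, an endomorphism is diagonal; equivariance under the exchange of the summands
makes its two diagonal entries equal. -/
theorem scalarEnd_Yobj (hodd : Odd (Fintype.card C)) {a : C} (ha : a ≠ 1) :
    ScalarEnd (Yobj D a) := fun f => by
  let x : ULift.{u} ℤˣ := ⟨1⟩
  have h0 : ∀ i j : ULift.{u} ℤˣ, i ≠ j → mat (toHom f) i j = 0 := fun i j hij => by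
    by_contra h
    refine hij (ULift.ext _ _ (zpow_units_injective hodd ha ?_))
    exact elt.inj (lab_eq (toHom f) h)
  refine ⟨mat (toHom f) x x, Matrix.ext fun (i : ULift.{u} ℤˣ) (j : ULift.{u} ℤˣ) => ?_⟩
  by_cases hij : i = j
  · subst hij
    refine Eq.trans ?_ ((congrArg (_ * ·) (if_pos rfl)).trans (mul_one _)).symm
    have h := mat_comm_apply f i.down x i
    have h1 : ∑ k : ULift.{u} ℤˣ, (Yobj D a).uMat i.down x k * mat (toHom f) k i =
        mat (toHom f) i i := by
      rw [Finset.sum_eq_single i]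
      · rw [uMat_Yobj, if_pos (by simp [x]), one_mul]
      · intro k _ hk
        rw [uMat_Yobj, if_neg (by simpa [x] using hk), zero_mul]
      · exact fun h => absurd (Finset.mem_univ _) h
    have h2 : ∑ k : ULift.{u} ℤˣ, mat (toHom f) x k * (Yobj D a).uMat i.down k i =
        mat (toHom f) x x := by
      rw [Finset.sum_eq_single x]
      · rw [uMat_Yobj, if_pos (by simp [x]), mul_one]
      · intro k _ hk
        rw [h0 x k hk.symm, zero_mul]
      · exact fun h => absurd (Finset.mem_univ _) h
    exact h1.symm.trans (h.trans h2)
  · rw [h0 i j hij]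
    exact ((congrArg (_ * ·) (if_neg hij)).trans (mul_zero _)).symm

theorem simple_Yobj (hodd : Odd (Fintype.card C)) {a : C} (ha : a ≠ 1) : Simple (Yobj D a) :=
  (scalarEnd_Yobj hodd ha).simple (⟨1⟩ : ULift.{u} ℤˣ)

/-- Frobenius reciprocity in disguise: `Yobj D a` is induced from the label `a`, so any summand `a`
of `M` gives a non-zero morphism from it. -/
theorem nonempty_iso_Yobj (hodd : Odd (Fintype.card C)) {M : EqObj D} (hM : Simple M) {a : C}
    (ha : a ≠ 1) (i : M.X.ι) (hi : M.X.lab i = elt a) : Nonempty (M ≅ Yobj D a) := by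
  let x : ULift.{u} ℤˣ := ⟨1⟩
  have hx : (Yobj D a).X.lab x = M.X.lab i := by
    rw [hi]
    exact congrArg elt (zpow_one a)
  refine (scalarEnd_Yobj hodd ha).nonempty_iso hM (f := linkHom (Yobj D a) M x i hx)
    (ne_zero_of_entry (i := x) (j := i) ?_)
  refine (linkHom_apply _ _ _ _ _ _ _).trans_ne ?_
  -- The element -1 moves the summand `x`, so only the identity contributes to this entry, with
  -- value 1.
  rw [Finset.sum_eq_single 1]
  · rw [uMat_Yobj, if_pos (by simp [x]), inv_one, uMat_one, Matrix.one_apply_eq, one_mul]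
    exact one_ne_zero
  · intro g _ hg
    rw [uMat_Yobj, if_neg (by simpa [x, ULift.ext_iff, eq_comm] using hg), zero_mul]
  · exact fun h => absurd (Finset.mem_univ _) h

theorem nonempty_Yobj_iso_iff (hodd : Odd (Fintype.card C)) {a b : C} (ha : a ≠ 1) (hb : b ≠ 1) :
    Nonempty (Yobj D a ≅ Yobj D b) ↔ b = a ∨ b = a⁻¹ := by
  constructor
  · rintro ⟨e⟩
    obtain ⟨(j : ULift.{u} ℤˣ), hj⟩ := exists_entry_of_iso e (⟨1⟩ : ULift.{u} ℤˣ)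
    have h : a ^ ((1 : ℤˣ) : ℤ) = b ^ (j.down : ℤ) := elt.inj (lab_eq _ hj)
    rcases Int.units_eq_one_or j.down with hj | hj <;> rw [hj] at h <;> simp at h
    · exact Or.inl h.symm
    · exact Or.inr (by rw [h, inv_inv])
  · rintro (rfl | rfl)
    · exact ⟨Iso.refl _⟩
    -- The second summand of `Yobj D a` has label `a⁻¹`, so the recognition of simple objects by one
    -- label applies.
    · exact nonempty_iso_Yobj hodd (simple_Yobj hodd ha) hb (⟨-1⟩ : ULift.{u} ℤˣ)
        (congrArg elt (by simp))

theorem classification (hodd : Odd (Fintype.card C)) (M : EqObj D) (hM : Simple M) :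
    (∃ s, Nonempty (M ≅ Xobj D s)) ∨ (∃ s, Nonempty (M ≅ Zobj D s)) ∨
      ∃ a, a ≠ 1 ∧ Nonempty (M ≅ Yobj D a) := by
  -- A simple object has non-zero identity, hence at least one summand `i`; its label decides the
  -- case.
  obtain ⟨i, -, -⟩ := exists_entry_ne_zero (Simple.not_isZero M |> fun h h' =>
    h ((IsZero.iff_id_eq_zero M).2 h') : 𝟙 M ≠ 0)
  rcases hi : M.X.lab i with a | _
  · by_cases ha : a = 1
    · subst ha
      exact Or.inl (exists_iso_line (ht := fun g => congrArg elt (one_zpow (g : ℤ))) hM i hi)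
    · exact Or.inr (Or.inr ⟨a, ha, nonempty_iso_Yobj hodd hM ha i hi⟩)
  · exact Or.inr (Or.inl (exists_iso_line (ht := fun _ => rfl) hM i hi))

theorem isEmpty_iso_Xobj_Zobj (s t : ℤˣ) : IsEmpty (Xobj D s ≅ Zobj D t) := ⟨fun e => by
  obtain ⟨j, hj⟩ := exists_entry_of_iso e PUnit.unit
  have h : elt (1 : C) = sigma := lab_eq _ hj
  cases h⟩

theorem isEmpty_iso_Xobj_Yobj (s : ℤˣ) {a : C} (ha : a ≠ 1) :
    IsEmpty (Xobj D s ≅ Yobj D a) := ⟨fun e => by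
  obtain ⟨(j : ULift.{u} ℤˣ), hj⟩ := exists_entry_of_iso e PUnit.unit
  exact zpow_units_ne_one ha _ (elt.inj (lab_eq _ hj)).symm⟩

theorem isEmpty_iso_Zobj_Yobj (s : ℤˣ) (a : C) : IsEmpty (Zobj D s ≅ Yobj D a) := ⟨fun e => by
  obtain ⟨(j : ULift.{u} ℤˣ), hj⟩ := exists_entry_of_iso e PUnit.unit
  have h : sigma = elt (a ^ (j.down : ℤ)) := lab_eq _ hj
  cases h⟩

end EqObj

theorem signChar_mul_left (s t g : ℤˣ) : signChar (s * t) g = signChar s g * signChar t g := by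
  unfold signChar
  split_ifs
  · rw [one_mul]
  · exact map_mul _ s t

namespace EqObj

/-! ### Objects on which the action permutes the summands up to scalars -/

/-- The action of `g` on `M` sends the summand `i` to the summand `act g i` with the scalar
`coeff g i`. -/
structure Monomial (M : EqObj D) where
  act : ℤˣ → M.X.ι → M.X.ι
  coeff : ℤˣ → M.X.ι → ℂ
  lab_act : ∀ g i, M.X.lab (act g i) = g • M.X.lab i
  act_act : ∀ g i, act g (act g i) = i
  uMat_act : ∀ g i, M.uMat g i (act g i) = coeff g i
  uMat_of_ne : ∀ g i j, j ≠ act g i → M.uMat g i j = 0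

namespace Monomial

/-- The action on a tensor product. -/
def tensor {M N : EqObj D} (P : Monomial M) (Q : Monomial N) : Monomial (M ⊗ N) where
  act g (p : TensorIdx M.X N.X) := (⟨P.act g p.left, Q.act g p.right, g • p.out, by
    rw [P.lab_act, Q.lab_act]
    exact p.fuses.smul g⟩ : TensorIdx M.X N.X)
  coeff g (p : TensorIdx M.X N.X) := P.coeff g p.left * Q.coeff g p.right
  lab_act _ _ := rfl
  act_act g (p : TensorIdx M.X N.X) := TensorIdx.ext (P.act_act g p.left) (Q.act_act g p.right)
    ((mul_smul g g p.out).symm.trans (by rw [Int.units_mul_self, one_smul]))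
  uMat_act g (p : TensorIdx M.X N.X) := by
    refine (uMat_tensor M N g p _).trans ((if_pos rfl).trans ?_)
    rw [P.uMat_act, Q.uMat_act]
  uMat_of_ne g (p : TensorIdx M.X N.X) (r : TensorIdx M.X N.X) h := by
    refine (uMat_tensor M N g p r).trans ?_
    split_ifs with h3
    · by_cases h1 : r.left = P.act g p.left
      · by_cases h2 : r.right = Q.act g p.right
        · exact absurd (TensorIdx.ext h1 h2 h3.symm) h
        · rw [Q.uMat_of_ne g _ _ h2, mul_zero]
      · rw [P.uMat_of_ne g _ _ h1, zero_mul]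
    · rfl

/-- The action on `X_±`. -/
def X (D : Datum C) (s : ℤˣ) : Monomial (Xobj D s) where
  act _ i := i
  coeff g _ := signChar s g
  lab_act g _ := congrArg elt (one_zpow (g : ℤ)).symm
  act_act _ _ := rfl
  uMat_act g _ := uMat_Xobj s g _ _
  uMat_of_ne _ _ _ h := absurd (Subsingleton.elim (α := PUnit) _ _) h

/-- The action on `Z_±`. -/
def Z (D : Datum C) (s : ℤˣ) : Monomial (Zobj D s) where
  act _ i := i
  coeff g _ := signChar s g
  lab_act _ _ := rfl
  act_act _ _ := rfl
  uMat_act g _ := uMat_Zobj s g _ _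
  uMat_of_ne _ _ _ h := absurd (Subsingleton.elim (α := PUnit) _ _) h

/-- The action on `Y_a`. -/
def Y (D : Datum C) (a : C) : Monomial (Yobj D a) where
  act g (t : ULift.{u} ℤˣ) := (⟨t.down * g⟩ : ULift.{u} ℤˣ)
  coeff _ _ := 1
  lab_act g (t : ULift.{u} ℤˣ) := by
    change elt (a ^ ((t.down * g : ℤˣ) : ℤ)) = elt ((a ^ (t.down : ℤ)) ^ (g : ℤ))
    rw [← zpow_mul, Units.val_mul]
  act_act g (t : ULift.{u} ℤˣ) := ULift.ext _ _ (by
    change t.down * g * g = t.down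
    rw [mul_assoc, Int.units_mul_self, mul_one])
  uMat_act g t := uMat_Yobj_mul a g t
  uMat_of_ne g t _ h := uMat_Yobj_of_ne a g t _ h

section Maps

variable {A M : EqObj D} (P : Monomial A) (Q : Monomial M) (e : A.X.ι → M.X.ι)
  (hlab : ∀ a, M.X.lab (e a) = A.X.lab a) (c : A.X.ι → ℂ)

theorem sum_uMat_mul (g : ℤˣ) (a : A.X.ι) (F : A.X.ι → ℂ) :
    ∑ b, A.uMat g a b * F b = P.coeff g a * F (P.act g a) := by
  rw [Finset.sum_eq_single (P.act g a), P.uMat_act]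
  · intro b _ hb
    rw [P.uMat_of_ne g a b hb, zero_mul]
  · exact fun h => absurd (Finset.mem_univ _) h

/-- The inclusion of `A` into `M` along an equivariant map of the summands. -/
def incl (hact : ∀ g a, e (P.act g a) = Q.act g (e a))
    (hcoeff : ∀ g a, P.coeff g a * c (P.act g a) = c a * Q.coeff g (e a)) : A ⟶ M :=
  mkHom ⟨Matrix.of fun a m => if m = e a then c a else 0, fun a m h => if_neg (by
    rintro rfl
    exact h (hlab a).symm)⟩ (fun g => Matrix.ext fun a m => by
      refine (sum_uMat_mul P g a fun b => if m = e b then c b else 0).trans ?_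
      refine Eq.trans ?_ (Finset.sum_eq_single (e a) (fun m' _ hm =>
        mul_eq_zero_of_left (if_neg hm) _) fun h => absurd (Finset.mem_univ _) h).symm
      refine Eq.trans ?_ (congrArg (· * M.uMat g (e a) m) (if_pos rfl)).symm
      rw [hact]
      split_ifs with h
      · rw [h, Q.uMat_act, hcoeff]
      · rw [Q.uMat_of_ne g _ _ h, mul_zero, mul_zero])

/-- The projection of `M` onto `A` along an equivariant map of the summands. -/
def proj (hc : ∀ a, c a ≠ 0) (hact : ∀ g a, e (P.act g a) = Q.act g (e a))
    (hcoeff : ∀ g a, P.coeff g a * c (P.act g a) = c a * Q.coeff g (e a)) : M ⟶ A :=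
  mkHom ⟨Matrix.of fun m a => if m = e a then (c a)⁻¹ else 0, fun m a h => if_neg (by
    rintro rfl
    exact h (hlab a))⟩ (fun g => Matrix.ext fun m a => by
      refine (sum_uMat_mul Q g m fun m' => if m' = e a then (c a)⁻¹ else 0).trans ?_
      refine Eq.trans ?_ (Finset.sum_eq_single (P.act g a) (fun a' _ ha =>
        mul_eq_zero_of_right _ (P.uMat_of_ne g _ _ fun h => ha (by rw [h, P.act_act])))
          fun h => absurd (Finset.mem_univ _) h).symm
      have hu : A.uMat g (P.act g a) a = P.coeff g (P.act g a) := by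
        rw [← P.uMat_act, P.act_act]
      refine Eq.trans ?_ (congrArg ((if m = e (P.act g a) then (c (P.act g a))⁻¹ else 0) * ·)
        hu).symm
      have hiff : Q.act g m = e a ↔ m = e (P.act g a) := by
        rw [hact]
        exact ⟨fun h => by rw [← h, Q.act_act], fun h => by rw [h, Q.act_act]⟩
      -- The projection carries inverse scalars, so the compatibility is needed at the image of `a`,
      -- which `g` sends back to `a`.
      have h1 := hcoeff g (P.act g a)
      rw [P.act_act] at h1
      by_cases h : m = e (P.act g a)
      · rw [if_pos (hiff.2 h), if_pos h, h]
        have := hc a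
        have := hc (P.act g a)
        field_simp
        linear_combination -h1
      · rw [if_neg fun h' => h (hiff.1 h'), if_neg h, zero_mul, mul_zero])

theorem incl_proj (he : Function.Injective e) (hc : ∀ a, c a ≠ 0)
    (hact : ∀ g a, e (P.act g a) = Q.act g (e a))
    (hcoeff : ∀ g a, P.coeff g a * c (P.act g a) = c a * Q.coeff g (e a)) :
    incl P Q e hlab c hact hcoeff ≫ proj P Q e hlab c hc hact hcoeff = 𝟙 A := by
  refine EqObj.hom_ext (TY.hom_ext (Matrix.ext fun a a' => ?_))
  refine Eq.trans ?_ (mat_id_apply A.X a a').symm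
  refine (Finset.sum_eq_single (e a) (fun m _ hm => mul_eq_zero_of_left (if_neg hm) _)
    fun h => absurd (Finset.mem_univ _) h).trans ?_
  refine (congrArg (· * _) (if_pos rfl)).trans ?_
  by_cases h : a = a'
  · subst h
    exact (congrArg (_ * ·) (if_pos rfl)).trans ((mul_inv_cancel₀ (hc a)).trans (if_pos rfl).symm)
  · exact (congrArg (_ * ·) (if_neg fun h' => h (he h'))).trans
      ((mul_zero _).trans (if_neg h).symm)

end Maps

theorem incl_proj_of_disjoint {A B M : EqObj D} (P : Monomial A) (P' : Monomial B)
    (Q : Monomial M) (e : A.X.ι → M.X.ι) (hlab : ∀ a, M.X.lab (e a) = A.X.lab a)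
    (c : A.X.ι → ℂ) (e' : B.X.ι → M.X.ι) (hlab' : ∀ a, M.X.lab (e' a) = B.X.lab a)
    (c' : B.X.ι → ℂ) (he : ∀ a b, e a ≠ e' b) (hc' : ∀ b, c' b ≠ 0)
    (hact : ∀ g a, e (P.act g a) = Q.act g (e a))
    (hcoeff : ∀ g a, P.coeff g a * c (P.act g a) = c a * Q.coeff g (e a))
    (hact' : ∀ g a, e' (P'.act g a) = Q.act g (e' a))
    (hcoeff' : ∀ g a, P'.coeff g a * c' (P'.act g a) = c' a * Q.coeff g (e' a)) :
    incl P Q e hlab c hact hcoeff ≫ proj P' Q e' hlab' c' hc' hact' hcoeff' = 0 := by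
  refine EqObj.hom_ext (TY.hom_ext (Matrix.ext fun a b => ?_))
  refine Finset.sum_eq_zero fun m _ => ?_
  by_cases h : m = e a
  · exact mul_eq_zero_of_right _ (if_neg fun h' => he a b (h.symm.trans h'))
  · exact mul_eq_zero_of_left (if_neg h) _

/-- An equivariant bijection of the summands of `⨁ j, F j` with the summands of `M`, compatible
with the scalars, gives an isomorphism. -/
theorem nonempty_iso {J : Type*} [Fintype J] {F : J → EqObj D} {b : Bicone F} (hb : b.IsBilimit)
    (P : ∀ j, Monomial (F j)) {M : EqObj D} (Q : Monomial M) (e : ∀ j, (F j).X.ι → M.X.ι)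
    (he : Function.Bijective fun z : Σ j, (F j).X.ι => e z.1 z.2)
    (hlab : ∀ j a, M.X.lab (e j a) = (F j).X.lab a)
    (c : ∀ j, (F j).X.ι → ℂ) (hc : ∀ j a, c j a ≠ 0)
    (hact : ∀ j g a, e j ((P j).act g a) = Q.act g (e j a))
    (hcoeff : ∀ j g a, (P j).coeff g a * c j ((P j).act g a) = c j a * Q.coeff g (e j a)) :
    Nonempty (M ≅ b.pt) := by
  let B : Bicone F :=
    { pt := M
      π := fun j => proj (P j) Q (e j) (hlab j) (c j) (hc j) (hact j) (hcoeff j)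
      ι := fun j => incl (P j) Q (e j) (hlab j) (c j) (hact j) (hcoeff j)
      ι_π := fun j k => by
        by_cases h : j = k
        · subst h
          rw [dif_pos rfl]
          exact incl_proj _ _ _ _ _ (fun a a' h => by
            have := he.1 (a₁ := ⟨j, a⟩) (a₂ := ⟨j, a'⟩) h
            simpa using this) _ _ _
        · rw [dif_neg h]
          refine incl_proj_of_disjoint _ _ _ _ _ _ _ _ _ (fun a a' h' => h ?_) _ _ _ _ _
          exact congrArg Sigma.fst (he.1 (a₁ := ⟨j, a⟩) (a₂ := ⟨k, a'⟩) h') }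
  have hB : B.IsBilimit := by
    refine isBilimitOfTotal B (EqObj.hom_ext (TY.hom_ext ?_))
    refine (toHom_sum _ _).trans (Matrix.ext fun m m' => ?_)
    refine (Matrix.sum_apply _ _ _ _).trans ?_
    refine Eq.trans ?_ (mat_id_apply M.X m m').symm
    have h := Fintype.sum_sigma (fun z : (Σ j, (F j).X.ι) =>
      (if m = e z.1 z.2 then (c z.1 z.2)⁻¹ else 0) * (if m' = e z.1 z.2 then c z.1 z.2 else 0))
    refine h.symm.trans ?_
    -- By bijectivity exactly one summand `z` lies over `m`, and there the scalars of inclusion and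
    -- projection cancel.
    obtain ⟨z, hz⟩ := he.2 m
    refine (Finset.sum_eq_single z (fun y _ hy => mul_eq_zero_of_left (if_neg fun h' =>
      hy (he.1 (h'.symm.trans hz.symm))) _) fun h => absurd (Finset.mem_univ _) h).trans ?_
    rw [if_pos hz.symm]
    by_cases hm : m = m'
    · rw [if_pos (hm.symm.trans hz.symm), if_pos hm, inv_mul_cancel₀ (hc _ _)]
    · rw [if_neg fun h' => hm (hz.symm.trans h'.symm), if_neg hm, mul_zero]
  exact ⟨hB.isLimit.conePointUniqueUpToIso hb.isLimit⟩

end Monomial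

end EqObj

/-! ### Matching summands with one object or with a binary sum -/

namespace EqObj

theorem Monomial.nonempty_iso_single {A M : EqObj D} (P : Monomial A) (Q : Monomial M)
    (e : A.X.ι → M.X.ι) (he : Function.Bijective e) (hlab : ∀ a, M.X.lab (e a) = A.X.lab a)
    (c : A.X.ι → ℂ) (hc : ∀ a, c a ≠ 0) (hact : ∀ g a, e (P.act g a) = Q.act g (e a))
    (hcoeff : ∀ g a, P.coeff g a * c (P.act g a) = c a * Q.coeff g (e a)) :
    Nonempty (M ≅ A) := by
  let b : Bicone fun _ : Unit => A :=
    { pt := A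
      π := fun _ => 𝟙 A
      ι := fun _ => 𝟙 A
      ι_π := fun _ _ => by simp }
  refine nonempty_iso (b := b) (isBilimitOfTotal b (by simp [b])) (fun _ => P) Q (fun _ => e) ?_
    (fun _ => hlab) (fun _ => c) (fun _ => hc) (fun _ => hact) (fun _ => hcoeff)
  exact he.comp (Equiv.uniqueSigma fun _ : Unit => A.X.ι).bijective

theorem Monomial.nonempty_iso_biprod {A B M : EqObj D} (P : Monomial A) (P' : Monomial B)
    (Q : Monomial M) (e : A.X.ι → M.X.ι) (e' : B.X.ι → M.X.ι)
    (he : Function.Injective e) (he' : Function.Injective e') (hne : ∀ a b, e a ≠ e' b)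
    (hsurj : ∀ m, (∃ a, e a = m) ∨ ∃ b, e' b = m)
    (hlab : ∀ a, M.X.lab (e a) = A.X.lab a) (hlab' : ∀ b, M.X.lab (e' b) = B.X.lab b)
    (hact : ∀ g a, e (P.act g a) = Q.act g (e a)) (hact' : ∀ g b, e' (P'.act g b) = Q.act g (e' b))
    (hcoeff : ∀ g a, P.coeff g a = Q.coeff g (e a))
    (hcoeff' : ∀ g b, P'.coeff g b = Q.coeff g (e' b)) :
    Nonempty (M ≅ A ⊞ B) := by
  refine nonempty_iso (F := pairFunction A B) (b := (BinaryBiproduct.bicone A B).toBicone)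
    ((BinaryBicone.toBiconeIsBilimit _).symm (BinaryBiproduct.isBilimit A B))
    (fun j => match j with | .left => P | .right => P') Q
    (fun j => match j with | .left => e | .right => e') ?_
    (by rintro (_ | _); exacts [hlab, hlab']) (fun _ _ => 1) (fun _ _ => one_ne_zero)
    (by rintro (_ | _); exacts [hact, hact'])
    (by
      rintro (_ | _) g a
      · rw [mul_one, one_mul]; exact hcoeff g a
      · rw [mul_one, one_mul]; exact hcoeff' g a)
  constructor
  · rintro ⟨_ | _, a⟩ ⟨_ | _, b⟩ h
    · exact congrArg _ (he h)
    · exact absurd h (hne a b)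
    · exact absurd h.symm (hne b a)
    · exact congrArg _ (he' h)
  · intro m
    rcases hsurj m with ⟨a, h⟩ | ⟨b, h⟩
    · exact ⟨⟨.left, a⟩, h⟩
    · exact ⟨⟨.right, b⟩, h⟩

/-! ### The regular representation of `ℤ/2` on a fixed label -/

/-- The object `t ⊕ t`, where `-1` exchanges the summands. -/
def regular (D : Datum C) (t : Label C) (ht : ∀ g : ℤˣ, g • t = t) : EqObj D :=
  ofMat ⟨ULift.{u} ℤˣ, fun _ => t⟩
    (fun g => Matrix.of fun i j => if j = ⟨i.down * g⟩ then 1 else 0)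
    (fun g _ _ h => absurd (ht g) h)
    (Matrix.ext fun i j => by
      change (if j = ⟨i.down * 1⟩ then (1 : ℂ) else 0) = _
      rw [mul_one]
      by_cases h : i = j
      · exact (if_pos h.symm).trans ((mat_id_apply ⟨ULift.{u} ℤˣ, fun _ => t⟩ i j).trans
          (if_pos h)).symm
      · exact (if_neg fun h' => h h'.symm).trans ((mat_id_apply
          ⟨ULift.{u} ℤˣ, fun _ => t⟩ i j).trans (if_neg h)).symm)
    (fun g h => Matrix.ext fun i j => by
      rw [Matrix.mul_apply, Finset.sum_eq_single ⟨i.down * h⟩]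
      · simp [mul_assoc]
      · intro k _ hk
        exact mul_eq_zero_of_left (if_neg hk) _
      · exact fun h => absurd (Finset.mem_univ _) h)

section Regular

variable {t : Label C} {ht : ∀ g : ℤˣ, g • t = t}

/-- The action on the regular representation. -/
def Monomial.regular : Monomial (regular D t ht) where
  act g (x : ULift.{u} ℤˣ) := (⟨x.down * g⟩ : ULift.{u} ℤˣ)
  coeff _ _ := 1
  lab_act g _ := (ht g).symm
  act_act g (x : ULift.{u} ℤˣ) := ULift.ext _ _ (by
    change x.down * g * g = x.down
    rw [mul_assoc, Int.units_mul_self, mul_one])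
  uMat_act _ _ := if_pos rfl
  uMat_of_ne _ _ _ h := if_neg h

/-- Orthogonality of the two characters of `ℤ/2`; the factor 1/2 is the normalisation of
`regularProj`. -/
theorem sum_signChar (s s' : ℤˣ) :
    ∑ x : ULift.{u} ℤˣ, (signChar s x.down : ℂ) * ((signChar s' x.down : ℂ) / 2) =
      if s = s' then 1 else 0 := by
  refine (Fintype.sum_equiv Equiv.ulift _ (fun x : ℤˣ => (signChar s x : ℂ) *
    ((signChar s' x : ℂ) / 2)) fun _ => rfl).trans ?_
  rw [UnitsInt.univ, Finset.sum_pair (by decide),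
    signChar_neg_one, signChar_neg_one]
  rcases Int.units_eq_one_or s with rfl | rfl <;> rcases Int.units_eq_one_or s' with rfl | rfl
  · norm_num
  · rw [if_neg (by decide)]; norm_num
  · rw [if_neg (by decide)]; norm_num
  · norm_num

/-- The inclusion of an isotypic component of the regular representation. -/
def regularIncl (s : ℤˣ) : line D t ht s ⟶ regular D t ht :=
  mkHom ⟨Matrix.of fun _ (x : ULift.{u} ℤˣ) => (signChar s x.down : ℂ), fun _ _ h => absurd rfl h⟩
    fun g => Matrix.ext fun (i : PUnit) (x : ULift.{u} ℤˣ) => by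
      refine (Finset.sum_singleton _ _).trans ?_
      refine (congrArg (· * (signChar s x.down : ℂ)) (uMat_line s g _ _)).trans ?_
      have hx : (⟨x.down * g * g⟩ : ULift.{u} ℤˣ) = x := ULift.ext _ _ (by
        change x.down * g * g = x.down
        rw [mul_assoc, Int.units_mul_self, mul_one])
      have h : ∑ y : ULift.{u} ℤˣ, (signChar s y.down : ℂ) * (regular D t ht).uMat g y x =
          signChar s (x.down * g) := by
        rw [Finset.sum_eq_single (⟨x.down * g⟩ : ULift.{u} ℤˣ)]
        · exact (congrArg (_ * ·) (if_pos hx.symm)).trans (mul_one _)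
        · rintro y - hy
          refine mul_eq_zero_of_right _ (if_neg fun h => hy ?_)
          rw [h]
          exact ULift.ext _ _ (by rw [mul_assoc, Int.units_mul_self, mul_one])
        · exact fun h => absurd (Finset.mem_univ _) h
      refine Eq.trans ?_ h.symm
      rw [← Units.val_mul, signChar_mul, mul_comm]

/-- The projection to an isotypic component of the regular representation. -/
def regularProj (s : ℤˣ) : regular D t ht ⟶ line D t ht s :=
  mkHom ⟨Matrix.of fun (x : ULift.{u} ℤˣ) _ => (signChar s x.down : ℂ) / 2,
    fun _ _ h => absurd rfl h⟩
    fun g => Matrix.ext fun (x : ULift.{u} ℤˣ) (i : PUnit) => by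
      refine Eq.trans ?_ (Finset.sum_singleton _ _).symm
      refine Eq.trans ?_ (congrArg ((signChar s x.down : ℂ) / 2 * ·) (uMat_line s g _ _)).symm
      refine (Monomial.sum_uMat_mul Monomial.regular g x
        fun y : ULift.{u} ℤˣ => (signChar s y.down : ℂ) / 2).trans ?_
      change 1 * ((signChar s (x.down * g) : ℂ) / 2) = _
      rw [one_mul, ← signChar_mul, Units.val_mul]
      ring

theorem regularIncl_proj (s s' : ℤˣ) (i j : PUnit) :
    mat (toHom (regularIncl (ht := ht) (D := D) s ≫ regularProj s')) i j =
      if s = s' then 1 else 0 := sum_signChar s s'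

theorem regularIncl_proj_self (s : ℤˣ) :
    regularIncl (ht := ht) (D := D) s ≫ regularProj s = 𝟙 _ :=
  EqObj.hom_ext (TY.hom_ext (Matrix.ext fun (i : PUnit) (j : PUnit) =>
    (regularIncl_proj s s i j).trans ((if_pos rfl).trans (if_pos rfl).symm)))

theorem regularIncl_proj_of_ne {s s' : ℤˣ} (h : s ≠ s') :
    regularIncl (ht := ht) (D := D) s ≫ regularProj s' = 0 :=
  EqObj.hom_ext (TY.hom_ext (Matrix.ext fun (i : PUnit) (j : PUnit) =>
    (regularIncl_proj s s' i j).trans (if_neg h)))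

/-- The regular representation of `ℤ/2` is the sum of its two eigenlines, spanned by the characters.
It is not matched summand by summand with these lines, so it needs its own biproduct data. -/
theorem nonempty_regular_iso :
    Nonempty (regular D t ht ≅ line D t ht 1 ⊞ line D t ht (-1)) := by
  let b : BinaryBicone (line D t ht 1) (line D t ht (-1)) :=
    { pt := regular D t ht
      fst := regularProj 1
      snd := regularProj (-1)
      inl := regularIncl 1
      inr := regularIncl (-1)
      inl_fst := regularIncl_proj_self 1
      inl_snd := regularIncl_proj_of_ne (by decide)
      inr_fst := regularIncl_proj_of_ne (by decide)
      inr_snd := regularIncl_proj_self (-1) }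
  refine ⟨biprod.uniqueUpToIso _ _ (isBinaryBilimitOfTotal b (EqObj.hom_ext (TY.hom_ext
    (Matrix.ext fun (x : ULift.{u} ℤˣ) (y : ULift.{u} ℤˣ) => ?_))))⟩
  have h : ∀ s, mat (toHom (regularProj (ht := ht) (D := D) s ≫ regularIncl s)) x y =
      (signChar s x.down : ℂ) / 2 * signChar s y.down := fun s => Finset.sum_singleton _ _
  refine (congrArg₂ (· + ·) (h 1) (h (-1))).trans ?_
  refine Eq.trans ?_ (mat_id_apply (regular D t ht).X x y).symm
  obtain ⟨x⟩ := x
  obtain ⟨y⟩ := y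
  rcases Int.units_eq_one_or x with rfl | rfl <;> rcases Int.units_eq_one_or y with rfl | rfl
  · refine Eq.trans ?_ (if_pos rfl).symm
    simp
    norm_num
  · refine Eq.trans ?_ (if_neg fun h => ?_).symm
    · simp [signChar_neg_one]
    · exact absurd (congrArg (ULift.down (α := ℤˣ)) h) (by decide)
  · refine Eq.trans ?_ (if_neg fun h => ?_).symm
    · simp [signChar_neg_one]
      norm_num
    · exact absurd (congrArg (ULift.down (α := ℤˣ)) h) (by decide)
  · refine Eq.trans ?_ (if_pos rfl).symm
    simp [signChar_neg_one]
    norm_num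

end Regular

/-! ### Fusion rules -/

/-- The definition of `Yobj` makes sense at the unit too, where it is the regular representation on
`e`. The fusion rules can therefore be proved uniformly and the degenerate entries replaced
afterwards. -/
theorem nonempty_Ytable_iso (c : C) : Nonempty (Yobj D c ≅ Ytable D c) := by
  unfold Ytable
  split_ifs with h
  · subst h
    obtain ⟨i⟩ := Monomial.nonempty_iso_single (Monomial.regular (D := D) (t := elt 1)
      (ht := fun g => congrArg elt (one_zpow (g : ℤ)))) (Monomial.Y D 1)
      (fun x : ULift.{u} ℤˣ => x) Function.bijective_id
      (fun x => congrArg elt (one_zpow _)) (fun _ => 1) (fun _ => one_ne_zero) (fun _ _ => rfl)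
      (fun _ _ => mul_comm _ _)
    obtain ⟨j⟩ := nonempty_regular_iso (D := D) (t := elt 1)
      (ht := fun g => congrArg elt (one_zpow (g : ℤ)))
    exact ⟨i ≪≫ j⟩
  · exact ⟨Iso.refl _⟩

theorem fusion_Xobj_Xobj (s t : ℤˣ) : Nonempty (Xobj D s ⊗ Xobj D t ≅ Xobj D (s * t)) := by
  refine Monomial.nonempty_iso_single (Monomial.X D (s * t))
    ((Monomial.X D s).tensor (Monomial.X D t))
    (fun _ => (⟨PUnit.unit, PUnit.unit, elt 1, mul_one 1⟩ :
      TensorIdx (Xobj D s).X (Xobj D t).X)) ⟨fun _ _ _ => Subsingleton.elim (α := PUnit) _ _, ?_⟩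
    (fun _ => rfl) (fun _ => 1) (fun _ => one_ne_zero)
    (fun g _ => TensorIdx.ext rfl rfl (congrArg elt (one_zpow (g : ℤ)).symm)) (fun g _ => ?_)
  · rintro ⟨_, _, _ | _, h⟩
    · exact ⟨PUnit.unit, TensorIdx.ext rfl rfl (congrArg elt ((mul_one 1).symm.trans h))⟩
    · exact h.elim
  · change (signChar (s * t) g : ℂ) * 1 = 1 * (signChar s g * signChar t g)
    rw [signChar_mul_left, Units.val_mul, mul_comm]

theorem fusion_Xobj_Zobj (s t : ℤˣ) : Nonempty (Xobj D s ⊗ Zobj D t ≅ Zobj D (s * t)) := by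
  refine Monomial.nonempty_iso_single (Monomial.Z D (s * t))
    ((Monomial.X D s).tensor (Monomial.Z D t))
    (fun _ => (⟨PUnit.unit, PUnit.unit, sigma, trivial⟩ :
      TensorIdx (Xobj D s).X (Zobj D t).X)) ⟨fun _ _ _ => Subsingleton.elim (α := PUnit) _ _, ?_⟩
    (fun _ => rfl) (fun _ => 1) (fun _ => one_ne_zero)
    (fun g _ => rfl) (fun g _ => ?_)
  · rintro ⟨_, _, _ | _, h⟩
    · exact h.elim
    · exact ⟨PUnit.unit, rfl⟩
  · change (signChar (s * t) g : ℂ) * 1 = 1 * (signChar s g * signChar t g)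
    rw [signChar_mul_left, Units.val_mul, mul_comm]

theorem fusion_Zobj_Xobj (s t : ℤˣ) : Nonempty (Zobj D s ⊗ Xobj D t ≅ Zobj D (s * t)) := by
  refine Monomial.nonempty_iso_single (Monomial.Z D (s * t))
    ((Monomial.Z D s).tensor (Monomial.X D t))
    (fun _ => (⟨PUnit.unit, PUnit.unit, sigma, trivial⟩ :
      TensorIdx (Zobj D s).X (Xobj D t).X)) ⟨fun _ _ _ => Subsingleton.elim (α := PUnit) _ _, ?_⟩
    (fun _ => rfl) (fun _ => 1) (fun _ => one_ne_zero)
    (fun g _ => rfl) (fun g _ => ?_)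
  · rintro ⟨_, _, _ | _, h⟩
    · exact h.elim
    · exact ⟨PUnit.unit, rfl⟩
  · change (signChar (s * t) g : ℂ) * 1 = 1 * (signChar s g * signChar t g)
    rw [signChar_mul_left, Units.val_mul, mul_comm]

theorem zpow_units_mul (a : C) (s t : ℤˣ) : a ^ ((s * t : ℤˣ) : ℤ) = (a ^ (s : ℤ)) ^ (t : ℤ) := by
  rw [Units.val_mul, zpow_mul]

theorem fusion_Xobj_Yobj (s : ℤˣ) (b : C) : Nonempty (Xobj D s ⊗ Yobj D b ≅ Yobj D b) := by
  refine Monomial.nonempty_iso_single (Monomial.Y D b)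
    ((Monomial.X D s).tensor (Monomial.Y D b))
    (fun t : ULift.{u} ℤˣ => (⟨PUnit.unit, t, elt (b ^ (t.down : ℤ)), one_mul _⟩ :
      TensorIdx (Xobj D s).X (Yobj D b).X)) ⟨fun _ _ h => congrArg TensorIdx.right h, ?_⟩
    -- Rescaling the summand `t` by the character of `s` absorbs the sign by which the action on the
    -- product differs from that on `Yobj D b`.
    (fun _ => rfl) (fun t : ULift.{u} ℤˣ => signChar s t.down) (fun _ => Units.ne_zero _)
    (fun g (t : ULift.{u} ℤˣ) => TensorIdx.ext rfl rfl
      (congrArg elt (zpow_units_mul b t.down g))) (fun g (t : ULift.{u} ℤˣ) => ?_)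
  · rintro ⟨_, t, _ | _, h⟩
    · exact ⟨t, TensorIdx.ext rfl rfl (congrArg elt ((one_mul _).symm.trans h))⟩
    · exact h.elim
  · change 1 * (signChar s (t.down * g) : ℂ) = signChar s t.down * (signChar s g * 1)
    rw [← signChar_mul, Units.val_mul]
    ring

theorem fusion_Yobj_Xobj (a : C) (s : ℤˣ) : Nonempty (Yobj D a ⊗ Xobj D s ≅ Yobj D a) := by
  refine Monomial.nonempty_iso_single (Monomial.Y D a)
    ((Monomial.Y D a).tensor (Monomial.X D s))
    (fun t : ULift.{u} ℤˣ => (⟨t, PUnit.unit, elt (a ^ (t.down : ℤ)), mul_one _⟩ :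
      TensorIdx (Yobj D a).X (Xobj D s).X)) ⟨fun _ _ h => congrArg TensorIdx.left h, ?_⟩
    (fun _ => rfl) (fun t : ULift.{u} ℤˣ => signChar s t.down) (fun _ => Units.ne_zero _)
    (fun g (t : ULift.{u} ℤˣ) => TensorIdx.ext rfl rfl
      (congrArg elt (zpow_units_mul a t.down g))) (fun g (t : ULift.{u} ℤˣ) => ?_)
  · rintro ⟨t, _, _ | _, h⟩
    · exact ⟨t, TensorIdx.ext rfl rfl (congrArg elt ((mul_one _).symm.trans h))⟩
    · exact h.elim
  · change 1 * (signChar s (t.down * g) : ℂ) = signChar s t.down * (1 * signChar s g)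
    rw [← signChar_mul, Units.val_mul]
    ring

/-- The product consists of two copies of `σ` exchanged by the action. Once the sign `s` is absorbed
by rescaling, this is the regular representation on `σ`. -/
theorem fusion_Yobj_Zobj (a : C) (s : ℤˣ) :
    Nonempty (Yobj D a ⊗ Zobj D s ≅ Zobj D 1 ⊞ Zobj D (-1)) := by
  obtain ⟨j⟩ := nonempty_regular_iso (D := D) (t := sigma) (ht := fun _ => rfl)
  suffices h : Nonempty (Yobj D a ⊗ Zobj D s ≅ regular D sigma fun _ => rfl) from
    h.map fun i => i ≪≫ j
  refine Monomial.nonempty_iso_single Monomial.regular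
    ((Monomial.Y D a).tensor (Monomial.Z D s))
    (fun t : ULift.{u} ℤˣ => (⟨t, PUnit.unit, sigma, trivial⟩ :
      TensorIdx (Yobj D a).X (Zobj D s).X)) ⟨fun _ _ h => congrArg TensorIdx.left h, ?_⟩
    (fun _ => rfl) (fun t : ULift.{u} ℤˣ => signChar s t.down) (fun _ => Units.ne_zero _)
    (fun g t => rfl) (fun g (t : ULift.{u} ℤˣ) => ?_)
  · rintro ⟨t, _, _ | _, h⟩
    · exact h.elim
    · exact ⟨t, rfl⟩
  · change 1 * (signChar s (t.down * g) : ℂ) = signChar s t.down * (1 * signChar s g)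
    rw [← signChar_mul, Units.val_mul]
    ring

theorem fusion_Zobj_Yobj (s : ℤˣ) (a : C) :
    Nonempty (Zobj D s ⊗ Yobj D a ≅ Zobj D 1 ⊞ Zobj D (-1)) := by
  obtain ⟨j⟩ := nonempty_regular_iso (D := D) (t := sigma) (ht := fun _ => rfl)
  suffices h : Nonempty (Zobj D s ⊗ Yobj D a ≅ regular D sigma fun _ => rfl) from
    h.map fun i => i ≪≫ j
  refine Monomial.nonempty_iso_single Monomial.regular
    ((Monomial.Z D s).tensor (Monomial.Y D a))
    (fun t : ULift.{u} ℤˣ => (⟨PUnit.unit, t, sigma, trivial⟩ :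
      TensorIdx (Zobj D s).X (Yobj D a).X)) ⟨fun _ _ h => congrArg TensorIdx.right h, ?_⟩
    (fun _ => rfl) (fun t : ULift.{u} ℤˣ => signChar s t.down) (fun _ => Units.ne_zero _)
    (fun g t => rfl) (fun g (t : ULift.{u} ℤˣ) => ?_)
  · rintro ⟨_, t, _ | _, h⟩
    · exact h.elim
    · exact ⟨t, rfl⟩
  · change 1 * (signChar s (t.down * g) : ℂ) = signChar s t.down * (signChar s g * 1)
    rw [← signChar_mul, Units.val_mul]
    ring

theorem mul_inv_zpow_units (a b : C) (t : ℤˣ) :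
    a ^ (t : ℤ) * b ^ ((-t : ℤˣ) : ℤ) = (a * b⁻¹) ^ (t : ℤ) := by
  rw [mul_zpow, inv_zpow', Units.val_neg]

/-- The four summands are indexed by pairs of signs. Equal signs give the powers of ab and opposite
signs those of ab⁻¹, and the action flips both signs together. -/
theorem fusion_Yobj_Yobj (a b : C) :
    Nonempty (Yobj D a ⊗ Yobj D b ≅ Ytable D (a * b) ⊞ Ytable D (a * b⁻¹)) := by
  obtain ⟨i⟩ := nonempty_Ytable_iso (D := D) (a * b)
  obtain ⟨j⟩ := nonempty_Ytable_iso (D := D) (a * b⁻¹)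
  suffices h : Nonempty (Yobj D a ⊗ Yobj D b ≅ Yobj D (a * b) ⊞ Yobj D (a * b⁻¹)) from
    h.map fun k => k ≪≫ biprod.mapIso i j
  refine Monomial.nonempty_iso_biprod (Monomial.Y D (a * b)) (Monomial.Y D (a * b⁻¹))
    ((Monomial.Y D a).tensor (Monomial.Y D b))
    (fun t : ULift.{u} ℤˣ => (⟨t, t, elt ((a * b) ^ (t.down : ℤ)), (mul_zpow a b _).symm⟩ :
      TensorIdx (Yobj D a).X (Yobj D b).X))
    (fun t : ULift.{u} ℤˣ => (⟨t, (⟨-t.down⟩ : ULift.{u} ℤˣ), elt ((a * b⁻¹) ^ (t.down : ℤ)),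
      mul_inv_zpow_units a b t.down⟩ : TensorIdx (Yobj D a).X (Yobj D b).X))
    (fun _ _ h => congrArg TensorIdx.left h) (fun _ _ h => congrArg TensorIdx.left h)
    (fun (s : ULift.{u} ℤˣ) (t : ULift.{u} ℤˣ) h => ?_) ?_ (fun _ => rfl) (fun _ => rfl)
    (fun g (t : ULift.{u} ℤˣ) => TensorIdx.ext rfl rfl
      (congrArg elt (zpow_units_mul _ t.down g)))
    (fun g (t : ULift.{u} ℤˣ) => TensorIdx.ext rfl (ULift.ext _ _ (neg_mul _ _).symm)
      (congrArg elt (zpow_units_mul _ t.down g))) (fun _ _ => (mul_one _).symm)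
      (fun _ _ => (mul_one _).symm)
  · have h1 : s = t := congrArg TensorIdx.left h
    have h2 : s = (⟨-t.down⟩ : ULift.{u} ℤˣ) := congrArg TensorIdx.right h
    rw [h1, ULift.ext_iff] at h2
    exact absurd h2 (units_ne_neg_self _)
  · rintro ⟨(s : ULift.{u} ℤˣ), (t : ULift.{u} ℤˣ), c | _, h⟩
    · replace h : a ^ (s.down : ℤ) * b ^ (t.down : ℤ) = c := h
      rcases eq_or_ne t s with rfl | hst
      · exact Or.inl ⟨t, TensorIdx.ext rfl rfl (congrArg elt ((mul_zpow a b _).trans h))⟩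
      -- There are only two signs, so different ones are opposite.
      · have ht : t = (⟨-s.down⟩ : ULift.{u} ℤˣ) :=
          ULift.ext _ _ (Int.units_ne_iff_eq_neg.1 fun h => hst (ULift.ext _ _ h))
        subst ht
        exact Or.inr ⟨s, TensorIdx.ext rfl rfl
          (congrArg elt ((mul_inv_zpow_units a b _).symm.trans h))⟩
    · exact h.elim

/-- The bicone of `A ⊞ ⨁ F` over the summands `A` and `F j`. -/
def optionBicone {J : Type u} [Finite J] (A : EqObj D) (F : J → EqObj D) :
    Bicone fun o : Option J => o.elim A F where
  pt := A ⊞ ⨁ F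
  π o := match o with
    | none => biprod.fst
    | some j => biprod.snd ≫ biproduct.π F j
  ι o := match o with
    | none => biprod.inl
    | some j => biproduct.ι F j ≫ biprod.inr
  ι_π := by
    rintro (_ | j) (_ | k)
    · rw [dif_pos rfl]
      exact biprod.inl_fst (X := A) (Y := ⨁ F)
    · change biprod.inl (X := A) (Y := ⨁ F) ≫ biprod.snd ≫ biproduct.π F k = _
      rw [dif_neg (Option.some_ne_none k).symm, biprod.inl_snd_assoc, zero_comp]
      rfl
    · change (biproduct.ι F j ≫ biprod.inr (X := A) (Y := ⨁ F)) ≫ biprod.fst = _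
      rw [dif_neg (Option.some_ne_none j), Category.assoc, biprod.inr_fst, comp_zero]
      rfl
    · change (biproduct.ι F j ≫ biprod.inr (X := A) (Y := ⨁ F)) ≫ biprod.snd ≫
        biproduct.π F k = _
      rw [Category.assoc, biprod.inr_snd_assoc, biproduct.ι_π]
      by_cases h : j = k
      · rw [dif_pos h, dif_pos (congrArg some h)]
        rfl
      · rw [dif_neg h, dif_neg fun h' => h (Option.some.inj h')]
        rfl

/-- Regarding the sum as a biproduct of a single family lets `Monomial.nonempty_iso` treat the fixed
point and the free orbits of σ ⊗ σ together. -/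
theorem optionBicone_isBilimit {J : Type u} [Fintype J] (A : EqObj D) (F : J → EqObj D) :
    Nonempty (optionBicone A F).IsBilimit := by
  refine ⟨isBilimitOfTotal _ ?_⟩
  rw [Fintype.sum_option]
  change biprod.fst ≫ biprod.inl + ∑ j, (biprod.snd ≫ biproduct.π F j) ≫
    biproduct.ι F j ≫ biprod.inr = 𝟙 (A ⊞ ⨁ F)
  rw [← biprod.total]
  congr 1
  simp_rw [Category.assoc]
  rw [← Preadditive.comp_sum]
  simp_rw [← Category.assoc (biproduct.π F _)]
  rw [← Preadditive.sum_comp, IsBilimit.total (biproduct.isBilimit F), Category.id_comp]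

/-- On σ ⊗ σ the element -1 inverts the label with total sign `s * t`. As n is odd, only `e` is
fixed, and there the sign survives in `X`; on the free orbits it can be absorbed. -/
theorem fusion_Zobj_Zobj (hodd : Odd (Fintype.card C)) (s t : ℤˣ) :
    Nonempty (Zobj D s ⊗ Zobj D t ≅ Xobj D (s * t) ⊞ Ysum D) := by
  have : Fintype (YOrbit C) := Fintype.ofFinite _
  obtain ⟨hb⟩ := optionBicone_isBilimit (Xobj D (s * t)) fun o : YOrbit C => Yobj D o.out.1
  refine Monomial.nonempty_iso hb
    (fun o => match o with
      | none => Monomial.X D (s * t)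
      | some o => Monomial.Y D o.out.1)
    ((Monomial.Z D s).tensor (Monomial.Z D t))
    (fun o => match o with
      | none => fun _ => (⟨PUnit.unit, PUnit.unit, elt 1, trivial⟩ :
          TensorIdx (Zobj D s).X (Zobj D t).X)
      | some o => fun x : ULift.{u} ℤˣ => (⟨PUnit.unit, PUnit.unit,
          elt (o.out.1 ^ (x.down : ℤ)), trivial⟩ : TensorIdx (Zobj D s).X (Zobj D t).X)) ?_ ?_
    (fun o => match o with
      | none => fun _ => 1
      -- The rescaling that removes the sign `s * t` from a free orbit.
      | some o => fun x : ULift.{u} ℤˣ => signChar (s * t) x.down) ?_ ?_ ?_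
  · constructor
    · rintro ⟨_ | o, x⟩ ⟨_ | o', x'⟩ h
      · rfl
      · exact absurd (elt.inj (congrArg TensorIdx.out h)).symm (zpow_units_ne_one o'.out.2 _)
      · exact absurd (elt.inj (congrArg TensorIdx.out h)) (zpow_units_ne_one o.out.2 _)
      · obtain ⟨x⟩ := (x : ULift.{u} ℤˣ)
        obtain ⟨x'⟩ := (x' : ULift.{u} ℤˣ)
        -- Oddness is used here: an orbit has two different elements, so a label determines both its
        -- orbit and its sign.
        have h1 := (orbitEquiv hodd).injective (a₁ := (o, x)) (a₂ := (o', x'))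
          (Subtype.ext (elt.inj (congrArg TensorIdx.out h)))
        obtain ⟨rfl, rfl⟩ := Prod.mk.inj h1
        rfl
    · rintro ⟨_, _, c | _, h⟩
      · by_cases hc : c = 1
        · subst hc
          exact ⟨⟨none, PUnit.unit⟩, rfl⟩
        · obtain ⟨⟨o, x⟩, hx⟩ := (orbitEquiv hodd).surjective ⟨c, hc⟩
          exact ⟨⟨some o, (⟨x⟩ : ULift.{u} ℤˣ)⟩,
            TensorIdx.ext rfl rfl (congrArg elt (congrArg Subtype.val hx))⟩
      · exact h.elim
  · rintro (_ | o) x <;> rfl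
  · rintro (_ | o) x
    · exact one_ne_zero
    · exact Units.ne_zero _
  · rintro (_ | o) g x
    · exact TensorIdx.ext rfl rfl (congrArg elt (one_zpow (g : ℤ)).symm)
    · exact TensorIdx.ext rfl rfl (congrArg elt (zpow_units_mul _ _ g))
  · rintro (_ | o) g x
    · change (signChar (s * t) g : ℂ) * 1 = 1 * (signChar s g * signChar t g)
      rw [signChar_mul_left, Units.val_mul, mul_comm]
    · change 1 * (signChar (s * t) (ULift.down x * g) : ℂ) =
        signChar (s * t) (ULift.down x) * (signChar s g * signChar t g)
      rw [← signChar_mul, ← Units.val_mul (signChar s g), ← signChar_mul_left, Units.val_mul,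
        one_mul, mul_comm]

end EqObj

end TambaraYamagami

end

theorem mainTheorem6 {C : Type u} [CommGroup C] [Fintype C] (hodd : Odd (Fintype.card C))
    (D : Datum C) :
    -- the simple objects; X_+ and X_- are invertible
    (∀ s, Simple (Xobj D s)) ∧ (∀ s, Simple (Zobj D s)) ∧ (∀ a, a ≠ 1 → Simple (Yobj D a)) ∧
    (∀ M : EqObj D, Simple M → (∃ s, Nonempty (M ≅ Xobj D s)) ∨ (∃ s, Nonempty (M ≅ Zobj D s)) ∨
      ∃ a, a ≠ 1 ∧ Nonempty (M ≅ Yobj D a)) ∧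
    (∀ s, Nonempty (Xobj D s ⊗ Xobj D s ≅ 𝟙_ (EqObj D))) ∧
    -- isomorphisms between the simple objects
    (∀ s t, Nonempty (Xobj D s ≅ Xobj D t) ↔ s = t) ∧
    (∀ s t, Nonempty (Zobj D s ≅ Zobj D t) ↔ s = t) ∧
    (∀ a b, a ≠ 1 → b ≠ 1 → (Nonempty (Yobj D a ≅ Yobj D b) ↔ b = a ∨ b = a⁻¹)) ∧
    (∀ s t, IsEmpty (Xobj D s ≅ Zobj D t)) ∧
    (∀ s a, a ≠ 1 → IsEmpty (Xobj D s ≅ Yobj D a)) ∧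
    (∀ s a, a ≠ 1 → IsEmpty (Zobj D s ≅ Yobj D a)) ∧
    Nat.card (YOrbit C) = (Fintype.card C - 1) / 2 ∧
    -- dimensions
    (∀ s, dim (Xobj D s) = 1) ∧ (∀ a, a ≠ 1 → dim (Yobj D a) = 2) ∧
    (∀ s, dim (Zobj D s) = (Real.sqrt (Fintype.card C) : ℂ)) ∧
    -- unit, associators and unitors
    Xobj D 1 = 𝟙_ (EqObj D) ∧
    (∀ M N P : EqObj D, toHom (α_ M N P).hom = (α_ M.X N.X P.X).hom) ∧
    (∀ M : EqObj D, toHom (λ_ M).hom = (λ_ M.X).hom) ∧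
    (∀ M : EqObj D, toHom (ρ_ M).hom = (ρ_ M.X).hom) ∧
    -- fusion rules
    (∀ s t, Nonempty (Xobj D s ⊗ Xobj D t ≅ Xobj D (s * t))) ∧
    (∀ s b, b ≠ 1 → Nonempty (Xobj D s ⊗ Yobj D b ≅ Yobj D b)) ∧
    (∀ a s, a ≠ 1 → Nonempty (Yobj D a ⊗ Xobj D s ≅ Yobj D a)) ∧
    (∀ s t, Nonempty (Xobj D s ⊗ Zobj D t ≅ Zobj D (s * t))) ∧
    (∀ s t, Nonempty (Zobj D s ⊗ Xobj D t ≅ Zobj D (s * t))) ∧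
    (∀ a b, a ≠ 1 → b ≠ 1 →
      Nonempty (Yobj D a ⊗ Yobj D b ≅ Ytable D (a * b) ⊞ Ytable D (a * b⁻¹))) ∧
    (∀ a s, a ≠ 1 → Nonempty (Yobj D a ⊗ Zobj D s ≅ Zobj D 1 ⊞ Zobj D (-1))) ∧
    (∀ s a, a ≠ 1 → Nonempty (Zobj D s ⊗ Yobj D a ≅ Zobj D 1 ⊞ Zobj D (-1))) ∧
    (∀ s t, Nonempty (Zobj D s ⊗ Zobj D t ≅ Xobj D (s * t) ⊞ Ysum D)) ∧
    -- the braiding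
    ∃ B : BraidedCategory (EqObj D),
      (∀ M N : EqObj D, toHom (B.braiding M N).hom = braid M N) ∧
      (∀ s t, toHom (B.braiding (Xobj D s) (Xobj D t)).hom =
        swapHom (Xobj D s).X (Xobj D t).X id fun _ _ _ => 1) ∧
      (∀ s a, a ≠ 1 → toHom (B.braiding (Xobj D s) (Yobj D a)).hom =
        swapHom (Xobj D s).X (Yobj D a).X id fun _ _ _ => 1) ∧
      (∀ a s, a ≠ 1 → toHom (B.braiding (Yobj D a) (Xobj D s)).hom =
        swapHom (Yobj D a).X (Xobj D s).X id fun _ _ _ => 1) ∧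
      (∀ a b, a ≠ 1 → b ≠ 1 → toHom (B.braiding (Yobj D a) (Yobj D b)).hom =
        swapHom (Yobj D a).X (Yobj D b).X id fun (i k : ULift.{u} ℤˣ) _ =>
          if i.down = k.down then (D.χ a b : ℂ) else (D.χ a b⁻¹ : ℂ)) ∧
      (∀ s t, toHom (B.braiding (Zobj D s) (Xobj D t)).hom =
        swapHom (Zobj D s).X (Xobj D t).X id fun _ _ _ => 1) ∧
      (∀ s a, a ≠ 1 → toHom (B.braiding (Zobj D s) (Yobj D a)).hom =
        swapHom (Zobj D s).X (Yobj D a).X id fun _ _ _ => (D.q a : ℂ)⁻¹) ∧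
      (∀ a s, a ≠ 1 → toHom (B.braiding (Yobj D a) (Zobj D s)).hom =
        swapHom (Yobj D a).X (Zobj D s).X (fun t : ULift.{u} ℤˣ => ⟨-t.down⟩)
          fun _ _ _ => (D.q a : ℂ)⁻¹) ∧
      (∀ s t, toHom (B.braiding (Xobj D s) (Zobj D t)).hom =
        swapHom (Xobj D s).X (Zobj D t).X id fun _ _ _ => ((s : ℤ) : ℂ)) ∧
      (∀ s t, toHom (B.braiding (Zobj D s) (Zobj D t)).hom =
        swapHom (Zobj D s).X (Zobj D t).X id fun _ _ w => ((s : ℤ) : ℂ) * D.δ * qLabel D w) := by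
  refine ⟨simple_Xobj, simple_Zobj, fun a ha => simple_Yobj hodd ha,
    classification hodd, fun s => ?_, nonempty_Xobj_iso_iff,
    nonempty_Zobj_iso_iff, fun a b ha hb => nonempty_Yobj_iso_iff hodd ha hb,
    isEmpty_iso_Xobj_Zobj, fun s a ha => isEmpty_iso_Xobj_Yobj s ha,
    fun s a _ => isEmpty_iso_Zobj_Yobj s a, card_YOrbit hodd, dim_Xobj, fun a _ => dim_Yobj a,
    dim_Zobj, Xobj_one D, fun _ _ _ => rfl, fun _ => rfl, fun _ => rfl, fusion_Xobj_Xobj,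
    fun s b _ => fusion_Xobj_Yobj s b, fun a s _ => fusion_Yobj_Xobj a s, fusion_Xobj_Zobj,
    fusion_Zobj_Xobj, fun a b _ _ => fusion_Yobj_Yobj a b, fun a s _ => fusion_Yobj_Zobj a s,
    fun s a _ => fusion_Zobj_Yobj s a, fusion_Zobj_Zobj hodd, braided D, fun _ _ => rfl,
    braid_Xobj_Xobj, fun s a _ => braid_Xobj_Yobj s a, fun a s _ => braid_Yobj_Xobj a s,
    fun a b _ _ => braid_Yobj_Yobj a b, braid_Zobj_Xobj, fun s a _ => braid_Zobj_Yobj s a,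
    fun a s _ => braid_Yobj_Zobj a s, braid_Xobj_Zobj, braid_Zobj_Zobj⟩
  -- Each `X` is its own inverse, since signs square to 1 and `Xobj D 1` is the unit.
  have h := fusion_Xobj_Xobj (D := D) s s
  rwa [Int.units_mul_self, Xobj_one] at h
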